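/- **Setting.** Fix $\alpha>0$, $\hbar>0$, $\xi\in\mathbb R$. For a particle mass $m\ge 0$ put $\mu^2=m^2+6\xi/\alpha^2$ and $M^2=\alpha^2\mu^2/\hbar^2$. A mass is *in range* if $M^2>0$ and *admissible* if moreover $M^2\ne1$ (principal series: $M^2>1$; complementary series: $0<M^2<1$). Let $\nu=-\tfrac12\pm\sqrt{1-M^2}$ with $\operatorname{Re}\nu\ge-\tfrac12$ (either root if $M^2>1$, the larger one if $M^2<1$). The Ferrers function $T_\nu^\sigma$ is the analytic continuation to $\mathbb C\setminus((-\infty,-1]\cup[1,\infty))$ of $$\frac{\Gamma(\nu+\sigma+1)}{\Gamma(\nu-\sigma+1)\Gamma(1+\sigma)}\Big(\frac{1-z}{1+z}\Big)^{\sigma/2}{}_2F_1\Big(-\nu,\nu+1;1+\sigma;\frac{1-z}2\Big),\qquad |z-1|<2 .$$ Put $\gamma_l=\Gamma(-\nu-l-\frac12)\Gamma(\nu-l+\frac12)$; $N(\nu)=1,-i,i$ according as $\operatorname{Im}\nu=0$, $>0$, $<0$; $a(t)=\alpha\cosh(t/\alpha)$; $$\tau_l(t)=\frac{N(\nu)\,T_\nu^{l+1/2}(i\sinh(t/\alpha))}{\sqrt{\cosh(t/\alpha)}},\qquad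 \omega_l^{dS}(t)=\frac1{|\gamma_l|\,|T_\nu^{l+1/2}(i\sinh(t/\alpha))|^2}.$$ Let $Y_l^m$ be the orthonormal spherical harmonics (Condon–Shortley phase), $l\in\mathbb N_0$, $-l\le m\le l$. The positive-energy modes of the Klein–Gordon equation on the three-dimensional de Sitter space of radius $\alpha$ are $u_{l,m}(t,\theta,\varphi)=\sqrt{|\gamma_l|/2\alpha}\;\tau_l(t)\,Y_l^m(\theta,\varphi)$. They are orthonormal for the form $$\langle f,g\rangle=i\,a(t)^2\int_{S^2}\big(f^*\partial_tg-(\partial_tf^*)g\big)\,d\Omega ,$$ and $\mathcal H$ is the Hilbert space with orthonormal basis $u_{l,m}$; $\phi\in\mathcal H$ with coefficients $\phi_{l,m}$ is identified with the solution $\phi(t,\cdot)=\sum\phi_{l,m}u_{l,m}(t,\cdot)$, which converges in $L^2(S^2)$ for every $t$ and determines $\phi$. Spatial rotations, the parities $P_i$ ($X^i\mapsto-X^i$) and the time reversal $(T\phi)(t,x)=\phi(-t,x)^*$ map $\mathcal H$ to itself. **Postulates.** A localization system is a family of unitary maps $W_t=W_t^{(m)}:\mathcal H\to L^2(S^2)$,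 for $t\in\mathbb R$ and admissible $m$, such that: - **I.** for all $t,t'\in\mathbb R$ and $h\in L^2(S^2)$, the slice $(W_t^{-1}h)(t',\cdot)\in L^2(S^2)$ depends continuously on the mass, in the sense that it extends to a continuous function of $m$ on the set of all masses in range (including the one with $M^2=1$); - **II.** $W_tU(\lambda)=R(\lambda)W_t$ for all rotations about the three coordinate axes, where $U(\lambda)$ acts on solutions and $R(\lambda)$ on $L^2(S^2)$; - **III.** $W_t(P_i\phi)$ is the reflection of $W_t\phi$ under $X^i\mapsto-X^i$ for $i=1,2,3$, and $W_t(T\phi)=(W_{-t}\phi)^*$; - **IV.** for every $t$ there is a positive function $f_t(m)$ of the mass such that $\|W_t\phi-f_t(m)\,\phi(t,\cdot)\|_{L^2(S^2)}\to0$ as $m\to\infty$, for every $\phi\in\mathcal H$ with coefficients $\phi_{l,m}$ independent of the mass. **Theorem.** 1. For every localization system and every admissible mass there are $s_l(t)\in\mathbb C$ with $W_t(u_{l,m})=s_l(t)Y_l^m$, $|s_l(t)|=1$, $s_l(-t)=s_l(t)^*$ and $s_l(0)=(-1)^l$, for all $l,m,t$. 2. Consequently $W_0$, and with it the Newton–Wigner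 position operator $W_0^{-1}\,\hat r_j\,W_0$ at time $0$ ($j=1,2,3$; $\hat r=(\sin\theta\cos\varphi,\sin\theta\sin\varphi,\cos\theta)$), is the same for all localization systems, at every admissible mass. 3. The family $$W_t(\phi)=\sum_{l,m}\sqrt{2a(t)\,\omega_l^{dS}(t)}\;\phi_{l,m}\,\sqrt{\frac{|\gamma_l|}{2\alpha}}\;\tau_l(t)\,Y_l^m$$ is a localization system (in particular for both the principal and the complementary series). Here $T_\nu^{l+1/2}(i\sinh(t/\alpha))\neq0$ and $W_t(u_{l,m})=e^{-i\zeta_l(t)}Y_l^m$ with a differentiable function $\zeta_l:\mathbb R\to\mathbb R$ such that $\zeta_l(t)\equiv-\arg\tau_l(t)\pmod{2\pi}$ and $\zeta_l'(t)=\omega_l^{dS}(t)/a(t)$. 4. For this family the position operators $\hat X^j_t=W_t^{-1}\hat r_jW_t$ are, for all $t$ and $\phi\in\mathcal H$, with convergence in $L^2(S^2)$, $$[\hat X^j_t\phi](t,\cdot)=\sum_{p,s}\sum_{l,m}(-1)^s\phi_{l,m}e^{-i\zeta_l(t)}\sqrt{\frac{(2l+1)(2p+1)}{2a(t)\omega_p^{dS}(t)}}\begin{pmatrix}1&l&p\\0&0&0\end{pmatrix}D^j_{l,m;p,s}\,Y_p^s,$$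 where, with Wigner $3$-$j$ symbols $c_q=\begin{pmatrix}1&l&p\\q&m&-s\end{pmatrix}$, $D^1=(c_{-1}-c_1)/\sqrt2$, $D^2=i(c_{-1}+c_1)/\sqrt2$, $D^3=c_0$. -/

import Mathlib

open MeasureTheory Filter Topology
open scoped ComplexConjugate

noncomputable section

namespace DeSitter

/-! ### The sphere, its symmetries, and the square-integrable functions on it -/

/-- Euclidean three-space, with coordinates `x 0, x 1, x 2` for `X¹, X², X³`. -/
abbrev Space := EuclideanSpace ℝ (Fin 3)

/-- The unit sphere `S²`. -/
abbrev Sphere := Metric.sphere (0 : Space) 1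

/-- The surface measure `sin θ dθ dφ` of the unit sphere (total mass `4π`). -/
abbrev sphereMeasure : Measure Sphere := (volume : Measure Space).toSphere

/-- The Hilbert space `L²(S²)`. -/
abbrev L2Sphere := Lp ℂ 2 sphereMeasure

/-- The action of an orthogonal transformation on the sphere. -/
def sphereMap (g : Space ≃ₗᵢ[ℝ] Space) (x : Sphere) : Sphere := ⟨g x, by simp⟩

open scoped Pointwise in
theorem sphereMap_measurePreserving (g : Space ≃ₗᵢ[ℝ] Space) :
    MeasurePreserving (sphereMap g) sphereMeasure sphereMeasure := by
  have hc : Continuous (sphereMap g) := by unfold sphereMap; fun_prop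
  refine ⟨hc.measurable, ?_⟩
  ext s hs
  rw [Measure.map_apply hc.measurable hs, Measure.toSphere_apply' _ (hc.measurable hs),
    Measure.toSphere_apply' _ hs]
  congr 1
  have hg := (g.measurePreserving).measure_preimage_equiv (f := g.toMeasurableEquiv)
    (Set.Ioo (0 : ℝ) 1 • (Subtype.val '' s))
  rw [← hg]
  congr 1
  ext x
  simp only [Set.mem_smul, Set.mem_image, Set.mem_preimage]
  constructor
  · rintro ⟨r, hr, _, ⟨y, hy, rfl⟩, rfl⟩
    exact ⟨r, hr, _, ⟨_, hy, rfl⟩, by simp [sphereMap]⟩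
  · rintro ⟨r, hr, _, ⟨y, hy, rfl⟩, h⟩
    refine ⟨r, hr, _, ⟨sphereMap g.symm y, ?_, rfl⟩, ?_⟩
    · convert hy; ext1; simp [sphereMap]
    · apply g.injective
      simpa [sphereMap] using h

/-- The action `(g f)(x) = f (g⁻¹ x)` of an orthogonal transformation on `L²(S²)`. -/
def sphereAct (g : Space ≃ₗᵢ[ℝ] Space) : L2Sphere →ₗᵢ[ℂ] L2Sphere :=
  Lp.compMeasurePreservingₗᵢ ℂ (sphereMap g.symm) (sphereMap_measurePreserving g.symm)

/-- The counterclockwise rotation by the angle `θ` about the `i`-th coordinate axis. -/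
def axisRotation (i : Fin 3) (θ : ℝ) : Space ≃ₗᵢ[ℝ] Space :=
  LinearIsometry.toLinearIsometryEquiv
    { toFun := fun x => WithLp.toLp 2 fun j =>
        if j = i then x i
        else if j = i + 1 then Real.cos θ * x (i + 1) - Real.sin θ * x (i + 2)
        else Real.sin θ * x (i + 1) + Real.cos θ * x (i + 2)
      map_add' := by
        intro x y; ext j; fin_cases i <;> fin_cases j <;> simp <;> ring
      map_smul' := by
        intro c x; ext j; fin_cases i <;> fin_cases j <;> simp <;> ring
      norm_map' := by
        intro x
        simp only [EuclideanSpace.norm_eq]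
        congr 1
        have h := Real.sin_sq_add_cos_sq θ
        fin_cases i <;> simp [Fin.sum_univ_three] <;> grind } rfl

/-- The parity transformation `X^i ↦ -X^i`. -/
def coordReflection (i : Fin 3) : Space ≃ₗᵢ[ℝ] Space :=
  LinearIsometryEquiv.piLpCongrRight 2 fun j =>
    if j = i then LinearIsometryEquiv.neg ℝ else LinearIsometryEquiv.refl ℝ ℝ

/-- The `j`-th component of the unit vector `r̂ = (sin θ cos φ, sin θ sin φ, cos θ)`. -/
def coordinate (j : Fin 3) : C(Sphere, ℂ) := ⟨fun x => ((x : Space) j : ℂ), by fun_prop⟩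

/-- Multiplication by the `j`-th component of `r̂` on `L²(S²)`. -/
def coordMul (j : Fin 3) : L2Sphere →ₗ[ℂ] L2Sphere where
  toFun f := ((coordinate j).toLp ⊤ sphereMeasure ℂ : Lp ℂ ⊤ sphereMeasure) • f
  map_add' f g := Lp.add_smul _ f g
  map_smul' a f := (Lp.smul_comm a _ f).symm

/-! ### Spherical harmonics -/

/-- The pairs `(l, m)` with `l ∈ ℕ₀`, `m ∈ ℤ` and `-l ≤ m ≤ l`. -/
abbrev Idx := {p : ℕ × ℤ // |p.2| ≤ (p.1 : ℤ)}

/-- The `k`-th derivative of the Legendre polynomial `P_l`, by the formula of Rodrigues. -/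
def legendreDeriv (l k : ℕ) : Polynomial ℝ :=
  Polynomial.C (1 / (2 ^ l * (l.factorial : ℝ))) *
    Polynomial.derivative^[l + k] ((Polynomial.X ^ 2 - 1) ^ l)

/-- The orthonormal spherical harmonic `Y_l^m` (Condon-Shortley phase). With
`x = (sin θ cos φ, sin θ sin φ, cos θ)` and `k = |m|`, one has
`sin^k θ e^{± i k φ} = (x₁ ± i x₂)^k`, and `Y_l^{-m} = (-1)^m conj Y_l^m`. -/
def sphHarmonic (l : ℕ) (m : ℤ) : C(Sphere, ℂ) :=
  ⟨fun x =>
    ((Real.sqrt ((2 * l + 1) / (4 * Real.pi) *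
        ((l - m.natAbs).factorial / (l + m.natAbs).factorial)) *
      (legendreDeriv l m.natAbs).eval ((x : Space) 2) : ℝ) : ℂ) *
    (if 0 ≤ m then
      (-1) ^ m.natAbs * (((x : Space) 0 : ℂ) + Complex.I * ((x : Space) 1 : ℂ)) ^ m.natAbs
    else (((x : Space) 0 : ℂ) - Complex.I * ((x : Space) 1 : ℂ)) ^ m.natAbs), by
    split_ifs <;> fun_prop⟩

/-- `Y_l^m` as an element of `L²(S²)`. -/
def Y (p : Idx) : L2Sphere := (sphHarmonic p.1.1 p.1.2).toLp 2 sphereMeasure ℂ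

/-! ### Mass, degree, Ferrers functions and energy modes -/

/-- `M² = α² μ² / ħ²`, where `μ² = m² + ξ R` and `R = 6 / α²`. -/
def massSq (α ħ ξ m : ℝ) : ℝ := α ^ 2 * (m ^ 2 + ξ * (6 / α ^ 2)) / ħ ^ 2

/-- The particle masses with `M² > 0`. -/
def massRange (α ħ ξ : ℝ) : Set ℝ := {m | 0 ≤ m ∧ 0 < massSq α ħ ξ m}

/-- The particle masses with `M² > 0` and `M² ≠ 1`; the principal series is `M² > 1`, the
complementary series is `0 < M² < 1`. -/
def admissibleMass (α ħ ξ : ℝ) : Set ℝ := {m ∈ massRange α ħ ξ | massSq α ħ ξ m ≠ 1}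

/-- `ν = -1/2 ± √(1 - M²)` with `Re ν ≥ -1/2`: either root in the principal series, the larger
one in the complementary series. -/
def IsDegree (Msq : ℝ) (ν : ℂ) : Prop :=
  (ν + 1 / 2) ^ 2 = 1 - (Msq : ℂ) ∧ -(1 / 2) ≤ ν.re

/-- The complex plane cut along `(-∞, -1] ∪ [1, ∞)`. -/
def cutPlane : Set ℂ := {z | z.im ≠ 0 ∨ |z.re| < 1}

/-- The hypergeometric expression of the Ferrers function `T_ν^σ`, for `|z - 1| < 2`. -/
def ferrersSeries (ν σ z : ℂ) : ℂ :=
  Complex.Gamma (ν + σ + 1) / (Complex.Gamma (ν - σ + 1) * Complex.Gamma (1 + σ)) *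
    ((1 - z) / (1 + z)) ^ (σ / 2) *
    ordinaryHypergeometric (-ν) (ν + 1) (1 + σ) ((1 - z) / 2)

open Classical in
/-- The Ferrers function `T_ν^σ`: the analytic continuation of `ferrersSeries ν σ` from
the part of the disc `|z - 1| < 2` off the cuts to the whole cut plane. -/
def ferrersT (ν σ : ℂ) : ℂ → ℂ :=
  if h : ∃ f : ℂ → ℂ, DifferentiableOn ℂ f cutPlane ∧
      Set.EqOn f (ferrersSeries ν σ) (cutPlane ∩ Metric.ball 1 2)
  then h.choose else 0

/-- The phase `N(ν)`: `1` for real `ν`, `-i` for `Im ν > 0`, `i` for `Im ν < 0`. -/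
def phaseN (ν : ℂ) : ℂ :=
  if ν.im = 0 then 1 else if 0 < ν.im then -Complex.I else Complex.I

/-- `|γ_l| = |Γ(-ν - l - 1/2) Γ(ν - l + 1/2)|`. -/
def gammaAbs (ν : ℂ) (l : ℕ) : ℝ :=
  ‖Complex.Gamma (-ν - l - 1 / 2) * Complex.Gamma (ν - l + 1 / 2)‖

/-- `T_ν^{l+1/2}(i sinh (t/α))`. -/
def timeT (α : ℝ) (ν : ℂ) (l : ℕ) (t : ℝ) : ℂ :=
  ferrersT ν (l + 1 / 2) (Complex.I * (Real.sinh (t / α) : ℂ))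

/-- `N(ν) T_ν^{l+1/2}(i sinh (t/α)) / √cosh(t/α)`. -/
def timeFactor (α : ℝ) (ν : ℂ) (l : ℕ) (t : ℝ) : ℂ :=
  phaseN ν * timeT α ν l t / (Real.sqrt (Real.cosh (t / α)) : ℂ)

/-- The time-dependent factor `√(|γ_l| / 2α) N(ν) T_ν^{l+1/2}(i sinh (t/α)) / √cosh(t/α)` of the
positive-energy mode `u_{l,m}`. -/
def radial (α : ℝ) (ν : ℂ) (l : ℕ) (t : ℝ) : ℂ :=
  (Real.sqrt (gammaAbs ν l / (2 * α)) : ℂ) * timeFactor α ν l t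

/-- The positive-energy mode `u_{l,m}(t, x)`. -/
def mode (α : ℝ) (ν : ℂ) (p : Idx) (t : ℝ) (x : Sphere) : ℂ :=
  radial α ν p.1.1 t * sphHarmonic p.1.1 p.1.2 x

/-- The radius `a(t) = α cosh(t/α)` of the time slice. -/
def scale (α t : ℝ) : ℝ := α * Real.cosh (t / α)

/-- `ω_l^{dS}(t) = 1 / (|γ_l| |T_ν^{l+1/2}(i sinh(t/α))|²)`. -/
def omegaDS (α : ℝ) (ν : ℂ) (l : ℕ) (t : ℝ) : ℝ :=
  1 / (gammaAbs ν l * ‖timeT α ν l t‖ ^ 2)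

/-! ### The Klein-Gordon form and the one-particle space -/

/-- The Klein-Gordon form
`⟨f, g⟩ = i a(t)² ∫_{S²} (f^* ∂_t g - (∂_t f^*) g)` on the slice at time `t`. -/
def kgForm (α t : ℝ) (f g : ℝ → Sphere → ℂ) : ℂ :=
  Complex.I * (scale α t : ℂ) ^ 2 *
    ∫ x, (conj (f t x) * deriv (fun s => g s x) t
      - deriv (fun s => conj (f s x)) t * g t x) ∂sphereMeasure

/-- The one-particle space `ℋ`, the completion of the span of the positive-energy modes for the
Klein-Gordon form, written in its orthonormal basis `u_{l,m}`: the vector `φ` is the family of its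
coefficients `φ_{l,m}`, and `field` gives the corresponding solution. -/
abbrev OneParticle := lp (fun _ : Idx => ℂ) 2

open Classical in
/-- The vector `u_{l,m}` of `ℋ`. -/
def modeVec (p : Idx) : OneParticle := lp.single 2 p 1

/-- The restriction `φ(t, ·) = ∑ φ_{l,m} u_{l,m}(t, ·)` to the time slice at `t` of the solution
with coefficients `φ`. -/
def field (α : ℝ) (ν : ℂ) (φ : OneParticle) (t : ℝ) : L2Sphere :=
  ∑' p : Idx, (φ p * radial α ν p.1.1 t) • Y p

/-! ### The localizability postulates -/

/-- The localizability postulates for a family `W m t : ℋ → L²(S²)` of unitary transformations,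
where `m` is the particle mass, `t` the time, and `ν m` the degree at mass `m`. -/
structure LocalizationPostulates (α ħ ξ : ℝ) (ν : ℝ → ℂ)
    (W : ℝ → ℝ → (OneParticle ≃ₗᵢ[ℂ] L2Sphere)) : Prop where
  /-- I: the solution `W_t⁻¹ h` depends continuously on the particle mass; the value `M = 1`, where
  the modes are not defined, is crossed by continuous extension. -/
  mass_continuity : ∀ (t : ℝ) (h : L2Sphere) (t' : ℝ), ∃ G : ℝ → L2Sphere,
    ContinuousOn G (massRange α ħ ξ) ∧
    ∀ m ∈ admissibleMass α ħ ξ, G m = field α (ν m) ((W m t).symm h) t'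
  /-- II: if `ψ = U(θ) φ` is the rotated solution, then `W_t ψ = R(θ) (W_t φ)`. -/
  rotation : ∀ m ∈ admissibleMass α ħ ξ, ∀ (i : Fin 3) (θ : ℝ) (φ ψ : OneParticle),
    (∀ t, field α (ν m) ψ t = sphereAct (axisRotation i θ) (field α (ν m) φ t)) →
    ∀ t, W m t ψ = sphereAct (axisRotation i θ) (W m t φ)
  /-- III for the parities: if `ψ = P_i φ`, then `W_t ψ` is the reflection of `W_t φ`. -/
  parity : ∀ m ∈ admissibleMass α ħ ξ, ∀ (i : Fin 3) (φ ψ : OneParticle),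
    (∀ t, field α (ν m) ψ t = sphereAct (coordReflection i) (field α (ν m) φ t)) →
    ∀ t, W m t ψ = sphereAct (coordReflection i) (W m t φ)
  /-- III for time reversal: if `ψ(t, x) = φ(-t, x)^*`, then `W_t ψ = (W_{-t} φ)^*`. -/
  time_reversal : ∀ m ∈ admissibleMass α ħ ξ, ∀ φ ψ : OneParticle,
    (∀ t, field α (ν m) ψ t = star (field α (ν m) φ (-t))) →
    ∀ t, W m t ψ = star (W m (-t) φ)
  /-- IV: in the large mass limit, `W_t φ` is proportional to `φ(t, ·)` with a positive
  normalization factor that depends only on the mass (and on `t`). -/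
  large_mass : ∀ t : ℝ, ∃ f : ℝ → ℝ, (∀ m, 0 < f m) ∧ ∀ φ : OneParticle,
    Tendsto (fun m => ‖W m t φ - (f m : ℂ) • field α (ν m) φ t‖) atTop (𝓝 0)

/-- The `j`-th component `W⁻¹ ∘ r̂_j ∘ W` on `ℋ` of the Newton-Wigner position operator. -/
def positionOp (W : OneParticle ≃ₗᵢ[ℂ] L2Sphere) (j : Fin 3) : OneParticle →ₗ[ℂ] OneParticle :=
  W.symm.toLinearEquiv.toLinearMap ∘ₗ coordMul j ∘ₗ W.toLinearEquiv.toLinearMap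

/-! ### Wigner 3-j symbols -/

/-- The Wigner 3-j symbol `(a b c; p q r)` for integral angular momenta, by the Racah formula. The
sum runs over those `k` for which all the arguments of factorials are non-negative. -/
def wigner3j (a b c : ℕ) (p q r : ℤ) : ℝ :=
  if p + q + r = 0 ∧ a ≤ b + c ∧ b ≤ a + c ∧ c ≤ a + b ∧ |p| ≤ a ∧ |q| ≤ b ∧ |r| ≤ c then
    (-1) ^ ((a : ℤ) - b - r) *
    Real.sqrt (((a + b - c).factorial * (a + c - b).factorial * (b + c - a).factorial : ℝ) /
      (a + b + c + 1).factorial) *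
    Real.sqrt ((a + p).toNat.factorial * (a - p).toNat.factorial * (b + q).toNat.factorial *
      (b - q).toNat.factorial * (c + r).toNat.factorial * (c - r).toNat.factorial) *
    ∑ k ∈ (Finset.range (a + b + 1)).filter (fun k : ℕ =>
        (k : ℤ) ≤ a + b - c ∧ (k : ℤ) ≤ a - p ∧ (k : ℤ) ≤ b + q ∧
        0 ≤ (c : ℤ) - b + p + k ∧ 0 ≤ (c : ℤ) - a - q + k),
      (-1 : ℝ) ^ k / (k.factorial * ((a : ℤ) + b - c - k).toNat.factorial *
        (a - p - k).toNat.factorial * (b + q - k).toNat.factorial *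
        ((c : ℤ) - b + p + k).toNat.factorial * ((c : ℤ) - a - q + k).toNat.factorial)
  else 0

/-- The 3-j symbols `(1 l p; q m -s)` combined as the components of `r̂` are combined from
`Y_1^{-1}, Y_1^0, Y_1^1`. -/
def dipole3j (j : Fin 3) (l p : ℕ) (m s : ℤ) : ℂ :=
  match j with
  | 0 => ((wigner3j 1 l p (-1) m (-s) - wigner3j 1 l p 1 m (-s)) / Real.sqrt 2 : ℝ)
  | 1 => Complex.I * ((wigner3j 1 l p (-1) m (-s) + wigner3j 1 l p 1 m (-s)) / Real.sqrt 2 : ℝ)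
  | 2 => (wigner3j 1 l p 0 m (-s) : ℝ)

end DeSitter

end

open DeSitter

noncomputable section

namespace DeSitter

/-! ### Recurrences for derivatives of Legendre polynomials -/

/-! Write κ = ν + 1/2, y = κ² = 1 - M² and η = t/α. Once a factor 1/cosh η is removed, the time
factor of a mode solves G'' = (y - l(l+1)/cosh²η) G. This potential is reflectionless: the operator
-i(d/dη - (l+1) tanh η) carries solutions for l to solutions for l + 1, and sin(κ(π/2 - iη))/κ is a
solution for l = 0. Accordingly the Ferrers functions of half-integral order are elementary. The
case l = 0 is a closed form of ₂F₁ with third parameter 3/2 (`two_mul_sin_mul_hypergeometric`), a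
contiguous relation raises l (`ferrersSeries_succ`), and the identity theorem spreads the formula
over the cut plane (`ferrersT_eq`). The Gamma factors collapse in the same way
(`modeNorm_eq_gammaAbs`), and N(ν) removes the phase of κ. What remains, `modeRadial`, depends on y
alone and is continuous for y < 1, also through the excluded point y = 0, where M² = 1.

The recursion in l then gives every property of the modes that is needed: a constant Wronskian
(`wronskian`), hence orthonormality, absence of zeros and the speed of the phase; the symmetry conj
G(-η) = G(η); the sign (-1)^l at η = 0 (`mode_at_zero`); bounds uniform in l from a decreasing
energy (`modeSq_le_of_one_le`); and |G_l|/|G_0| → 1 after normalization as the mass grows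
(`tendsto_modeSq_div`).

Uniqueness. Postulate II and Schur's lemma (`inner_Y_map_Y`) leave only one phase s_l(t) for each
degree. The modes u_{l,0} are fixed by time reversal, so s_l(-t) = conj s_l(t) and s_l(0) = ±1. By
postulate I this sign is continuous on the connected set of masses in range, hence constant; for
large mass postulate IV forces the sign of u_{l,0} at time 0, which is (-1)^l (`phase_at_zero`).

Existence. The explicit W_t replaces the time factor R_l(t) by its phase R_l/|R_l|. It acts by a
scalar on each degree, so it commutes with all orthogonal transformations, and the reflection
symmetry of R_l handles time reversal. Postulates I and IV are statements about multipliers that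
converge for each l and are bounded uniformly in l; dominated convergence in ℓ² applies
(`tendsto_multiplier`). The Wronskian identifies the phase velocity with ω/a (`exp_modeAngle`).

Position operators. The matrix elements of r̂_j between spherical harmonics come from the
recurrences of Legendre polynomials and are matched with the Racah formula (`inner_Y_coordMul_Y`).
This matrix has at most nine nonzero entries per row, which is why the double series converges
unconditionally (`summable_smul_of_banded`). -/

open Polynomial in
/-- The `n`-th derivative of `(X² - 1)^l / (2^l l!)`. -/
def rodrigues (l n : ℕ) : Polynomial ℝ :=
  C (1 / (2 ^ l * (l.factorial : ℝ))) * derivative^[n] ((X ^ 2 - 1) ^ l)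

section Legendre
open Polynomial

theorem legendreDeriv_eq_rodrigues (l k : ℕ) : legendreDeriv l k = rodrigues l (l + k) := rfl

theorem derivative_rodrigues (l n : ℕ) : derivative (rodrigues l n) = rodrigues l (n + 1) := by
  simp [rodrigues, Function.iterate_succ_apply']

theorem rodrigues_succ_one (l : ℕ) : rodrigues (l + 1) 1 = X * rodrigues l 0 := by
  have h : (1 / (2 ^ (l + 1) * ((l + 1).factorial : ℝ))) * (2 * (l + 1)) =
      1 / (2 ^ l * (l.factorial : ℝ)) := by
    rw [Nat.factorial_succ]; push_cast; field_simp; try ring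
  have hC := congrArg (C : ℝ → ℝ[X]) h
  simp only [rodrigues, Function.iterate_one, Function.iterate_zero, id_eq, derivative_pow,
    derivative_sub, derivative_one, derivative_X, Nat.add_sub_cancel]
  rw [← hC]
  simp only [map_mul, map_add, map_ofNat, map_natCast, map_one]
  push_cast
  ring_nf

/-- This is `rodrigues_succ_one` differentiated n + 1 times; Leibniz' rule leaves two terms because
X'' = 0. -/
theorem rodrigues_succ (l n : ℕ) :
    rodrigues (l + 1) (n + 2) = X * rodrigues l (n + 1) + ((n : ℝ[X]) + 1) * rodrigues l n := by
  induction n with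
  | zero =>
    rw [← derivative_rodrigues, rodrigues_succ_one, derivative_mul, derivative_rodrigues]
    simp; ring
  | succ n ih =>
    rw [← derivative_rodrigues, ih]
    simp only [derivative_add, derivative_mul, derivative_X, derivative_rodrigues,
      derivative_natCast, derivative_one]
    push_cast; ring

theorem sq_sub_one_mul_rodrigues (l : ℕ) :
    (X ^ 2 - 1) * rodrigues l 1 = 2 * (l : ℝ[X]) * X * rodrigues l 0 := by
  cases l with
  | zero => simp [rodrigues]
  | succ l =>
    simp only [rodrigues, Function.iterate_one, Function.iterate_zero, id_eq, derivative_pow,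
      derivative_sub, derivative_one, derivative_X, Nat.add_sub_cancel]
    push_cast
    ring_nf
    rw [show (C (1 + (l : ℝ)) : ℝ[X]) = 1 + (l : ℝ[X]) by simp]
    simp only [map_ofNat]
    ring

theorem rodrigues_zero_succ (n : ℕ) : rodrigues 0 (n + 1) = 0 := by simp [rodrigues]

/-- For n = 0, split X² = (X² - 1) + 1 in the second derivative and absorb the factor X² - 1 into
the next power; the general case follows by differentiation. -/
theorem rodrigues_add_two (l n : ℕ) :
    rodrigues (l + 2) (n + 2) = (2 * (l : ℝ[X]) + 3) * rodrigues (l + 1) n + rodrigues l n := by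
  induction n with
  | zero =>
    rw [rodrigues_succ, rodrigues_succ_one]
    have h : (2 * ((l : ℝ[X]) + 1)) * rodrigues (l + 1) 0 = (X ^ 2 - 1) * rodrigues l 0 := by
      have h : (1 / (2 ^ (l + 1) * ((l + 1).factorial : ℝ))) * (2 * (l + 1)) =
          1 / (2 ^ l * (l.factorial : ℝ)) := by
        rw [Nat.factorial_succ]; push_cast; field_simp; try ring
      have hC := congrArg (C : ℝ → ℝ[X]) h
      simp only [rodrigues, Function.iterate_zero, id_eq]
      rw [← hC]
      simp only [map_mul, map_add, map_ofNat, map_natCast, map_one]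
      ring
    linear_combination (-1 : ℝ[X]) * h
  | succ n ih =>
    rw [← derivative_rodrigues, ih]
    simp only [derivative_add, derivative_mul, derivative_rodrigues, derivative_natCast,
      derivative_ofNat]
    ring

/-- The first-order equation of (X² - 1)^l in `sq_sub_one_mul_rodrigues`, differentiated n + 1
times. At n = l + k it is the differential equation of the k-th derivative of P_l. -/
theorem rodrigues_ode (l n : ℕ) :
    (X ^ 2 - 1) * rodrigues l (n + 2) + 2 * ((n : ℝ[X]) + 1) * X * rodrigues l (n + 1)
      + (n : ℝ[X]) * ((n : ℝ[X]) + 1) * rodrigues l n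
      = 2 * (l : ℝ[X]) * (X * rodrigues l (n + 1) + ((n : ℝ[X]) + 1) * rodrigues l n) := by
  induction n with
  | zero =>
    have h := congrArg derivative (sq_sub_one_mul_rodrigues l)
    simp only [derivative_mul, derivative_sub, derivative_pow, derivative_X, derivative_one,
      derivative_rodrigues, derivative_natCast, derivative_ofNat] at h
    simp only [Nat.cast_ofNat, map_ofNat] at h
    push_cast
    linear_combination h
  | succ n ih =>
    have h := congrArg derivative ih
    simp only [derivative_mul, derivative_add, derivative_sub, derivative_pow, derivative_X,
      derivative_one, derivative_rodrigues, derivative_natCast, derivative_ofNat] at h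
    simp only [Nat.cast_ofNat, map_ofNat] at h
    push_cast
    linear_combination h

theorem legendreDeriv_eq_zero {l k : ℕ} (h : l < k) : legendreDeriv l k = 0 := by
  rw [legendreDeriv, iterate_derivative_eq_zero, mul_zero]
  have h1 : natDegree ((X : ℝ[X]) ^ 2 - 1) ≤ 2 := by
    rw [show (1 : ℝ[X]) = C 1 from rfl, natDegree_X_pow_sub_C]
  calc _ ≤ l * natDegree ((X : ℝ[X]) ^ 2 - 1) := natDegree_pow_le
    _ ≤ l * 2 := by gcongr
    _ < l + k := by omega

theorem derivative_legendreDeriv (l k : ℕ) :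
    derivative (legendreDeriv l k) = legendreDeriv l (k + 1) := by
  rw [legendreDeriv_eq_rodrigues, derivative_rodrigues]; rfl

/-- In this and the next recurrences the truncated l - 1 is harmless at l = 0: the term it produces
vanishes, either through its coefficient or because P_0 is constant. -/
theorem legendreDeriv_mul (l k : ℕ) :
    (2 * (l : ℝ[X]) + 1) * legendreDeriv l k =
      legendreDeriv (l + 1) (k + 1) - legendreDeriv (l - 1) (k + 1) := by
  simp only [legendreDeriv_eq_rodrigues]
  cases l with
  | zero =>
    simp only [Nat.zero_sub, zero_add]
    rw [show 1 + (k + 1) = k + 2 by ring, rodrigues_succ 0 k, rodrigues_zero_succ]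
    cases k with
    | zero => simp
    | succ k => simp [rodrigues_zero_succ]
  | succ l =>
    rw [show l + 1 + 1 + (k + 1) = (l + 1 + k) + 2 by ring, rodrigues_add_two,
      show l + 1 - 1 + (k + 1) = l + 1 + k by simp; ring]
    push_cast; ring

theorem X_mul_legendreDeriv (l k : ℕ) :
    (2 * (l : ℝ[X]) + 1) * (X * legendreDeriv l k) =
      ((l : ℝ[X]) + 1 - (k : ℝ[X])) * legendreDeriv (l + 1) k
        + ((l : ℝ[X]) + (k : ℝ[X])) * legendreDeriv (l - 1) k := by
  by_cases h0 : l + k = 0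
  · obtain ⟨rfl, rfl⟩ : l = 0 ∧ k = 0 := by omega
    simp [legendreDeriv_eq_rodrigues, rodrigues_succ_one]
  obtain ⟨n, hn⟩ : ∃ n, l + k = n + 1 := ⟨l + k - 1, by omega⟩
  have hn' : (l : ℝ[X]) + k = n + 1 := by exact_mod_cast hn
  have h1 : legendreDeriv (l + 1) k = X * legendreDeriv l k + ((l : ℝ[X]) + (k : ℝ[X])) * rodrigues l n := by
    rw [legendreDeriv_eq_rodrigues, legendreDeriv_eq_rodrigues,
      show l + 1 + k = n + 2 by omega, rodrigues_succ, hn, hn']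
  cases l with
  | zero =>
    cases k with
    | zero => simp at h0
    | succ k =>
      rw [legendreDeriv_eq_zero (l := 0) (by omega)] at h1 ⊢
      cases k with
      | zero => simp
      | succ k => simp [legendreDeriv_eq_zero (l := 1) (show 1 < k + 1 + 1 by omega)]
  | succ l =>
    have h2 : legendreDeriv (l + 2) k = (2 * (l : ℝ[X]) + 3) * rodrigues (l + 1) n
        + legendreDeriv l k := by
      rw [legendreDeriv_eq_rodrigues, legendreDeriv_eq_rodrigues,
        show l + 2 + k = n + 2 by omega, rodrigues_add_two, show l + k = n by omega]
    simp only [Nat.add_sub_cancel]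
    push_cast at h1 ⊢
    rw [show l + 1 + 1 = l + 2 by ring] at h1 ⊢
    linear_combination (-(2 * (l : ℝ[X]) + 3)) * h1 + ((l : ℝ[X]) + 1 + k) * h2

theorem legendreDeriv_ode (l k : ℕ) :
    (1 - X ^ 2) * legendreDeriv l (k + 2) =
      2 * ((k : ℝ[X]) + 1) * X * legendreDeriv l (k + 1)
        - ((l : ℝ[X]) + (k : ℝ[X]) + 1) * ((l : ℝ[X]) - (k : ℝ[X])) * legendreDeriv l k := by
  have h := rodrigues_ode l (l + k)
  simp only [legendreDeriv_eq_rodrigues]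
  simp only [← add_assoc]
  push_cast at h
  linear_combination (-1 : ℝ[X]) * h

theorem one_sub_sq_mul_legendreDeriv (l k : ℕ) :
    (2 * (l : ℝ[X]) + 1) * ((1 - X ^ 2) * legendreDeriv l (k + 1)) =
      ((l : ℝ[X]) + (k : ℝ[X])) * ((l : ℝ[X]) + (k : ℝ[X]) + 1) * legendreDeriv (l - 1) k
        - ((l : ℝ[X]) - (k : ℝ[X])) * ((l : ℝ[X]) - (k : ℝ[X]) + 1) * legendreDeriv (l + 1) k := by
  cases l with
  | zero =>
    cases k with
    | zero => simp [legendreDeriv_eq_zero]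
    | succ k =>
      cases k with
      | zero => simp [legendreDeriv_eq_zero]
      | succ k => simp [legendreDeriv_eq_zero]
  | succ l =>
    have h1 := rodrigues_ode (l + 1) (l + k)
    have h2 := rodrigues_add_two l (l + k)
    have h3 := X_mul_legendreDeriv (l + 1) k
    simp only [legendreDeriv_eq_rodrigues] at h3 ⊢
    simp only [Nat.add_sub_cancel] at h3 ⊢
    rw [show l + 1 + (k + 1) = l + k + 2 by ring, show l + 1 + 1 + k = l + k + 2 by ring]
    rw [show l + 1 + 1 + k = l + k + 2 by ring, show l + 1 + k = l + k + 1 by ring] at h3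
    push_cast at h1 h3 ⊢
    linear_combination (-(2 * (l : ℝ[X]) + 3)) * h1 + (-(2 * (k : ℝ[X]))) * (-h3) + ((l:ℝ[X]) + k + 1) * ((l:ℝ[X]) - k + 2) * h2

end Legendre

/-! ### Products of spherical harmonics with the coordinates -/

/-- All ratios of normalization constants below are obtained from this by checking a rational
identity between the squares. -/
theorem sqrt_mul_sqrt_eq {A B C d : ℝ} (hA : 0 ≤ A) (hd : 0 ≤ d) (h : A * B = C * d ^ 2) :
    √A * √B = √C * d := by
  rw [← Real.sqrt_mul hA, h, Real.sqrt_mul' _ (sq_nonneg d), Real.sqrt_sq hd]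

/-- The normalization constant of `Y_l^{±k}`. -/
def harmonicNorm (l k : ℕ) : ℝ :=
  √((2 * l + 1) / (4 * Real.pi) * ((l - k).factorial / (l + k).factorial))

theorem sphere_sum_sq (x : Sphere) :
    ((x : Space) 0) ^ 2 + ((x : Space) 1) ^ 2 + ((x : Space) 2) ^ 2 = 1 := by
  have h : ‖(x : Space)‖ = 1 := by simp
  rw [EuclideanSpace.norm_eq, Real.sqrt_eq_one, Fin.sum_univ_three] at h
  simpa using h

/-- The function `x₁ + i x₂` on the sphere. -/
def planeCoord (x : Sphere) : ℂ := ((x : Space) 0 : ℂ) + Complex.I * ((x : Space) 1 : ℂ)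

theorem conj_planeCoord (x : Sphere) :
    conj (planeCoord x) = ((x : Space) 0 : ℂ) - Complex.I * ((x : Space) 1 : ℂ) := by
  simp [planeCoord, sub_eq_add_neg]

theorem planeCoord_mul_conj (x : Sphere) :
    planeCoord x * conj (planeCoord x) = 1 - ((x : Space) 2 : ℂ) ^ 2 := by
  have h := sphere_sum_sq x
  rw [conj_planeCoord, planeCoord]
  have h' : ((x : Space) 0 : ℂ) ^ 2 + ((x : Space) 1 : ℂ) ^ 2 + ((x : Space) 2 : ℂ) ^ 2 = 1 := by
    have := congrArg Complex.ofReal h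
    push_cast at this
    exact this
  linear_combination h' - ((x : Space) 1 : ℂ) ^ 2 * Complex.I_sq

/-- The value of the `k`-th derivative of `P_l` at `x₃`. -/
def legendreAt (l k : ℕ) (x : Sphere) : ℂ := ((legendreDeriv l k).eval ((x : Space) 2) : ℝ)

theorem sphHarmonic_natCast (l k : ℕ) (x : Sphere) :
    sphHarmonic l k x = harmonicNorm l k * legendreAt l k x * ((-1) ^ k * planeCoord x ^ k) := by
  simp [sphHarmonic, harmonicNorm, legendreAt, planeCoord]

theorem sphHarmonic_neg_natCast (l k : ℕ) (x : Sphere) :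
    sphHarmonic l (-k) x = harmonicNorm l k * legendreAt l k x * conj (planeCoord x) ^ k := by
  rcases Nat.eq_zero_or_pos k with rfl | hk
  · simpa using sphHarmonic_natCast l 0 x
  · have : ¬ (0 ≤ -(k : ℤ)) := by omega
    simp only [sphHarmonic, harmonicNorm, legendreAt, conj_planeCoord, ContinuousMap.coe_mk,
      Int.natAbs_neg, Int.natAbs_natCast, if_neg this]
    push_cast; rfl

theorem neg_one_zpow_mul_self (m : ℤ) : (-1 : ℂ) ^ m * (-1 : ℂ) ^ m = 1 := by
  rw [← mul_zpow]; simp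

theorem conj_legendreAt (l k : ℕ) (x : Sphere) : conj (legendreAt l k x) = legendreAt l k x :=
  Complex.conj_ofReal _

theorem conj_sphHarmonic (l : ℕ) (m : ℤ) (x : Sphere) :
    conj (sphHarmonic l m x) = (-1) ^ m * sphHarmonic l (-m) x := by
  obtain ⟨k, rfl | rfl⟩ := m.eq_nat_or_neg
  · rw [sphHarmonic_neg_natCast, sphHarmonic_natCast]
    simp [conj_legendreAt]; ring
  · rw [neg_neg, sphHarmonic_neg_natCast, sphHarmonic_natCast]
    have h := neg_one_zpow_mul_self (k : ℤ)
    simp only [zpow_natCast] at h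
    rw [zpow_neg, zpow_natCast, ← inv_pow, show (-1 : ℂ)⁻¹ = -1 by norm_num]
    simp [conj_legendreAt]
    linear_combination (-(harmonicNorm l k : ℂ) * legendreAt l k x * planeCoord x ^ k) * h

theorem sphHarmonic_eq_zero {l : ℕ} {m : ℤ} (h : (l : ℤ) < |m|) : sphHarmonic l m = 0 := by
  rw [Int.abs_eq_natAbs] at h
  ext x
  have h' : legendreDeriv l m.natAbs = 0 := legendreDeriv_eq_zero (by omega)
  simp [sphHarmonic, h']

theorem legendreAt_mul (l k : ℕ) (x : Sphere) :
    (2 * l + 1) * legendreAt l k x = legendreAt (l + 1) (k + 1) x - legendreAt (l - 1) (k + 1) x := by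
  have h := congrArg (Polynomial.eval ((x : Space) 2)) (legendreDeriv_mul l k)
  simp at h
  simp only [legendreAt]; exact_mod_cast h

theorem coord_mul_legendreAt (l k : ℕ) (x : Sphere) :
    (2 * l + 1) * (((x : Space) 2 : ℂ) * legendreAt l k x) =
      (l + 1 - k) * legendreAt (l + 1) k x + (l + k) * legendreAt (l - 1) k x := by
  have h := congrArg (Polynomial.eval ((x : Space) 2)) (X_mul_legendreDeriv l k)
  simp at h
  simp only [legendreAt]; exact_mod_cast h

theorem legendreAt_ode (l k : ℕ) (x : Sphere) :
    (1 - ((x : Space) 2 : ℂ) ^ 2) * legendreAt l (k + 2) x =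
      2 * (k + 1) * ((x : Space) 2 : ℂ) * legendreAt l (k + 1) x
        - (l + k + 1) * (l - k) * legendreAt l k x := by
  have h := congrArg (Polynomial.eval ((x : Space) 2)) (legendreDeriv_ode l k)
  simp at h
  simp only [legendreAt]; exact_mod_cast h

theorem one_sub_sq_mul_legendreAt (l k : ℕ) (x : Sphere) :
    (2 * l + 1) * ((1 - ((x : Space) 2 : ℂ) ^ 2) * legendreAt l (k + 1) x) =
      (l + k) * (l + k + 1) * legendreAt (l - 1) k x
        - (l - k) * (l - k + 1) * legendreAt (l + 1) k x := by
  have h := congrArg (Polynomial.eval ((x : Space) 2)) (one_sub_sq_mul_legendreDeriv l k)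
  simp at h
  simp only [legendreAt]; exact_mod_cast h

theorem legendreAt_eq_zero {l k : ℕ} (h : l < k) (x : Sphere) : legendreAt l k x = 0 := by
  simp [legendreAt, legendreDeriv_eq_zero h]

/-- Coefficient of `Y_{l+1}^m` in `x₃ Y_l^m`. -/
def upZero (l m : ℝ) : ℝ := √((l + 1 - m) * (l + 1 + m) / ((2 * l + 1) * (2 * l + 3)))
/-- Coefficient of `Y_{l-1}^m` in `x₃ Y_l^m`. -/
def downZero (l m : ℝ) : ℝ := √((l - m) * (l + m) / ((2 * l - 1) * (2 * l + 1)))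
/-- Coefficient of `Y_{l+1}^{m+1}` in `-(x₁ + i x₂) / √2 Y_l^m`. -/
def upOne (l m : ℝ) : ℝ := √((l + 1 + m) * (l + 2 + m) / (2 * ((2 * l + 1) * (2 * l + 3))))
/-- Negative of the coefficient of `Y_{l-1}^{m+1}` in `-(x₁ + i x₂) / √2 Y_l^m`. -/
def downOne (l m : ℝ) : ℝ := √((l - m) * (l - m - 1) / (2 * ((2 * l - 1) * (2 * l + 1))))
/-- The ladder coefficient `√((l - m) (l + m + 1))`. -/
def ladder (l m : ℝ) : ℝ := √((l - m) * (l + m + 1))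

theorem harmonicNorm_upZero {l k : ℕ} (h : k ≤ l) :
    harmonicNorm (l + 1) k * upZero l k = harmonicNorm l k * ((l + 1 - k) / (2 * l + 1)) := by
  obtain ⟨n, rfl⟩ := Nat.exists_eq_add_of_le h
  refine sqrt_mul_sqrt_eq (by positivity) ?_ ?_
  · push_cast; rw [show (k : ℝ) + n + 1 - k = n + 1 by ring]; positivity
  · rw [show k + n + 1 - k = n + 1 by omega, show k + n - k = n by omega,
      show k + n + 1 + k = (k + n + k) + 1 by ring, Nat.factorial_succ, Nat.factorial_succ]
    push_cast
    have := Real.pi_pos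
    field_simp
    ring

theorem harmonicNorm_downZero {l k : ℕ} (h : k ≤ l) :
    harmonicNorm l k * downZero (l + 1) k
      = harmonicNorm (l + 1) k * ((l + 1 + k) / (2 * (l + 1) + 1)) := by
  obtain ⟨n, rfl⟩ := Nat.exists_eq_add_of_le h
  refine sqrt_mul_sqrt_eq (by positivity) (by positivity) ?_
  · rw [show k + n + 1 - k = n + 1 by omega, show k + n - k = n by omega,
      show k + n + 1 + k = (k + n + k) + 1 by ring, Nat.factorial_succ, Nat.factorial_succ]
    push_cast
    have := Real.pi_pos
    rw [show 2 * ((k : ℝ) + n + 1) - 1 = 2 * (k + n) + 1 by ring]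
    field_simp
    ring

theorem harmonicNorm_upOne {l k : ℕ} (h : k ≤ l) :
    harmonicNorm (l + 1) (k + 1) * upOne l k = harmonicNorm l k * (1 / (√2 * (2 * l + 1))) := by
  obtain ⟨n, rfl⟩ := Nat.exists_eq_add_of_le h
  refine sqrt_mul_sqrt_eq (by positivity) (by positivity) ?_
  · rw [show k + n + 1 - (k + 1) = n by omega, show k + n - k = n by omega,
      show k + n + 1 + (k + 1) = (k + n + k) + 1 + 1 by ring, Nat.factorial_succ,
      Nat.factorial_succ, div_pow, mul_pow √2, Real.sq_sqrt (by norm_num)]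
    push_cast
    have := Real.pi_pos
    field_simp
    ring

theorem harmonicNorm_downOne {l k : ℕ} (h : k + 1 ≤ l) :
    harmonicNorm l (k + 1) * downOne (l + 1) k
      = harmonicNorm (l + 1) k * (1 / (√2 * (2 * (l + 1) + 1))) := by
  obtain ⟨n, rfl⟩ := Nat.exists_eq_add_of_le h
  refine sqrt_mul_sqrt_eq (by positivity) (by positivity) ?_
  · rw [show k + 1 + n - (k + 1) = n by omega, show k + 1 + n + 1 - k = n + 1 + 1 by omega,
      show k + 1 + n + (k + 1) = k + 1 + n + 1 + k by ring, Nat.factorial_succ,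
      Nat.factorial_succ, div_pow, mul_pow √2, Real.sq_sqrt (by norm_num)]
    push_cast
    have := Real.pi_pos
    rw [show 2 * ((k : ℝ) + 1 + n + 1) - 1 = 2 * (k + n) + 3 by ring]
    field_simp
    ring

theorem harmonicNorm_upOne_neg {l k : ℕ} (h : k + 1 ≤ l) :
    harmonicNorm (l + 1) k * upOne l (-(k + 1))
      = harmonicNorm l (k + 1) * ((l - k) * (l - k + 1) / (√2 * (2 * l + 1))) := by
  obtain ⟨n, rfl⟩ := Nat.exists_eq_add_of_le h
  refine sqrt_mul_sqrt_eq (by positivity) ?_ ?_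
  · push_cast; rw [show (k : ℝ) + 1 + n - k = n + 1 by ring]; positivity
  · rw [show k + 1 + n - (k + 1) = n by omega, show k + 1 + n + 1 - k = n + 1 + 1 by omega,
      show k + 1 + n + (k + 1) = k + 1 + n + 1 + k by ring, Nat.factorial_succ,
      Nat.factorial_succ, div_pow, mul_pow √2, Real.sq_sqrt (by norm_num)]
    push_cast
    have := Real.pi_pos
    field_simp
    ring

theorem harmonicNorm_downOne_neg {l k : ℕ} (h : k ≤ l) :
    harmonicNorm l k * downOne (l + 1) (-(k + 1))
      = harmonicNorm (l + 1) (k + 1) *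
        ((l + 1 + k) * (l + 1 + k + 1) / (√2 * (2 * (l + 1) + 1))) := by
  obtain ⟨n, rfl⟩ := Nat.exists_eq_add_of_le h
  refine sqrt_mul_sqrt_eq (by positivity) (by positivity) ?_
  · rw [show k + n + 1 - (k + 1) = n by omega, show k + n - k = n by omega,
      show k + n + 1 + (k + 1) = (k + n + k) + 1 + 1 by ring, Nat.factorial_succ,
      Nat.factorial_succ, div_pow, mul_pow √2, Real.sq_sqrt (by norm_num)]
    push_cast
    have := Real.pi_pos
    rw [show 2 * ((k : ℝ) + n + 1) - 1 = 2 * (k + n) + 1 by ring]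
    field_simp
    ring

theorem harmonicNorm_ladder {l k : ℕ} (h : k + 1 ≤ l) :
    harmonicNorm l (k + 1) * ladder l k = harmonicNorm l k := by
  obtain ⟨n, rfl⟩ := Nat.exists_eq_add_of_le h
  rw [← mul_one (harmonicNorm (k + 1 + n) k)]
  refine sqrt_mul_sqrt_eq (by positivity) (by positivity) ?_
  rw [show k + 1 + n - (k + 1) = n by omega, show k + 1 + n - k = n + 1 by omega,
    show k + 1 + n + (k + 1) = k + 1 + n + k + 1 by ring, Nat.factorial_succ,
    Nat.factorial_succ]
  push_cast
  have := Real.pi_pos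
  field_simp
  ring

theorem harmonicNorm_ladder' {l k : ℕ} (h : k + 1 ≤ l) :
    harmonicNorm l k * ladder l k = harmonicNorm l (k + 1) * ((l + k + 1) * (l - k)) := by
  obtain ⟨n, rfl⟩ := Nat.exists_eq_add_of_le h
  refine sqrt_mul_sqrt_eq (by positivity) ?_ ?_
  · push_cast; rw [show (k : ℝ) + 1 + n - k = n + 1 by ring]; positivity
  rw [show k + 1 + n - (k + 1) = n by omega, show k + 1 + n - k = n + 1 by omega,
    show k + 1 + n + (k + 1) = k + 1 + n + k + 1 by ring, Nat.factorial_succ,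
    Nat.factorial_succ]
  push_cast
  have := Real.pi_pos
  field_simp
  ring

/-- The factor `legendreAt (l - 1) k x` is kept on both sides so that the boundary case k = l, where
Y_{l-1}^k does not exist, is covered: there the factor is zero. The next lemma has this form for the
same reason. -/
theorem harmonicNorm_mul_downZero {l k : ℕ} (h : k ≤ l) (x : Sphere) :
    (harmonicNorm (l - 1) k : ℂ) * downZero l k * legendreAt (l - 1) k x =
      harmonicNorm l k * ((l + k) / (2 * l + 1)) * legendreAt (l - 1) k x := by
  cases l with
  | zero =>
    obtain rfl : k = 0 := by omega
    simp [downZero]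
  | succ l =>
    rcases Nat.lt_or_ge l k with hk | hk
    · simp [legendreAt_eq_zero hk]
    · have := congrArg Complex.ofReal (harmonicNorm_downZero hk)
      simp only [Nat.add_sub_cancel]
      push_cast at this ⊢
      rw [this]

theorem harmonicNorm_mul_downOne {l k : ℕ} (h : k ≤ l) (x : Sphere) :
    (harmonicNorm (l - 1) (k + 1) : ℂ) * downOne l k * legendreAt (l - 1) (k + 1) x =
      harmonicNorm l k * (1 / ((√2 : ℝ) * (2 * l + 1))) * legendreAt (l - 1) (k + 1) x := by
  cases l with
  | zero =>
    obtain rfl : k = 0 := by omega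
    simp [legendreAt_eq_zero]
  | succ l =>
    rcases Nat.lt_or_ge l (k + 1) with hk | hk
    · simp [legendreAt_eq_zero hk]
    · have := congrArg Complex.ofReal (harmonicNorm_downOne hk)
      simp only [Nat.add_sub_cancel]
      push_cast at this ⊢
      rw [this]

theorem coord_mul_sphHarmonic {l : ℕ} {m : ℤ} (h : |m| ≤ l) (x : Sphere) :
    ((x : Space) 2 : ℂ) * sphHarmonic l m x =
      upZero l m * sphHarmonic (l + 1) m x + downZero l m * sphHarmonic (l - 1) m x := by
  have key : ∀ k : ℕ, k ≤ l → ((x : Space) 2 : ℂ) * (harmonicNorm l k * legendreAt l k x) =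
      upZero l k * (harmonicNorm (l + 1) k * legendreAt (l + 1) k x)
        + downZero l k * (harmonicNorm (l - 1) k * legendreAt (l - 1) k x) := by
    intro k hk
    have h1 := congrArg Complex.ofReal (harmonicNorm_upZero hk)
    have h2 := harmonicNorm_mul_downZero hk x
    have h3 := coord_mul_legendreAt l k x
    push_cast at h1
    have hl : (2 * (l : ℂ) + 1) ≠ 0 := by norm_cast
    have h3' : ((x : Space) 2 : ℂ) * legendreAt l k x = ((l + 1 - k) / (2 * l + 1)) *
      legendreAt (l + 1) k x + ((l + k) / (2 * l + 1)) * legendreAt (l - 1) k x := by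
      have hl' := hl
      rw [mul_comm 2] at hl'
      field_simp; linear_combination h3
    linear_combination (harmonicNorm l k : ℂ) * h3' - legendreAt (l + 1) k x * h1 - h2
  obtain ⟨k, rfl | rfl⟩ := m.eq_nat_or_neg
  · have := key k (by simpa using h)
    simp only [sphHarmonic_natCast, Int.cast_natCast]
    linear_combination ((-1) ^ k * planeCoord x ^ k) * this
  · have := key k (by simpa using h)
    simp only [sphHarmonic_neg_natCast, Int.cast_neg, Int.cast_natCast]
    rw [show upZero l (-k) = upZero l k by simp only [upZero]; ring_nf,
      show downZero l (-k) = downZero l k by simp only [downZero]; ring_nf]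
    linear_combination (conj (planeCoord x) ^ k) * this

/-- For m ≥ 0 the factor x₁ + i x₂ lengthens the power already present, and only `legendreAt_mul` is
needed. For m < 0 it meets its conjugate, the product is 1 - x₃², and `one_sub_sq_mul_legendreAt`
takes over. -/
theorem planeCoord_mul_sphHarmonic {l : ℕ} {m : ℤ} (h : |m| ≤ l) (x : Sphere) :
    planeCoord x * sphHarmonic l m x =
      -(√2 : ℝ) * (upOne l m * sphHarmonic (l + 1) (m + 1) x
        - downOne l m * sphHarmonic (l - 1) (m + 1) x) := by
  have hl : (2 * (l : ℂ) + 1) ≠ 0 := by norm_cast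
  have hs : ((√2 : ℝ) : ℂ) ^ 2 = 2 := by
    rw [← Complex.ofReal_pow, Real.sq_sqrt (by norm_num)]; norm_num
  have hs0 : ((√2 : ℝ) : ℂ) ≠ 0 := by simp
  rcases le_or_gt 0 m with hm | hm
  · obtain ⟨k, rfl⟩ := Int.eq_ofNat_of_zero_le hm
    have hk : k ≤ l := by simpa using h
    have h1 := congrArg Complex.ofReal (harmonicNorm_upOne hk)
    have h2 := harmonicNorm_mul_downOne hk x
    have h3 := legendreAt_mul l k x
    push_cast at h1
    have h3' : legendreAt l k x = (√2 : ℝ) * ((1 / ((√2 : ℝ) * (2 * l + 1))) *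
      (legendreAt (l + 1) (k + 1) x - legendreAt (l - 1) (k + 1) x)) := by
      field_simp; linear_combination h3
    rw [show (k : ℤ) + 1 = ((k + 1 : ℕ) : ℤ) by push_cast; ring]
    simp only [sphHarmonic_natCast, Int.cast_natCast]
    linear_combination (harmonicNorm l k * (-1) ^ k * planeCoord x ^ (k + 1) : ℂ) * h3'
      + ((√2 : ℝ) * (-1) ^ (k + 1) * planeCoord x ^ (k + 1)) *
        (legendreAt (l + 1) (k + 1) x * h1 - h2)
  · obtain ⟨k, rfl⟩ := Int.eq_negSucc_of_lt_zero hm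
    rw [Int.negSucc_eq] at h ⊢
    have hk : k + 1 ≤ l := by
      have := (abs_le.1 h).1; omega
    obtain ⟨l, rfl⟩ := Nat.exists_eq_add_of_le' hk
    have h1 := congrArg Complex.ofReal (harmonicNorm_upOne_neg (l := l + k + 1) (k := k) (by omega))
    have h2 := congrArg Complex.ofReal (harmonicNorm_downOne_neg (l := l + k) (k := k) (by omega))
    have h3 := one_sub_sq_mul_legendreAt (l + (k + 1)) k x
    rw [← planeCoord_mul_conj] at h3
    rw [show -((k : ℤ) + 1) + 1 = -(k : ℕ) by ring,
      show -((k : ℤ) + 1) = -((k + 1 : ℕ) : ℤ) by push_cast; ring]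
    simp only [sphHarmonic_neg_natCast, Int.cast_neg, Int.cast_natCast]
    simp only [← add_assoc, Nat.add_sub_cancel] at *
    push_cast at h1 h2 h3 hl ⊢
    have h3' : planeCoord x * conj (planeCoord x) * legendreAt (l + k + 1) (k + 1) x =
      (√2 : ℝ) * (((l + k + 1 + k) * (l + k + 1 + k + 1) / ((√2 : ℝ) * (2 * (l + k + 1) + 1))) *
        legendreAt (l + k) k x - ((l + k + 1 - k) * (l + k + 1 - k + 1) /
          ((√2 : ℝ) * (2 * (l + k + 1) + 1))) * legendreAt (l + k + 1 + 1) k x) := by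
      have hl' := hl
      rw [mul_comm 2] at hl'
      field_simp; linear_combination h3
    linear_combination (harmonicNorm (l + k + 1) (k + 1) * conj (planeCoord x) ^ k : ℂ) * h3'
      + ((√2 : ℝ) * conj (planeCoord x) ^ k) *
        (legendreAt (l + k + 1 + 1) k x * h1 - legendreAt (l + k) k x * h2)

theorem conj_planeCoord_mul_sphHarmonic {l : ℕ} {m : ℤ} (h : |m| ≤ l) (x : Sphere) :
    conj (planeCoord x) * sphHarmonic l m x =
      (√2 : ℝ) * (upOne l (-m) * sphHarmonic (l + 1) (m - 1) x
        - downOne l (-m) * sphHarmonic (l - 1) (m - 1) x) := by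
  have h1 := congrArg conj (planeCoord_mul_sphHarmonic (l := l) (m := -m) (by simpa using h) x)
  simp only [map_mul, map_sub, map_neg, Complex.conj_ofReal, conj_sphHarmonic, neg_neg] at h1
  rw [show -(-m + 1) = m - 1 by ring, zpow_add₀ (by norm_num), zpow_neg] at h1
  push_cast at h1
  have h2 := neg_one_zpow_mul_self m
  rw [inv_eq_of_mul_eq_one_left h2] at h1
  simp only [zpow_one] at h1
  linear_combination (-1 : ℂ) ^ m * h1 + (-(conj (planeCoord x) * sphHarmonic l m x) +
    (√2 : ℝ) * (upOne l (-m) * sphHarmonic (l + 1) (m - 1) x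
        - downOne l (-m) * sphHarmonic (l - 1) (m - 1) x)) * h2

/-! ### Rotations of spherical harmonics -/

theorem axisRotation_apply (i : Fin 3) (θ : ℝ) (x : Space) (j : Fin 3) :
    axisRotation i θ x j = if j = i then x i
        else if j = i + 1 then Real.cos θ * x (i + 1) - Real.sin θ * x (i + 2)
        else Real.sin θ * x (i + 1) + Real.cos θ * x (i + 2) := rfl

theorem axisRotation_symm (i : Fin 3) (θ : ℝ) :
    (axisRotation i θ).symm = axisRotation i (-θ) := by
  ext x j
  rw [LinearIsometryEquiv.symm_apply_eq _ |>.2]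
  have h := Real.sin_sq_add_cos_sq θ
  ext j
  fin_cases i <;> fin_cases j <;> simp [axisRotation_apply] <;> grind

/-- The action of an orthogonal transformation on continuous functions on the sphere. -/
def contAct (g : Space ≃ₗᵢ[ℝ] Space) (f : C(Sphere, ℂ)) : C(Sphere, ℂ) :=
  f.comp ⟨sphereMap g.symm, by unfold sphereMap; fun_prop⟩

theorem contAct_apply (g : Space ≃ₗᵢ[ℝ] Space) (f : C(Sphere, ℂ)) (x : Sphere) :
    contAct g f x = f (sphereMap g.symm x) := rfl

theorem contAct_axisRotation_two (θ : ℝ) (l : ℕ) (m : ℤ) :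
    contAct (axisRotation 2 θ) (sphHarmonic l m) =
      Complex.exp (-(m * θ * Complex.I)) • sphHarmonic l m := by
  ext x
  have hz : ((sphereMap (axisRotation 2 θ).symm x : Sphere) : Space) 2 = (x : Space) 2 := by
    simp [sphereMap, axisRotation_symm, axisRotation_apply]
  have hw : planeCoord (sphereMap (axisRotation 2 θ).symm x) =
      Complex.exp (-(θ * Complex.I)) * planeCoord x := by
    rw [← neg_mul, ← Complex.ofReal_neg, Complex.exp_mul_I, ← Complex.ofReal_cos,
      ← Complex.ofReal_sin]
    simp [planeCoord, sphereMap, axisRotation_symm, axisRotation_apply]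
    ring_nf; simp
  simp only [contAct_apply, ContinuousMap.smul_apply, smul_eq_mul]
  obtain ⟨k, rfl | rfl⟩ := m.eq_nat_or_neg
  · rw [sphHarmonic_natCast, sphHarmonic_natCast, hw, mul_pow, ← Complex.exp_nat_mul]
    simp only [legendreAt, hz, Int.cast_natCast]
    ring_nf
  · rw [sphHarmonic_neg_natCast, sphHarmonic_neg_natCast, hw, map_mul, mul_pow, ← Complex.exp_conj,
      ← Complex.exp_nat_mul]
    simp only [legendreAt, hz, Int.cast_neg, Int.cast_natCast, map_neg, map_mul,
      Complex.conj_ofReal, Complex.conj_I]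
    ring_nf

/-- Rotated harmonics are differentiated in the Banach algebra of continuous functions; uniform
convergence of the difference quotients then passes to L² through a bounded linear map. -/
theorem hasDerivAt_polynomial_aeval {f : ℝ → C(Sphere, ℂ)} {f' : C(Sphere, ℂ)} {t : ℝ}
    (hf : HasDerivAt f f' t) (p : Polynomial ℝ) :
    HasDerivAt (fun s => Polynomial.aeval (f s) p)
      (Polynomial.aeval (f t) (Polynomial.derivative p) * f') t := by
  induction p using Polynomial.induction_on' with
  | add p q hp hq =>
    simp only [map_add, add_mul]
    exact hp.add hq
  | monomial n a =>
    simp only [Polynomial.aeval_monomial, Polynomial.derivative_monomial]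
    refine ((hf.fun_pow n).const_mul (algebraMap ℝ C(Sphere, ℂ) a)).congr_deriv ?_
    rw [map_mul, map_natCast]; ring

/-- The derivative of `Y_l^m` under rotation about the first axis. -/
def axisGenerator (l : ℕ) (m : ℤ) : C(Sphere, ℂ) :=
  (-(Complex.I / 2)) • ((ladder l m : ℂ) • sphHarmonic l (m + 1)
    + (ladder l (m - 1) : ℂ) • sphHarmonic l (m - 1))


theorem contAct_coordinate (g : Space ≃ₗᵢ[ℝ] Space) (j : Fin 3) (x : Sphere) :
    contAct g (coordinate j) x = ((g.symm (x : Space)) j : ℂ) := rfl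

theorem coordinate_apply (j : Fin 3) (x : Sphere) : coordinate j x = ((x : Space) j : ℂ) := rfl

theorem hasDerivAt_contAct_coordinate_one :
    HasDerivAt (fun θ => contAct (axisRotation 0 θ) (coordinate 1)) (coordinate 2) 0 := by
  have h : (fun θ : ℝ => contAct (axisRotation 0 θ) (coordinate 1)) =
      fun θ : ℝ => Real.cos θ • coordinate 1 + Real.sin θ • coordinate 2 := by
    ext θ x
    simp [contAct_coordinate, axisRotation_symm, axisRotation_apply, coordinate_apply]
  rw [h]
  refine (((Real.hasDerivAt_cos 0).smul_const _).add
    ((Real.hasDerivAt_sin 0).smul_const _)).congr_deriv ?_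
  simp

theorem hasDerivAt_contAct_coordinate_two :
    HasDerivAt (fun θ => contAct (axisRotation 0 θ) (coordinate 2)) (-coordinate 1) 0 := by
  have h : (fun θ : ℝ => contAct (axisRotation 0 θ) (coordinate 2)) =
      fun θ : ℝ => Real.cos θ • coordinate 2 - Real.sin θ • coordinate 1 := by
    ext θ x
    simp [contAct_coordinate, axisRotation_symm, axisRotation_apply, coordinate_apply]
    try ring
  rw [h]
  refine (((Real.hasDerivAt_cos 0).smul_const _).sub
    ((Real.hasDerivAt_sin 0).smul_const _)).congr_deriv ?_
  simp

theorem contAct_coordinate_zero (θ : ℝ) :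
    contAct (axisRotation 0 θ) (coordinate 0) = coordinate 0 := by
  ext x
  simp [contAct_coordinate, axisRotation_symm, axisRotation_apply, coordinate_apply]

theorem axisRotation_zero (i : Fin 3) : axisRotation i 0 = LinearIsometryEquiv.refl ℝ Space := by
  ext x j
  fin_cases i <;> fin_cases j <;> simp [axisRotation_apply]

theorem contAct_axisRotation_zero (i : Fin 3) (f : C(Sphere, ℂ)) :
    contAct (axisRotation i 0) f = f := by
  ext x; simp only [contAct_apply, axisRotation_zero, sphereMap]; rfl

theorem conj_axisGenerator (l : ℕ) (m : ℤ) :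
    star (axisGenerator l m) = ((-1 : ℂ) ^ m) • axisGenerator l (-m) := by
  ext x
  simp only [axisGenerator, ContinuousMap.star_apply, ContinuousMap.smul_apply,
    ContinuousMap.add_apply, smul_eq_mul, RCLike.star_def, map_mul, map_add, map_neg,
    map_div₀, Complex.conj_I, Complex.conj_ofReal, conj_sphHarmonic, map_ofNat]
  rw [show -(m + 1) = -m - 1 by ring, show -(m - 1) = -m + 1 by ring,
    zpow_add₀ (by norm_num), zpow_sub₀ (by norm_num)]
  have h1 : ladder l (-m : ℤ) = ladder l (m - 1) := by
    simp only [ladder]; push_cast; ring_nf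
  have h2 : ladder l ((-m : ℤ) - 1) = ladder l m := by
    simp only [ladder]; push_cast; ring_nf
  rw [h1, h2]
  simp; ring

theorem aeval_apply_of_eq_ofReal {f : C(Sphere, ℂ)} {x : Sphere} {r : ℝ} (h : f x = r)
    (p : Polynomial ℝ) : (Polynomial.aeval f p : C(Sphere, ℂ)) x = (p.eval r : ℝ) := by
  induction p using Polynomial.induction_on' with
  | add p q hp hq => simp [hp, hq]
  | monomial n a => simp [Polynomial.aeval_monomial, h, Algebra.algebraMap_eq_smul_one]

/-- The generator about the first axis is -(i/2)(L₊ + L₋). The chain rule gives a term with x₂ and a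
term with x₃. Writing x₂ through x₁ ± i x₂ separates the raised harmonic; in the rest, (x₁ + i
x₂)(x₁ - i x₂) = 1 - x₃² and Legendre's equation produce the lowered one. -/
theorem hasDerivAt_contAct_natCast (l k : ℕ) (hk : k ≤ l) :
    HasDerivAt (fun θ => contAct (axisRotation 0 θ) (sphHarmonic l k)) (axisGenerator l k) 0 := by
  have h : (fun θ => contAct (axisRotation 0 θ) (sphHarmonic l k)) = fun θ =>
      ((harmonicNorm l k : ℂ) * (-1) ^ k) •
      (Polynomial.aeval (contAct (axisRotation 0 θ) (coordinate 2)) (legendreDeriv l k) *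
        (coordinate 0 + Complex.I • contAct (axisRotation 0 θ) (coordinate 1)) ^ k) := by
    ext θ x
    rw [← contAct_coordinate_zero θ]
    simp only [contAct_apply, sphHarmonic_natCast, planeCoord, ContinuousMap.smul_apply,
      ContinuousMap.mul_apply, ContinuousMap.pow_apply, ContinuousMap.add_apply, smul_eq_mul,
      legendreAt, coordinate_apply]
    rw [aeval_apply_of_eq_ofReal (contAct_coordinate _ _ _)]
    simp only [sphereMap]
    ring
  rw [h]
  refine (((hasDerivAt_polynomial_aeval hasDerivAt_contAct_coordinate_two _).fun_mul
    (((hasDerivAt_contAct_coordinate_one.fun_const_smul Complex.I).const_add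
      (coordinate 0)).fun_pow k)).fun_const_smul _).congr_deriv ?_
  simp only [contAct_axisRotation_zero, derivative_legendreDeriv]
  ext x
  have haeval : ∀ p : Polynomial ℝ, (Polynomial.aeval (coordinate 2) p : C(Sphere, ℂ)) x =
      (p.eval ((x : Space) 2) : ℝ) := by
    exact fun p => aeval_apply_of_eq_ofReal rfl p
  have hx1 : ((x : Space) 1 : ℂ) = -(Complex.I / 2) * (planeCoord x - conj (planeCoord x)) := by
    rw [conj_planeCoord, planeCoord]; ring_nf; simp
  simp only [ContinuousMap.smul_apply, ContinuousMap.mul_apply, ContinuousMap.pow_apply,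
    ContinuousMap.add_apply, ContinuousMap.neg_apply, smul_eq_mul, haeval, axisGenerator]
  change ((harmonicNorm l k : ℂ) * (-1) ^ k) * (legendreAt l (k + 1) x * -((x : Space) 1 : ℂ) *
    planeCoord x ^ k + legendreAt l k x * ((k : ℂ) * planeCoord x ^ (k - 1) *
      (Complex.I * ((x : Space) 2 : ℂ)))) = _
  rw [hx1]
  have hup : (ladder l k : ℂ) * sphHarmonic l (k + 1) x =
      harmonicNorm l k * legendreAt l (k + 1) x * ((-1) ^ (k + 1) * planeCoord x ^ (k + 1)) := by
    rw [show (k : ℤ) + 1 = ((k + 1 : ℕ) : ℤ) by push_cast; ring, sphHarmonic_natCast]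
    rcases Nat.lt_or_ge l (k + 1) with hk' | hk'
    · simp [legendreAt_eq_zero hk']
    · rw [← harmonicNorm_ladder hk']; push_cast; ring
  simp only [Int.cast_natCast]
  rw [hup]
  have hw := planeCoord_mul_conj x
  cases k with
  | zero =>
    -- For k = 0 the lowered order is -1, represented by the conjugate of x₁ + i x₂, and the
    -- differential equation is not needed.
    have hdn : (ladder l (((0 : ℕ) : ℝ) - 1) : ℂ) * sphHarmonic l (((0 : ℕ) : ℤ) - 1) x =
        harmonicNorm l 0 * legendreAt l 1 x * conj (planeCoord x) := by
      rw [show ((0 : ℕ) : ℤ) - 1 = -((1 : ℕ) : ℤ) by simp, sphHarmonic_neg_natCast]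
      rcases Nat.lt_or_ge l 1 with hk' | hk'
      · simp [legendreAt_eq_zero hk']
      · rw [← harmonicNorm_ladder (k := 0) hk']
        rw [show ladder l (((0 : ℕ) : ℝ) - 1) = ladder l (0 : ℕ) by simp [ladder, mul_comm]]
        push_cast; ring
    rw [hdn]
    simp; ring
  | succ k =>
    have hdn : (ladder l (((k + 1 : ℕ) : ℝ) - 1) : ℂ) * sphHarmonic l (((k + 1 : ℕ) : ℤ) - 1) x =
        harmonicNorm l (k + 1) * ((l + k + 1) * (l - k)) * legendreAt l k x *
          ((-1) ^ k * planeCoord x ^ k) := by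
      rw [show ((k + 1 : ℕ) : ℤ) - 1 = (k : ℕ) by simp, sphHarmonic_natCast]
      have := congrArg Complex.ofReal (harmonicNorm_ladder' (l := l) (k := k) hk)
      push_cast at this
      rw [← this]
      push_cast; ring_nf
    rw [hdn]
    have hode := legendreAt_ode l k x
    rw [← hw] at hode
    simp only [Nat.add_sub_cancel]
    push_cast
    linear_combination ((-1) ^ (k + 1) * (Complex.I / 2) * harmonicNorm l (k + 1) *
      planeCoord x ^ k) * (-hode)

theorem sphHarmonic_neg (l : ℕ) (m : ℤ) :
    sphHarmonic l (-m) = ((-1 : ℂ) ^ m) • star (sphHarmonic l m) := by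
  ext x
  simp only [ContinuousMap.smul_apply, ContinuousMap.star_apply, RCLike.star_def,
    conj_sphHarmonic, smul_eq_mul, ← mul_assoc, neg_one_zpow_mul_self, one_mul]

theorem hasDerivAt_contAct_sphHarmonic {l : ℕ} {m : ℤ} (h : |m| ≤ l) :
    HasDerivAt (fun θ => contAct (axisRotation 0 θ) (sphHarmonic l m)) (axisGenerator l m) 0 := by
  obtain ⟨k, rfl | rfl⟩ := m.eq_nat_or_neg
  · exact hasDerivAt_contAct_natCast l k (by simpa using h)
  · have h1 := hasDerivAt_contAct_natCast l k (by simpa using h)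
    have h2 := h1.star.const_smul ((-1 : ℂ) ^ (k : ℤ))
    rw [conj_axisGenerator, smul_smul, neg_one_zpow_mul_self, one_smul] at h2
    have h3 : (fun θ => contAct (axisRotation 0 θ) (sphHarmonic l (-k))) = fun θ =>
        ((-1 : ℂ) ^ (k : ℤ)) • star (contAct (axisRotation 0 θ) (sphHarmonic l k)) := by
      ext θ x
      rw [sphHarmonic_neg]
      rfl
    rw [h3]
    exact h2

/-! ### Schur's lemma and orthonormality of the spherical harmonics -/

/-- The class in `L²(S²)` of a continuous function. -/
def toL2 : C(Sphere, ℂ) →L[ℂ] L2Sphere := ContinuousMap.toLp 2 sphereMeasure ℂ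

theorem Y_eq (p : Idx) : Y p = toL2 (sphHarmonic p.1.1 p.1.2) := rfl

theorem toL2_coeFn (f : C(Sphere, ℂ)) : toL2 f =ᵐ[sphereMeasure] f :=
  ContinuousMap.coeFn_toLp sphereMeasure f

theorem sphereAct_toL2 (g : Space ≃ₗᵢ[ℝ] Space) (f : C(Sphere, ℂ)) :
    sphereAct g (toL2 f) = toL2 (contAct g f) := by
  apply Lp.ext
  refine (Lp.coeFn_compMeasurePreserving (toL2 f) (sphereMap_measurePreserving g.symm)).trans ?_
  refine EventuallyEq.trans ?_ (toL2_coeFn _).symm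
  exact (sphereMap_measurePreserving g.symm).quasiMeasurePreserving.ae_eq_comp (toL2_coeFn f)

theorem inner_toL2 (f g : C(Sphere, ℂ)) :
    inner ℂ (toL2 f) (toL2 g) = ∫ x, conj (f x) * g x ∂sphereMeasure := by
  rw [toL2, ContinuousMap.inner_toLp]
  simp [mul_comm]

theorem sphereAct_inner (g : Space ≃ₗᵢ[ℝ] Space) (u v : L2Sphere) :
    inner ℂ (sphereAct g u) (sphereAct g v) = inner ℂ u v := (sphereAct g).inner_map_map u v

/-- The matrix coefficient `⟨Y_{l'}^{m'}, A Y_l^m⟩`. -/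
def matCoeff (A : L2Sphere →L[ℂ] L2Sphere) (l' : ℕ) (m' : ℤ) (l : ℕ) (m : ℤ) : ℂ :=
  inner ℂ (toL2 (sphHarmonic l' m')) (A (toL2 (sphHarmonic l m)))

section Schur
variable {A : L2Sphere →L[ℂ] L2Sphere}
  (hA : ∀ (i : Fin 3) (θ : ℝ) (f : L2Sphere),
    A (sphereAct (axisRotation i θ) f) = sphereAct (axisRotation i θ) (A f))

include hA

theorem matCoeff_eq_zero_of_ne {l' l : ℕ} {m' m : ℤ} (h : m' ≠ m) : matCoeff A l' m' l m = 0 := by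
  have hne : ((m' : ℝ) - m) ≠ 0 := by
    rw [sub_ne_zero]; exact_mod_cast h
  -- For this angle the two rotation phases have quotient -1, so invariance equates the coefficient
  -- with its negative.
  set θ : ℝ := Real.pi / (m' - m) with hθ
  have h1 := sphereAct_inner (axisRotation 2 θ) (toL2 (sphHarmonic l' m'))
    (A (toL2 (sphHarmonic l m)))
  rw [← hA, sphereAct_toL2, sphereAct_toL2, contAct_axisRotation_two, contAct_axisRotation_two,
    map_smul, map_smul, map_smul, inner_smul_left, inner_smul_right, ← mul_assoc,
    ← Complex.exp_conj, ← Complex.exp_add] at h1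
  have h2 : conj (-((m' : ℂ) * θ * Complex.I)) + -(m * θ * Complex.I) = Real.pi * Complex.I := by
    simp only [map_neg, map_mul, Complex.conj_ofReal, Complex.conj_I]
    have : ((m' : ℝ) - m) * θ = Real.pi := by rw [hθ]; field_simp
    have := congrArg Complex.ofReal this
    push_cast at this
    rw [← this]
    simp; ring
  rw [h2, Complex.exp_pi_mul_I] at h1
  unfold matCoeff
  linear_combination (-1 / 2 : ℂ) * h1

/-- Since A commutes with rotations, the matrix coefficient between simultaneously rotated harmonics
is constant in the angle; the identity is its vanishing derivative at angle 0. -/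
theorem matCoeff_generator {l' l : ℕ} {m' m : ℤ} (h' : |m'| ≤ l') (h : |m| ≤ l) :
    ladder l' m' * matCoeff A l' (m' + 1) l m + ladder l' (m' - 1) * matCoeff A l' (m' - 1) l m =
      ladder l m * matCoeff A l' m' l (m + 1) + ladder l (m - 1) * matCoeff A l' m' l (m - 1) := by
  have hd : ∀ (l : ℕ) (m : ℤ), |m| ≤ l → HasDerivAt
      (fun θ => toL2 (contAct (axisRotation 0 θ) (sphHarmonic l m))) (toL2 (axisGenerator l m)) 0 :=
    fun l m h => (toL2.restrictScalars ℝ).hasFDerivAt.comp_hasDerivAt _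
      (hasDerivAt_contAct_sphHarmonic h)
  have h1 := (hd l' m' h').inner ℂ ((A.restrictScalars ℝ).hasFDerivAt.comp_hasDerivAt _ (hd l m h))
  have h2 : (fun θ => inner ℂ (toL2 (contAct (axisRotation 0 θ) (sphHarmonic l' m')))
      (((A.restrictScalars ℝ) ∘ fun θ => toL2 (contAct (axisRotation 0 θ) (sphHarmonic l m))) θ)) =
      fun _ => matCoeff A l' m' l m := by
    ext θ
    simp only [Function.comp, ContinuousLinearMap.coe_restrictScalars']
    rw [← sphereAct_toL2, ← sphereAct_toL2, hA, sphereAct_inner]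
    rfl
  rw [h2] at h1
  have h3 := h1.unique (hasDerivAt_const _ _)
  simp only [Function.comp, ContinuousLinearMap.coe_restrictScalars', contAct_axisRotation_zero,
    axisGenerator, map_smul, map_add, inner_smul_left, inner_smul_right, inner_add_left,
    inner_add_right, map_neg, map_div₀, Complex.conj_I, Complex.conj_ofReal, map_ofNat] at h3
  have hI := Complex.I_sq
  have h4 : ∀ a b : ℂ, -(Complex.I / 2) * b + -(-Complex.I / 2) * a = 0 → a = b := by
    intro a b h
    linear_combination (-2 * Complex.I) * h + (a - b) * hI
  exact h4 _ _ h3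

theorem matCoeff_ladder {l' l : ℕ} {m : ℤ} (h' : |m + 1| ≤ l') (h : |m| ≤ l) :
    ladder l' m * matCoeff A l' m l m = ladder l m * matCoeff A l' (m + 1) l (m + 1) := by
  have h1 := matCoeff_generator hA h' h
  rw [matCoeff_eq_zero_of_ne hA (show m + 1 + 1 ≠ m by omega),
    matCoeff_eq_zero_of_ne hA (show m + 1 ≠ m - 1 by omega), add_sub_cancel_right] at h1
  push_cast at h1
  simpa using h1

theorem matCoeff_ladder' {l' l : ℕ} {m : ℤ} (h' : |m| ≤ l') (h : |m + 1| ≤ l) :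
    ladder l' m * matCoeff A l' (m + 1) l (m + 1) = ladder l m * matCoeff A l' m l m := by
  have h1 := matCoeff_generator hA h' h
  rw [matCoeff_eq_zero_of_ne hA (show m - 1 ≠ m + 1 by omega),
    matCoeff_eq_zero_of_ne hA (show m ≠ m + 1 + 1 by omega), add_sub_cancel_right] at h1
  push_cast at h1
  simpa using h1

/-- A Casimir argument: going up and down by one multiplies the coefficient by the squared ladder
factor of l' on one side and of l on the other, and these differ by (l' - l)(l' + l + 1). -/
theorem matCoeff_eq_zero_of_lt {l' l : ℕ} (hl : l' ≠ l) (m : ℤ) : matCoeff A l' m l m = 0 := by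
  by_cases hm' : (l' : ℤ) < |m|
  · simp [matCoeff, sphHarmonic_eq_zero hm']
  by_cases hm : (l : ℤ) < |m|
  · simp [matCoeff, sphHarmonic_eq_zero hm]
  push Not at hm hm'
  have hsq : ∀ {l : ℕ}, |m| ≤ l → ladder l m ^ 2 = (l - m) * (l + m + 1) := by
    intro l hm
    have h1 : ((m : ℤ) : ℝ) ≤ l := by exact_mod_cast (abs_le.1 hm).2
    have h2 : (-(l : ℝ)) ≤ m := by exact_mod_cast (abs_le.1 hm).1
    exact Real.sq_sqrt (mul_nonneg (by linarith) (by linarith))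
  have hne : ladder l' m ^ 2 - ladder l m ^ 2 ≠ 0 := by
    rw [hsq hm, hsq hm', show ((l' : ℝ) - m) * (l' + m + 1) - (l - m) * (l + m + 1) =
      (l' - l) * (l' + l + 1) by ring]
    refine mul_ne_zero ?_ (by positivity)
    rw [sub_ne_zero]; exact_mod_cast hl
  have key : ((ladder l' m ^ 2 - ladder l m ^ 2 : ℝ) : ℂ) * matCoeff A l' m l m = 0 := by
    rw [abs_le] at hm hm'
    -- At the top order there is no next harmonic, but there the ladder factor is zero; each ladder
    -- relation is thus either available or multiplied by zero.
    have c1 : |m + 1| ≤ l' ∨ ladder l' m = 0 := by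
      rcases lt_or_eq_of_le hm'.2 with h | h
      · left; rw [abs_le]; omega
      · right; simp [ladder, h]
    have c2 : |m + 1| ≤ l ∨ ladder l m = 0 := by
      rcases lt_or_eq_of_le hm.2 with h | h
      · left; rw [abs_le]; omega
      · right; simp [ladder, h]
    rw [← abs_le] at hm hm'
    rcases c1 with c1 | c1 <;> rcases c2 with c2 | c2
    · have h1 := matCoeff_ladder hA c1 hm
      have h2 := matCoeff_ladder' hA hm' c2
      push_cast
      linear_combination (ladder l' m : ℂ) * h1 + (ladder l m : ℂ) * h2
    · have h1 := matCoeff_ladder hA c1 hm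
      rw [c2] at h1 ⊢
      push_cast at h1 ⊢
      linear_combination (ladder l' m : ℂ) * h1
    · have h2 := matCoeff_ladder' hA hm' c2
      rw [c1] at h2 ⊢
      push_cast at h2 ⊢
      linear_combination (ladder l m : ℂ) * h2
    · simp [c1, c2]
  exact (mul_eq_zero.1 key).resolve_left (by exact_mod_cast hne)

theorem matCoeff_succ {l : ℕ} {m : ℤ} (h1 : -(l : ℤ) ≤ m) (h2 : m < l) :
    matCoeff A l m l m = matCoeff A l (m + 1) l (m + 1) := by
  have h := matCoeff_ladder hA (l' := l) (l := l) (m := m) (by rw [abs_le]; omega)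
    (by rw [abs_le]; omega)
  refine mul_left_cancel₀ ?_ h
  have h1' : (0 : ℝ) ≤ l + m := by
    have : (0 : ℤ) ≤ l + m := by omega
    exact_mod_cast this
  have h2' : (0 : ℝ) < l - m := by
    rw [sub_pos]; exact_mod_cast h2
  have : 0 < ladder l m := Real.sqrt_pos.2 (by positivity)
  exact_mod_cast this.ne'

theorem matCoeff_eq_matCoeff_zero {l : ℕ} {m : ℤ} (h : |m| ≤ l) :
    matCoeff A l m l m = matCoeff A l 0 l 0 := by
  obtain ⟨k, rfl | rfl⟩ := m.eq_nat_or_neg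
  · have h : k ≤ l := by simpa using h
    clear * - h hA
    induction k with
    | zero => simp
    | succ k ih =>
      rw [← ih (by omega), matCoeff_succ hA (m := k) (by omega) (by omega)]
      push_cast; rfl
  · have h : k ≤ l := by simpa using h
    clear * - h hA
    induction k with
    | zero => simp
    | succ k ih =>
      rw [← ih (by omega), matCoeff_succ hA (m := -((k + 1 : ℕ) : ℤ)) (by omega) (by omega)]
      push_cast; ring_nf

/-- Schur's lemma for the rotations of the sphere. -/
theorem inner_Y_map_Y (p q : Idx) :
    inner ℂ (Y p) (A (Y q)) = if p = q then matCoeff A q.1.1 0 q.1.1 0 else 0 := by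
  obtain ⟨⟨l', m'⟩, h'⟩ := p
  obtain ⟨⟨l, m⟩, h⟩ := q
  change matCoeff A l' m' l m = _
  split_ifs with heq
  · simp only [Subtype.mk.injEq, Prod.mk.injEq] at heq
    obtain ⟨rfl, rfl⟩ := heq
    exact matCoeff_eq_matCoeff_zero hA h
  · by_cases hm : m' = m
    · subst hm
      refine matCoeff_eq_zero_of_lt hA ?_ _
      rintro rfl
      exact heq rfl
    · exact matCoeff_eq_zero_of_ne hA hm

end Schur

theorem inner_toL2_coordinate_mul (j : Fin 3) (f g : C(Sphere, ℂ)) :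
    inner ℂ (toL2 f) (toL2 (coordinate j * g)) = inner ℂ (toL2 (coordinate j * f)) (toL2 g) := by
  rw [inner_toL2, inner_toL2]
  congr 1; ext x
  simp [coordinate_apply]; ring

theorem sphereMeasure_univ : sphereMeasure Set.univ = ENNReal.ofReal (4 * Real.pi) := by
  rw [sphereMeasure, Measure.toSphere_apply_univ, EuclideanSpace.volume_ball_fin_three]
  simp only [finrank_euclideanSpace, Fintype.card_fin, Nat.cast_ofNat, ENNReal.ofReal_one, one_pow,
    one_mul]
  rw [show (3 : ENNReal) = ENNReal.ofReal 3 by simp, ← ENNReal.ofReal_mul (by norm_num)]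
  congr 1; ring

theorem matCoeff_id_zero : matCoeff (ContinuousLinearMap.id ℂ L2Sphere) 0 0 0 0 = 1 := by
  have h : ∀ x, sphHarmonic 0 0 x = (√(1 / (4 * Real.pi)) : ℝ) := by
    intro x
    have := sphHarmonic_natCast 0 0 x
    simp only [Nat.cast_zero] at this
    rw [this]
    simp [harmonicNorm, legendreAt, legendreDeriv]
  simp only [matCoeff, ContinuousLinearMap.id_apply, inner_toL2, h, Complex.conj_ofReal]
  rw [integral_const, ← Complex.ofReal_mul, Real.mul_self_sqrt (by positivity), measureReal_def,
    sphereMeasure_univ, ENNReal.toReal_ofReal (by positivity), Complex.real_smul,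
    ← Complex.ofReal_mul]
  have := Real.pi_pos
  norm_cast
  field_simp

/-- Multiplication by x₃ is symmetric, and its coefficient from l to l + 1 equals the one from l + 1
to l. Hence Y_l^0 and Y_{l+1}^0 have the same norm, and the area 4π settles l = 0. The other orders
follow from Schur's lemma for the identity. -/
theorem matCoeff_id (l : ℕ) : matCoeff (ContinuousLinearMap.id ℂ L2Sphere) l 0 l 0 = 1 := by
  induction l with
  | zero => exact matCoeff_id_zero
  | succ l ih =>
    have hA : ∀ (i : Fin 3) (θ : ℝ) (f : L2Sphere),
      ContinuousLinearMap.id ℂ L2Sphere (sphereAct (axisRotation i θ) f) =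
        sphereAct (axisRotation i θ) (ContinuousLinearMap.id ℂ L2Sphere f) := fun _ _ _ => rfl
    have hmul : ∀ l : ℕ, coordinate 2 * sphHarmonic l 0 = (upZero l 0 : ℂ) • sphHarmonic (l + 1) 0
        + (downZero l 0 : ℂ) • sphHarmonic (l - 1) 0 := by
      intro l
      ext x
      simpa [coordinate_apply] using coord_mul_sphHarmonic (l := l) (m := 0) (by simp) x
    have h := inner_toL2_coordinate_mul 2 (sphHarmonic (l + 1) 0) (sphHarmonic l 0)
    have h0 : ∀ {l' l : ℕ}, l' ≠ l →
        inner ℂ (toL2 (sphHarmonic l' 0)) (toL2 (sphHarmonic l 0)) = 0 :=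
      fun h => matCoeff_eq_zero_of_lt hA h 0
    rw [hmul, hmul] at h
    simp only [map_add, map_smul, inner_add_left, inner_add_right, inner_smul_left,
      inner_smul_right, Complex.conj_ofReal, Nat.add_sub_cancel] at h
    rw [h0 (show l + 1 ≠ l - 1 by omega), h0 (show l + 1 + 1 ≠ l by omega)] at h
    have hud : downZero ((l + 1 : ℕ) : ℝ) 0 = upZero l 0 := by
      simp only [downZero, upZero]; push_cast; ring_nf
    rw [hud] at h
    have hpos : 0 < upZero l 0 := Real.sqrt_pos.2 (by rw [sub_zero]; positivity)
    have hne : (upZero l 0 : ℂ) ≠ 0 := by exact_mod_cast hpos.ne'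
    rw [← ih]
    simp only [mul_zero, add_zero, zero_add] at h
    exact mul_left_cancel₀ hne h

theorem orthonormal_Y : Orthonormal ℂ Y := by
  rw [orthonormal_iff_ite]
  intro p q
  have h := inner_Y_map_Y (A := ContinuousLinearMap.id ℂ L2Sphere) (fun _ _ _ => rfl) p q
  rwa [matCoeff_id] at h

/-! ### Completeness of the spherical harmonics -/

/-- The span of the spherical harmonics of degree at most `n`. -/
def degreeSpan (n : ℕ) : Submodule ℂ C(Sphere, ℂ) :=
  Submodule.span ℂ {f | ∃ l ≤ n, ∃ m : ℤ, f = sphHarmonic l m}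

theorem sphHarmonic_mem_degreeSpan {l n : ℕ} (h : l ≤ n) (m : ℤ) :
    sphHarmonic l m ∈ degreeSpan n := Submodule.subset_span ⟨l, h, m, rfl⟩

theorem degreeSpan_mono {n n' : ℕ} (h : n ≤ n') : degreeSpan n ≤ degreeSpan n' :=
  Submodule.span_mono fun _ ⟨l, hl, m, hf⟩ => ⟨l, hl.trans h, m, hf⟩

/-- The function `x₁ + i x₂`. -/
def planeFun : C(Sphere, ℂ) := coordinate 0 + Complex.I • coordinate 1

theorem planeFun_apply (x : Sphere) : planeFun x = planeCoord x := rfl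

theorem coordinate_zero_eq : coordinate 0 = (1 / 2 : ℂ) • (planeFun + star planeFun) := by
  ext x
  simp only [coordinate_apply, ContinuousMap.smul_apply, ContinuousMap.add_apply, planeFun_apply,
    ContinuousMap.star_apply, RCLike.star_def, conj_planeCoord, smul_eq_mul]
  rw [planeCoord]; ring

theorem coordinate_one_eq :
    coordinate 1 = (-(Complex.I / 2)) • (planeFun - star planeFun) := by
  ext x
  simp only [coordinate_apply, ContinuousMap.smul_apply, ContinuousMap.sub_apply, planeFun_apply,
    ContinuousMap.star_apply, RCLike.star_def, conj_planeCoord, smul_eq_mul]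
  rw [planeCoord]; ring_nf; simp

theorem coordinate_two_mul {l : ℕ} {m : ℤ} (h : |m| ≤ l) :
    coordinate 2 * sphHarmonic l m = (upZero l m : ℂ) • sphHarmonic (l + 1) m
      + (downZero l m : ℂ) • sphHarmonic (l - 1) m := by
  ext x
  simpa [coordinate_apply] using coord_mul_sphHarmonic h x

theorem planeFun_mul {l : ℕ} {m : ℤ} (h : |m| ≤ l) :
    planeFun * sphHarmonic l m = (-(√2 : ℝ) : ℂ) • ((upOne l m : ℂ) • sphHarmonic (l + 1) (m + 1)
      - (downOne l m : ℂ) • sphHarmonic (l - 1) (m + 1)) := by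
  ext x
  simpa [planeFun_apply] using planeCoord_mul_sphHarmonic h x

theorem star_planeFun_mul {l : ℕ} {m : ℤ} (h : |m| ≤ l) :
    star planeFun * sphHarmonic l m =
      ((√2 : ℝ) : ℂ) • ((upOne l (-m) : ℂ) • sphHarmonic (l + 1) (m - 1)
      - (downOne l (-m) : ℂ) • sphHarmonic (l - 1) (m - 1)) := by
  ext x
  simpa [planeFun_apply] using conj_planeCoord_mul_sphHarmonic h x

theorem coordinate_mul_mem_degreeSpan (j : Fin 3) {n : ℕ} {f : C(Sphere, ℂ)}
    (hf : f ∈ degreeSpan n) : coordinate j * f ∈ degreeSpan (n + 1) := by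
  induction hf using Submodule.span_induction with
  | zero => simp
  | add f g _ _ hf hg => rw [mul_add]; exact add_mem hf hg
  | smul c f _ hf => rw [mul_smul_comm]; exact Submodule.smul_mem _ _ hf
  | mem f hf =>
    obtain ⟨l, hl, m, rfl⟩ := hf
    by_cases hm : |m| ≤ l
    · have mem : ∀ l' ≤ l + 1, ∀ m' : ℤ, sphHarmonic l' m' ∈ degreeSpan (n + 1) :=
        fun l' h m' => sphHarmonic_mem_degreeSpan (by omega) m'
      have hp : planeFun * sphHarmonic l m ∈ degreeSpan (n + 1) := by
        rw [planeFun_mul hm]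
        exact Submodule.smul_mem _ _ (sub_mem (Submodule.smul_mem _ _ (mem _ (by omega) _))
          (Submodule.smul_mem _ _ (mem _ (by omega) _)))
      have hp' : star planeFun * sphHarmonic l m ∈ degreeSpan (n + 1) := by
        rw [star_planeFun_mul hm]
        exact Submodule.smul_mem _ _ (sub_mem (Submodule.smul_mem _ _ (mem _ (by omega) _))
          (Submodule.smul_mem _ _ (mem _ (by omega) _)))
      fin_cases j
      · change coordinate 0 * _ ∈ _
        rw [coordinate_zero_eq, smul_mul_assoc, add_mul]
        exact Submodule.smul_mem _ _ (add_mem hp hp')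
      · change coordinate 1 * _ ∈ _
        rw [coordinate_one_eq, smul_mul_assoc, sub_mul]
        exact Submodule.smul_mem _ _ (sub_mem hp hp')
      · change coordinate 2 * _ ∈ _
        rw [coordinate_two_mul hm]
        exact add_mem (Submodule.smul_mem _ _ (mem _ (by omega) _))
          (Submodule.smul_mem _ _ (mem _ (by omega) _))
    · rw [sphHarmonic_eq_zero (by omega), mul_zero]
      exact zero_mem _

theorem one_mem_degreeSpan : (1 : C(Sphere, ℂ)) ∈ degreeSpan 0 := by
  have h : (1 : C(Sphere, ℂ)) = ((√(1 / (4 * Real.pi)) : ℝ) : ℂ)⁻¹ • sphHarmonic 0 0 := by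
    ext x
    have := sphHarmonic_natCast 0 0 x
    simp only [Nat.cast_zero] at this
    have hpi : (√(1 / (4 * Real.pi)) : ℝ) ≠ 0 := by positivity
    have hpi' : ((√(1 / (4 * Real.pi)) : ℝ) : ℂ) ≠ 0 := by exact_mod_cast hpi
    rw [ContinuousMap.smul_apply, this]
    simp only [harmonicNorm, legendreAt, legendreDeriv]
    rw [smul_eq_mul, ContinuousMap.one_apply, eq_inv_mul_iff_mul_eq₀ hpi']
    simp
  rw [h]
  exact Submodule.smul_mem _ _ (sphHarmonic_mem_degreeSpan le_rfl 0)

/-- The algebra of polynomials in the coordinates. -/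
def polyAlgebra : StarSubalgebra ℂ C(Sphere, ℂ) := StarAlgebra.adjoin ℂ (Set.range coordinate)

theorem star_coordinate (j : Fin 3) : star (coordinate j) = coordinate j := by
  ext x; simp [coordinate_apply]

theorem polyAlgebra_separatesPoints : polyAlgebra.SeparatesPoints := by
  intro x y hxy
  have : ∃ j, (x : Space) j ≠ (y : Space) j := by
    by_contra! h
    exact hxy (Subtype.ext (by ext j; exact h j))
  obtain ⟨j, hj⟩ := this
  refine ⟨_, ⟨coordinate j, StarAlgebra.subset_adjoin ℂ _ ⟨j, rfl⟩, rfl⟩, ?_⟩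
  simpa [coordinate_apply] using hj

theorem exists_mem_degreeSpan_of_mem_polyAlgebra {f : C(Sphere, ℂ)} (hf : f ∈ polyAlgebra) :
    ∃ n, f ∈ degreeSpan n := by
  have h1 : f ∈ Algebra.adjoin ℂ (Set.range coordinate) := by
    have : star (Set.range coordinate) = Set.range coordinate := by
      ext g
      simp only [Set.mem_star, Set.mem_range]
      constructor
      · rintro ⟨j, hj⟩; exact ⟨j, by rw [← star_coordinate, hj, star_star]⟩
      · rintro ⟨j, rfl⟩; exact ⟨j, (star_coordinate j).symm⟩
    have h2 := StarAlgebra.adjoin_toSubalgebra ℂ (Set.range coordinate)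
    rw [this, Set.union_self] at h2
    rw [← h2]; exact hf
  clear hf
  have h2 : ∀ n, ∀ g ∈ degreeSpan n, ∃ n', f * g ∈ degreeSpan n' := by
    induction h1 using Algebra.adjoin_induction with
    | mem f hf =>
      obtain ⟨j, rfl⟩ := hf
      exact fun n g hg => ⟨n + 1, coordinate_mul_mem_degreeSpan j hg⟩
    | algebraMap r =>
      intro n g hg
      refine ⟨n, ?_⟩
      rw [← Algebra.smul_def]
      exact Submodule.smul_mem _ _ hg
    | add f f' _ _ hf hf' =>
      intro n g hg
      obtain ⟨a, ha⟩ := hf n g hg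
      obtain ⟨b, hb⟩ := hf' n g hg
      exact ⟨max a b, by
        rw [add_mul]
        exact add_mem (degreeSpan_mono (le_max_left _ _) ha) (degreeSpan_mono (le_max_right _ _) hb)⟩
    | mul f f' _ _ hf hf' =>
      intro n g hg
      obtain ⟨b, hb⟩ := hf' n g hg
      obtain ⟨a, ha⟩ := hf b _ hb
      exact ⟨a, by rwa [mul_assoc]⟩
  simpa using h2 0 1 one_mem_degreeSpan

/-- Stone–Weierstrass makes polynomials in the coordinates dense, and every such polynomial is a
finite combination of harmonics because multiplication by a coordinate raises the degree by at most
one. -/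
theorem span_sphHarmonic_dense :
    (Submodule.span ℂ (Set.range fun p : Idx => sphHarmonic p.1.1 p.1.2)).topologicalClosure
      = ⊤ := by
  rw [eq_top_iff]
  have h := ContinuousMap.starSubalgebra_topologicalClosure_eq_top_of_separatesPoints polyAlgebra
    polyAlgebra_separatesPoints
  have h1 : Subalgebra.toSubmodule polyAlgebra.toSubalgebra ≤
      Submodule.span ℂ (Set.range fun p : Idx => sphHarmonic p.1.1 p.1.2) := by
    intro f hf
    obtain ⟨n, hn⟩ := exists_mem_degreeSpan_of_mem_polyAlgebra hf
    refine Submodule.span_le.2 ?_ hn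
    rintro _ ⟨l, -, m, rfl⟩
    by_cases hm : |m| ≤ l
    · exact Submodule.subset_span ⟨⟨(l, m), hm⟩, rfl⟩
    · rw [sphHarmonic_eq_zero (by omega)]; exact zero_mem _
  refine le_trans ?_ (Submodule.topologicalClosure_mono h1)
  intro f _
  have : f ∈ polyAlgebra.topologicalClosure := by rw [h]; trivial
  exact this

theorem span_Y_dense : (Submodule.span ℂ (Set.range Y)).topologicalClosure = ⊤ := by
  have h := (ContinuousMap.toLp_denseRange ℂ sphereMeasure ℂ
    (p := 2) (by norm_num)).topologicalClosure_map_submodule span_sphHarmonic_dense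
  rw [Submodule.map_span, ← Set.range_comp] at h
  exact h

/-- The spherical harmonics as a Hilbert basis of `L²(S²)`. -/
def basisY : HilbertBasis Idx ℂ L2Sphere := HilbertBasis.mk orthonormal_Y span_Y_dense.ge

theorem basisY_apply (p : Idx) : basisY p = Y p := by simp [basisY]

/-- The unitary map `φ ↦ ∑ φ_p Y_p`. -/
def expand : OneParticle ≃ₗᵢ[ℂ] L2Sphere := basisY.repr.symm

theorem hasSum_expand (φ : OneParticle) : HasSum (fun p => φ p • Y p) (expand φ) := by
  have h := basisY.hasSum_repr_symm φ
  simp only [basisY_apply] at h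
  exact h

theorem expand_symm_apply (f : L2Sphere) (p : Idx) : expand.symm f p = inner ℂ (Y p) f := by
  rw [← basisY_apply]
  exact basisY.repr_apply_apply f p

theorem inner_Y_expand (φ : OneParticle) (p : Idx) : inner ℂ (Y p) (expand φ) = φ p := by
  rw [← expand_symm_apply, LinearIsometryEquiv.symm_apply_apply]

theorem expand_modeVec (p : Idx) : expand (modeVec p) = Y p := by
  rw [expand, modeVec, basisY.repr_symm_single, basisY_apply]

theorem L2_ext {f g : L2Sphere} (h : ∀ p, inner ℂ (Y p) f = inner ℂ (Y p) g) : f = g := by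
  apply expand.symm.injective
  ext p
  rw [expand_symm_apply, expand_symm_apply, h]

theorem continuousLinearMap_ext_Y {F : Type*} [NormedAddCommGroup F] [NormedSpace ℂ F]
    {A B : L2Sphere →L[ℂ] F} (h : ∀ p, A (Y p) = B (Y p)) : A = B := by
  refine ContinuousLinearMap.ext_on (s := Set.range Y) ?_ ?_
  · exact Submodule.dense_iff_topologicalClosure_eq_top.2 span_Y_dense
  · rintro _ ⟨p, rfl⟩; exact h p

/-! ### Invariance of the degree under orthogonal transformations -/

theorem contAct_coordinate_eq_sum (g : Space ≃ₗᵢ[ℝ] Space) (j : Fin 3) :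
    ∃ a : Fin 3 → ℂ, contAct g (coordinate j) = ∑ k, a k • coordinate k := by
  refine ⟨fun k => ((g.symm (EuclideanSpace.single k 1)) j : ℂ), ?_⟩
  ext x
  rw [contAct_coordinate]
  have hx : (x : Space) = ∑ k, (x : Space) k • EuclideanSpace.single k (1 : ℝ) := by
    ext i; fin_cases i <;> simp [Fin.sum_univ_three]
  conv_lhs => rw [hx]
  simp [Fin.sum_univ_three, coordinate_apply]
  ring

theorem contAct_mul (g : Space ≃ₗᵢ[ℝ] Space) (f f' : C(Sphere, ℂ)) :
    contAct g (f * f') = contAct g f * contAct g f' := rfl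

theorem contAct_add (g : Space ≃ₗᵢ[ℝ] Space) (f f' : C(Sphere, ℂ)) :
    contAct g (f + f') = contAct g f + contAct g f' := rfl

theorem contAct_neg (g : Space ≃ₗᵢ[ℝ] Space) (f : C(Sphere, ℂ)) :
    contAct g (-f) = -contAct g f := rfl

theorem contAct_smul (g : Space ≃ₗᵢ[ℝ] Space) (c : ℂ) (f : C(Sphere, ℂ)) :
    contAct g (c • f) = c • contAct g f := rfl

theorem contAct_coordinate_mul_mem (g : Space ≃ₗᵢ[ℝ] Space) (j : Fin 3) {n : ℕ}
    {f : C(Sphere, ℂ)} (hf : contAct g f ∈ degreeSpan n) :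
    contAct g (coordinate j * f) ∈ degreeSpan (n + 1) := by
  obtain ⟨a, ha⟩ := contAct_coordinate_eq_sum g j
  rw [contAct_mul, ha, Finset.sum_mul]
  refine Submodule.sum_mem _ fun k _ => ?_
  rw [smul_mul_assoc]
  exact Submodule.smul_mem _ _ (coordinate_mul_mem_degreeSpan k hf)

theorem mem_of_smul_add_mem {S : Submodule ℂ C(Sphere, ℂ)} {r : ℝ} (hr : 0 < r)
    {f h : C(Sphere, ℂ)} (h1 : (r : ℂ) • f + h ∈ S) (h2 : h ∈ S) : f ∈ S := by
  have h3 := (Submodule.add_mem_iff_left S h2).1 h1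
  exact (Submodule.smul_mem_iff S (by exact_mod_cast hr.ne')).1 h3

/-- Up to terms of degree l - 1 and a nonzero factor, Y_{l+1}^m is a coordinate times a harmonic of
degree l: x₃ serves for |m| ≤ l and x₁ ± i x₂ for m = ±(l + 1). An orthogonal map turns coordinates
into combinations of coordinates, so induction on l applies. -/
theorem contAct_sphHarmonic_mem (g : Space ≃ₗᵢ[ℝ] Space) (l : ℕ) (m : ℤ) :
    contAct g (sphHarmonic l m) ∈ degreeSpan l := by
  induction l using Nat.strong_induction_on generalizing m with
  | _ l ih =>
    cases l with
    | zero =>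
      by_cases hm : |m| ≤ (0 : ℕ)
      · obtain rfl : m = 0 := by simpa using hm
        have h : contAct g (sphHarmonic 0 0) = sphHarmonic 0 0 := by
          ext x
          have h := sphHarmonic_natCast 0 0
          simp only [Nat.cast_zero] at h
          rw [contAct_apply, h, h]
          simp [legendreAt, legendreDeriv]
        rw [h]
        exact sphHarmonic_mem_degreeSpan le_rfl 0
      · rw [sphHarmonic_eq_zero (by omega)]
        exact zero_mem _
    | succ l =>
      have hlow : ∀ m, contAct g (sphHarmonic (l - 1) m) ∈ degreeSpan (l + 1) := fun m =>
        degreeSpan_mono (by omega) (ih (l - 1) (by omega) m)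
      have hc : ∀ j m, contAct g (coordinate j * sphHarmonic l m) ∈ degreeSpan (l + 1) :=
        fun j m => contAct_coordinate_mul_mem g j (ih l (by omega) m)
      have hplane : ∀ m, contAct g (planeFun * sphHarmonic l m) ∈ degreeSpan (l + 1) := by
        intro m
        rw [planeFun, add_mul, contAct_add, smul_mul_assoc, contAct_smul]
        exact add_mem (hc 0 m) (Submodule.smul_mem _ _ (hc 1 m))
      have hplane' : ∀ m, contAct g (star planeFun * sphHarmonic l m) ∈ degreeSpan (l + 1) := by
        intro m
        have : star planeFun = coordinate 0 + (-Complex.I) • coordinate 1 := by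
          rw [planeFun, star_add, star_smul, star_coordinate, star_coordinate]; simp
        rw [this, add_mul, contAct_add, smul_mul_assoc, contAct_smul]
        exact add_mem (hc 0 m) (Submodule.smul_mem _ _ (hc 1 m))
      by_cases hm : |m| ≤ (l + 1 : ℕ)
      swap
      · rw [sphHarmonic_eq_zero (by omega)]
        exact zero_mem _
      have h2 : (0 : ℝ) < √2 := by positivity
      rw [abs_le] at hm
      by_cases hm1 : m = l + 1
      · subst hm1
        have h := hplane l
        rw [planeFun_mul (by simp), contAct_smul, Submodule.smul_mem_iff _
          (by rw [neg_ne_zero]; exact_mod_cast h2.ne'), sub_eq_add_neg, contAct_add,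
          contAct_smul] at h
        have hpos : 0 < upOne l (l : ℤ) := by
          refine Real.sqrt_pos.2 ?_
          push_cast; positivity
        refine mem_of_smul_add_mem hpos h ?_
        rw [contAct_neg, contAct_smul]
        exact neg_mem (Submodule.smul_mem _ _ (hlow _))
      by_cases hm2 : m = -(l + 1)
      · subst hm2
        have h := hplane' (-(l : ℤ))
        rw [star_planeFun_mul (by simp), contAct_smul, Submodule.smul_mem_iff _
          (by exact_mod_cast h2.ne'), sub_eq_add_neg, contAct_add, contAct_smul] at h
        have hpos : 0 < upOne l (-((-(l : ℤ) : ℤ) : ℝ)) := by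
          refine Real.sqrt_pos.2 ?_
          push_cast; rw [neg_neg]; positivity
        rw [show -((l : ℤ) + 1) = -(l : ℤ) - 1 by ring]
        refine mem_of_smul_add_mem hpos h ?_
        rw [contAct_neg, contAct_smul]
        exact neg_mem (Submodule.smul_mem _ _ (hlow _))
      · have hml : |m| ≤ l := by rw [abs_le]; push_cast at hm; omega
        have h := hc 2 m
        rw [coordinate_two_mul hml, contAct_add, contAct_smul] at h
        have hpos : 0 < upZero l m := by
          have h1 : (m : ℝ) ≤ l := by exact_mod_cast (abs_le.1 hml).2
          have h2 : -(l : ℝ) ≤ m := by exact_mod_cast (abs_le.1 hml).1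
          refine Real.sqrt_pos.2 (div_pos (mul_pos ?_ ?_) (by positivity)) <;> linarith
        refine mem_of_smul_add_mem hpos h ?_
        rw [contAct_smul]
        exact Submodule.smul_mem _ _ (hlow _)

theorem inner_Y_toL2_eq_zero {n : ℕ} {f : C(Sphere, ℂ)} (hf : f ∈ degreeSpan n) {p : Idx}
    (hp : n < p.1.1) : inner ℂ (Y p) (toL2 f) = 0 := by
  induction hf using Submodule.span_induction with
  | zero => simp
  | add f g _ _ hf hg => rw [map_add, inner_add_right, hf, hg, add_zero]
  | smul c f _ hf => rw [map_smul, inner_smul_right, hf, mul_zero]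
  | mem f hf =>
    obtain ⟨l, hl, m, rfl⟩ := hf
    by_cases hm : |m| ≤ l
    · have := orthonormal_Y.2 (i := p) (j := ⟨(l, m), hm⟩) (by
        rintro rfl
        exact absurd hl (by simpa using hp))
      exact this
    · rw [sphHarmonic_eq_zero (by omega)]; simp

theorem sphereAct_symm_apply (g : Space ≃ₗᵢ[ℝ] Space) (f : L2Sphere) :
    sphereAct g.symm (sphereAct g f) = f := by
  have h : ((sphereAct g.symm).comp (sphereAct g)).toContinuousLinearMap =
      ContinuousLinearMap.id ℂ L2Sphere := by
    refine continuousLinearMap_ext_Y fun p => ?_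
    simp only [LinearIsometry.coe_toContinuousLinearMap, LinearIsometry.coe_comp,
      Function.comp, Y_eq, sphereAct_toL2, ContinuousLinearMap.id_apply]
    congr 1
    ext x
    simp [contAct_apply, sphereMap]
  exact congrArg (fun A : L2Sphere →L[ℂ] L2Sphere => A f) h

theorem inner_sphereAct_left (g : Space ≃ₗᵢ[ℝ] Space) (f h : L2Sphere) :
    inner ℂ f (sphereAct g h) = inner ℂ (sphereAct g.symm f) h := by
  rw [← sphereAct_inner g.symm f, sphereAct_symm_apply]

/-- An orthogonal map does not raise the degree. Used for g this excludes components of higher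
degree; used for the inverse on the other side of the inner product it excludes those of lower
degree. -/
theorem inner_Y_sphereAct_Y (g : Space ≃ₗᵢ[ℝ] Space) {p q : Idx} (h : p.1.1 ≠ q.1.1) :
    inner ℂ (Y p) (sphereAct g (Y q)) = 0 := by
  rcases lt_or_gt_of_ne h with h | h
  · rw [inner_sphereAct_left, ← inner_conj_symm, Y_eq p, sphereAct_toL2,
      inner_Y_toL2_eq_zero (contAct_sphHarmonic_mem _ _ _) h, map_zero]
  · rw [Y_eq q, sphereAct_toL2]
    exact inner_Y_toL2_eq_zero (contAct_sphHarmonic_mem _ _ _) h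

/-! ### Multipliers depending on the degree -/

theorem memℓp_multiplier {c : ℕ → ℂ} {B : ℝ} (hc : ∀ l, ‖c l‖ ≤ B) (φ : OneParticle) :
    Memℓp (fun p : Idx => c p.1.1 * φ p) 2 := by
  have hB : 0 ≤ B := (norm_nonneg _).trans (hc 0)
  refine Memℓp.mono' ((lp.memℓp φ).const_mul (B : ℂ)) fun p => ?_
  rw [norm_mul, norm_mul, Complex.norm_real, Real.norm_of_nonneg hB]
  gcongr
  exact hc _

open Classical in
/-- The operator multiplying `φ_{l,m}` by `c l`, for a bounded sequence `c`. -/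
def multiplier (c : ℕ → ℂ) : OneParticle →L[ℂ] OneParticle :=
  if h : ∃ B, ∀ l, ‖c l‖ ≤ B then
    LinearMap.mkContinuous
      { toFun := fun φ => ⟨fun p => c p.1.1 * φ p, memℓp_multiplier h.choose_spec φ⟩
        map_add' := fun φ ψ => by ext p; simp [mul_add]; rfl
        map_smul' := fun a φ => by ext p; simp; ring } h.choose (fun φ => by
          have hB : 0 ≤ h.choose := (norm_nonneg _).trans (h.choose_spec 0)
          have h1 : ‖((h.choose : ℂ)) • φ‖ = h.choose * ‖φ‖ := by
            rw [norm_smul, Complex.norm_real, Real.norm_of_nonneg hB]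
          rw [← h1]
          refine lp.norm_mono (by norm_num) fun p => ?_
          have h2 : ‖((h.choose : ℂ) • φ : OneParticle) p‖ = h.choose * ‖φ p‖ := by
            rw [lp.coeFn_smul, Pi.smul_apply, norm_smul, Complex.norm_real,
              Real.norm_of_nonneg hB]
          rw [h2]
          change ‖c p.1.1 * φ p‖ ≤ _
          rw [norm_mul]
          gcongr
          exact h.choose_spec _)
  else 0

theorem multiplier_apply {c : ℕ → ℂ} (h : ∃ B, ∀ l, ‖c l‖ ≤ B) (φ : OneParticle) (p : Idx) :
    multiplier c φ p = c p.1.1 * φ p := by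
  rw [multiplier, dif_pos h]; rfl

/-- The multiplication by a sequence of phases as a unitary map. -/
def phaseEquiv (c : ℕ → ℂ) (hc : ∀ l, ‖c l‖ = 1) : OneParticle ≃ₗᵢ[ℂ] OneParticle where
  toLinearEquiv := LinearEquiv.ofLinearMap (multiplier c).toLinearMap
    (multiplier fun l => conj (c l)).toLinearMap
    (by
      ext φ p
      simp only [LinearMap.comp_apply, ContinuousLinearMap.coe_coe, LinearMap.id_apply]
      rw [multiplier_apply ⟨1, fun l => (hc l).le⟩,
        multiplier_apply ⟨1, fun l => by simp [hc]⟩, ← mul_assoc, Complex.mul_conj']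
      simp [hc])
    (by
      ext φ p
      simp only [LinearMap.comp_apply, ContinuousLinearMap.coe_coe, LinearMap.id_apply]
      rw [multiplier_apply ⟨1, fun l => by simp [hc]⟩,
        multiplier_apply ⟨1, fun l => (hc l).le⟩, ← mul_assoc, mul_comm (conj _),
        Complex.mul_conj']
      simp [hc])
  norm_map' := fun φ => by
    have h : ∀ p, ‖multiplier c φ p‖ = ‖φ p‖ := fun p => by
      rw [multiplier_apply ⟨1, fun l => (hc l).le⟩, norm_mul, hc, one_mul]
    exact le_antisymm (lp.norm_mono (by norm_num) fun p => (h p).le)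
      (lp.norm_mono (by norm_num) fun p => (h p).ge)

theorem phaseEquiv_symm_apply {c : ℕ → ℂ} (hc : ∀ l, ‖c l‖ = 1) (φ : OneParticle) (p : Idx) :
    (phaseEquiv c hc).symm φ p = conj (c p.1.1) * φ p :=
  multiplier_apply ⟨1, fun l => by simp [hc]⟩ φ p

/-- The operator on `L²(S²)` multiplying `Y_l^m` by `c l`, for a bounded sequence `c`. -/
def sphereMultiplier (c : ℕ → ℂ) : L2Sphere →L[ℂ] L2Sphere :=
  (expand : OneParticle →L[ℂ] L2Sphere) ∘L multiplier c ∘L (expand.symm : L2Sphere →L[ℂ] OneParticle)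

theorem sphereMultiplier_expand (c : ℕ → ℂ) (φ : OneParticle) :
    sphereMultiplier c (expand φ) = expand (multiplier c φ) := by
  simp [sphereMultiplier]

theorem inner_Y_sphereMultiplier {c : ℕ → ℂ} (h : ∃ B, ∀ l, ‖c l‖ ≤ B) (f : L2Sphere) (p : Idx) :
    inner ℂ (Y p) (sphereMultiplier c f) = c p.1.1 * inner ℂ (Y p) f := by
  obtain ⟨φ, rfl⟩ := expand.surjective f
  rw [sphereMultiplier_expand, inner_Y_expand, inner_Y_expand, multiplier_apply h]

theorem sphereMultiplier_Y {c : ℕ → ℂ} (h : ∃ B, ∀ l, ‖c l‖ ≤ B) (p : Idx) :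
    sphereMultiplier c (Y p) = c p.1.1 • Y p := by
  refine L2_ext fun q => ?_
  rw [inner_Y_sphereMultiplier h, inner_smul_right, orthonormal_iff_ite.1 orthonormal_Y]
  split_ifs with hqp
  · rw [hqp]
  · simp

/-- Orthogonal maps preserve the degree, and the multiplier is a scalar in each degree. This gives
postulate II and the parities of postulate III for the explicit family at one stroke. -/
theorem sphereMultiplier_sphereAct {c : ℕ → ℂ} (h : ∃ B, ∀ l, ‖c l‖ ≤ B)
    (g : Space ≃ₗᵢ[ℝ] Space) (f : L2Sphere) :
    sphereMultiplier c (sphereAct g f) = sphereAct g (sphereMultiplier c f) := by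
  have key : (sphereMultiplier c) ∘L (sphereAct g).toContinuousLinearMap =
      (sphereAct g).toContinuousLinearMap ∘L (sphereMultiplier c) := by
    refine continuousLinearMap_ext_Y fun q => L2_ext fun p => ?_
    simp only [ContinuousLinearMap.comp_apply, LinearIsometry.coe_toContinuousLinearMap]
    rw [inner_Y_sphereMultiplier h, sphereMultiplier_Y h, map_smul, inner_smul_right]
    by_cases hpq : p.1.1 = q.1.1
    · rw [hpq]
    · rw [inner_Y_sphereAct_Y g hpq]; simp
  exact congrArg (fun A : L2Sphere →L[ℂ] L2Sphere => A f) key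

theorem inner_star_right (f h : L2Sphere) :
    inner ℂ f (star h) = conj (inner ℂ (star f) h) := by
  rw [L2.inner_def, L2.inner_def, ← integral_conj]
  refine integral_congr_ae ?_
  filter_upwards [Lp.coeFn_star f, Lp.coeFn_star h] with x hf hh
  rw [hf, hh]
  simp

theorem star_toL2 (f : C(Sphere, ℂ)) : star (toL2 f) = toL2 (star f) := by
  apply Lp.ext
  filter_upwards [Lp.coeFn_star (toL2 f), toL2_coeFn f, toL2_coeFn (star f)] with x h1 h2 h3
  rw [h1, h3, Pi.star_apply, h2]; rfl

/-- The index `(l, -m)`. -/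
def negIdx (p : Idx) : Idx := ⟨(p.1.1, -p.1.2), by simpa using p.2⟩

theorem star_Y (p : Idx) : star (Y p) = ((-1 : ℂ) ^ p.1.2) • Y (negIdx p) := by
  rw [Y_eq, star_toL2, Y_eq, ← map_smul]
  congr 1
  ext x
  simp [conj_sphHarmonic, negIdx]

theorem inner_Y_star (f : L2Sphere) (p : Idx) :
    inner ℂ (Y p) (star f) = (-1 : ℂ) ^ p.1.2 * conj (inner ℂ (Y (negIdx p)) f) := by
  rw [inner_star_right, star_Y, inner_smul_left, map_mul, Complex.conj_conj]

theorem sphereMultiplier_star {c : ℕ → ℂ} (h : ∃ B, ∀ l, ‖c l‖ ≤ B) (f : L2Sphere) :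
    star (sphereMultiplier c f) = sphereMultiplier (fun l => conj (c l)) (star f) := by
  refine L2_ext fun p => ?_
  rw [inner_Y_star, inner_Y_sphereMultiplier h, inner_Y_sphereMultiplier (by simpa using h),
    inner_Y_star, map_mul]
  simp only [negIdx]
  ring

/-! ### Multiplication by the coordinates -/

theorem coordMul_toL2 (j : Fin 3) (f : C(Sphere, ℂ)) :
    coordMul j (toL2 f) = toL2 (coordinate j * f) := by
  apply Lp.ext
  have h1 := Lp.coeFn_lpSMul (r := 2)
    ((coordinate j).toLp ⊤ sphereMeasure ℂ : Lp ℂ ⊤ sphereMeasure) (toL2 f)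
  refine EventuallyEq.trans h1 ?_
  filter_upwards [toL2_coeFn f, toL2_coeFn (coordinate j * f),
    ContinuousMap.coeFn_toLp (p := ⊤) (𝕜 := ℂ) sphereMeasure (coordinate j)] with x h2 h3 h4
  rw [Pi.smul_apply', h4, h2, h3]; rfl

theorem norm_coordMul_le (j : Fin 3) (f : L2Sphere) : ‖coordMul j f‖ ≤ ‖f‖ := by
  have h1 := Lp.coeFn_lpSMul (r := 2)
    ((coordinate j).toLp ⊤ sphereMeasure ℂ : Lp ℂ ⊤ sphereMeasure) f
  refine Lp.norm_le_norm_of_ae_le ?_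
  change ∀ᵐ x ∂sphereMeasure, ‖(((coordinate j).toLp ⊤ sphereMeasure ℂ :
    Lp ℂ ⊤ sphereMeasure) • f : L2Sphere) x‖ ≤ ‖f x‖
  filter_upwards [h1, ContinuousMap.coeFn_toLp (p := ⊤) (𝕜 := ℂ) sphereMeasure (coordinate j)]
    with x h2 h4
  rw [h2, Pi.smul_apply', h4, norm_smul, coordinate_apply, Complex.norm_real]
  have h5 : ‖(x : Space) j‖ ≤ 1 := by
    refine (PiLp.norm_apply_le (x : Space) j).trans ?_
    simp
  exact mul_le_of_le_one_left (norm_nonneg _) h5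

/-- `coordMul` as a bounded operator. -/
def coordMulL (j : Fin 3) : L2Sphere →L[ℂ] L2Sphere :=
  (coordMul j).mkContinuous 1 fun f => by simpa using norm_coordMul_le j f

theorem coordMulL_apply (j : Fin 3) (f : L2Sphere) : coordMulL j f = coordMul j f := rfl

/-! ### Values of the `3`-`j` symbols with one entry equal to `1` -/

/-- The parameters u = l + m, v = l - m, a = 1 + t, b = 1 - t turn all factorial arguments into
natural numbers without case distinctions. Only k = 0 survives in the Racah sum. -/
theorem wigner3j_one_succ {l u v a b : ℕ} (huv : u + v = 2 * l) (hab : a + b = 2) :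
    wigner3j 1 l (l + 1) ((a : ℤ) - 1) ((u : ℤ) - l) (-((a : ℤ) - 1 + ((u : ℤ) - l))) =
      (-1) ^ ((1 : ℤ) - l + ((a : ℤ) - 1 + ((u : ℤ) - l))) *
      √((2 * (2 * l).factorial : ℝ) / (2 * l + 3).factorial) *
      √(a.factorial * b.factorial * u.factorial * v.factorial * (u + a).factorial
        * (v + b).factorial) / (a.factorial * b.factorial * u.factorial * v.factorial) := by
  rw [wigner3j, if_pos ⟨by ring, by omega, by omega, by omega, by rw [abs_le]; omega,
    by rw [abs_le]; omega, by rw [abs_le]; push_cast; omega⟩]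
  rw [Finset.sum_eq_single_of_mem 0 (by
    simp only [Finset.mem_filter, Finset.mem_range]; push_cast; omega) (by
    intro k hk hk0
    simp only [Finset.mem_filter] at hk
    push_cast at hk; omega)]
  rw [show 1 + l - (l + 1) = 0 by omega, show 1 + (l + 1) - l = 2 by omega,
    show l + (l + 1) - 1 = 2 * l by omega, show 1 + l + (l + 1) + 1 = 2 * l + 3 by omega,
    show (((1 : ℕ) : ℤ) + ((a : ℤ) - 1)).toNat = a by omega,
    show (((1 : ℕ) : ℤ) - ((a : ℤ) - 1)).toNat = b by omega,
    show ((l : ℤ) + ((u : ℤ) - l)).toNat = u by omega,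
    show ((l : ℤ) - ((u : ℤ) - l)).toNat = v by omega,
    show (((l + 1 : ℕ) : ℤ) + -((a : ℤ) - 1 + ((u : ℤ) - l))).toNat = v + b by omega,
    show (((l + 1 : ℕ) : ℤ) - -((a : ℤ) - 1 + ((u : ℤ) - l))).toNat = u + a by omega,
    show (((1 : ℕ) : ℤ) + l - (l + 1 : ℕ) - (0 : ℕ)).toNat = 0 by omega,
    show (((1 : ℕ) : ℤ) - ((a : ℤ) - 1) - (0 : ℕ)).toNat = b by omega,
    show ((l : ℤ) + ((u : ℤ) - l) - (0 : ℕ)).toNat = u by omega,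
    show (((l + 1 : ℕ) : ℤ) - l + ((a : ℤ) - 1) + (0 : ℕ)).toNat = a by omega,
    show (((l + 1 : ℕ) : ℤ) - (1 : ℕ) - ((u : ℤ) - l) + (0 : ℕ)).toNat = v by omega]
  rw [show (a.factorial * b.factorial * u.factorial * v.factorial * (v + b).factorial
    * (u + a).factorial : ℝ) = a.factorial * b.factorial * u.factorial * v.factorial *
      (u + a).factorial * (v + b).factorial by ring]
  simp only [Nat.factorial_zero, Nat.factorial_two, pow_zero, Nat.cast_one, one_mul, mul_one,
    sub_neg_eq_add, Nat.cast_ofNat]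
  field_simp

/-- Here l = p + 1, and x, y stand for p ± s with s = m + t. The only term of the Racah sum is k =
b, the source of the sign (-1)^b. -/
theorem wigner3j_one_pred {p u v a b x y : ℕ} (huv : u + v = 2 * (p + 1)) (hab : a + b = 2)
    (hx : x + 2 = u + a) (hy : y + 2 = v + b) :
    wigner3j 1 (p + 1) p ((a : ℤ) - 1) ((u : ℤ) - (p + 1))
        (-((a : ℤ) - 1 + ((u : ℤ) - (p + 1)))) =
      (-1) ^ (-(p : ℤ) + ((a : ℤ) - 1 + ((u : ℤ) - (p + 1)))) *
      √((2 * (2 * p).factorial : ℝ) / (2 * p + 3).factorial) *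
      √(a.factorial * b.factorial * u.factorial * v.factorial * x.factorial
        * y.factorial) * (-1) ^ b / (a.factorial * b.factorial * x.factorial * y.factorial) := by
  rw [wigner3j, if_pos ⟨by ring, by omega, by omega, by omega, by rw [abs_le]; omega,
    by rw [abs_le]; omega, by rw [abs_le]; omega⟩]
  rw [Finset.sum_eq_single_of_mem b (by
    simp only [Finset.mem_filter, Finset.mem_range]; push_cast; omega) (by
    intro k hk hk0
    simp only [Finset.mem_filter] at hk
    push_cast at hk; omega)]
  rw [show 1 + (p + 1) - p = 2 by omega, show 1 + p - (p + 1) = 0 by omega,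
    show p + 1 + p - 1 = 2 * p by omega, show 1 + (p + 1) + p + 1 = 2 * p + 3 by omega,
    show (((1 : ℕ) : ℤ) + ((a : ℤ) - 1)).toNat = a by omega,
    show (((1 : ℕ) : ℤ) - ((a : ℤ) - 1)).toNat = b by omega,
    show (((p + 1 : ℕ) : ℤ) + ((u : ℤ) - (p + 1))).toNat = u by omega,
    show (((p + 1 : ℕ) : ℤ) - ((u : ℤ) - (p + 1))).toNat = v by omega,
    show ((p : ℤ) + -((a : ℤ) - 1 + ((u : ℤ) - (p + 1)))).toNat = y by omega,
    show ((p : ℤ) - -((a : ℤ) - 1 + ((u : ℤ) - (p + 1)))).toNat = x by omega,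
    show (((1 : ℕ) : ℤ) + (p + 1 : ℕ) - p - (b : ℕ)).toNat = a by omega,
    show (((1 : ℕ) : ℤ) - ((a : ℤ) - 1) - (b : ℕ)).toNat = 0 by omega,
    show (((p + 1 : ℕ) : ℤ) + ((u : ℤ) - (p + 1)) - (b : ℕ)).toNat = x by omega,
    show ((p : ℤ) - (p + 1 : ℕ) + ((a : ℤ) - 1) + (b : ℕ)).toNat = 0 by omega,
    show ((p : ℤ) - (1 : ℕ) - ((u : ℤ) - (p + 1)) + (b : ℕ)).toNat = y by omega]
  rw [show (a.factorial * b.factorial * u.factorial * v.factorial * y.factorial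
    * x.factorial : ℝ) = a.factorial * b.factorial * u.factorial * v.factorial *
      x.factorial * y.factorial by ring,
    show ((1 : ℕ) : ℤ) - (p + 1 : ℕ) - -((a : ℤ) - 1 + ((u : ℤ) - (p + 1))) =
      -(p : ℤ) + ((a : ℤ) - 1 + ((u : ℤ) - (p + 1))) by push_cast; ring]
  simp only [Nat.factorial_zero, Nat.factorial_two, Nat.cast_one, mul_one, Nat.cast_ofNat]
  field_simp

/-- The parity rule: the two terms k = 0 and k = 1 of the Racah sum cancel. -/
theorem wigner3j_one_self (l : ℕ) : wigner3j 1 l l 0 0 0 = 0 := by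
  rw [wigner3j]
  split_ifs with h
  · obtain ⟨l, rfl⟩ : ∃ k, l = k + 1 := ⟨l - 1, by omega⟩
    have hs : ((Finset.range (1 + (l + 1) + 1)).filter (fun k : ℕ =>
        (k : ℤ) ≤ (1 : ℕ) + (l + 1 : ℕ) - (l + 1 : ℕ) ∧ (k : ℤ) ≤ (1 : ℕ) - 0 ∧
        (k : ℤ) ≤ (l + 1 : ℕ) + 0 ∧ 0 ≤ ((l + 1 : ℕ) : ℤ) - (l + 1 : ℕ) + 0 + k ∧
        0 ≤ ((l + 1 : ℕ) : ℤ) - (1 : ℕ) - 0 + k)) = {0, 1} := by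
      ext k
      simp only [Finset.mem_filter, Finset.mem_range, Finset.mem_insert, Finset.mem_singleton]
      push_cast; omega
    rw [hs, Finset.sum_pair (by norm_num)]
    simp
    right
    field_simp
    simp
  · rfl

/-- The matrix element of a spherical component of `r̂` in terms of `3`-`j` symbols. -/
def dipoleProd (t : ℤ) (l : ℕ) (m : ℤ) (l' : ℕ) (s : ℤ) : ℝ :=
  (-1) ^ s * √((2 * l + 1) * (2 * l' + 1)) * wigner3j 1 l l' 0 0 0 * wigner3j 1 l l' t m (-s)

theorem dipoleProd_eq_zero_of_ne {t : ℤ} {l : ℕ} {m : ℤ} {l' : ℕ} {s : ℤ} (h : s ≠ m + t) :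
    dipoleProd t l m l' s = 0 := by
  rw [dipoleProd, wigner3j, wigner3j, if_neg (c := t + m + -s = 0 ∧ _) (by
    rintro ⟨h1, -⟩; omega), mul_zero]

theorem dipoleProd_eq_zero {t : ℤ} {l : ℕ} {m : ℤ} {l' : ℕ} {s : ℤ} (h : l' ≠ l + 1)
    (h' : l ≠ l' + 1) : dipoleProd t l m l' s = 0 := by
  by_cases hl : l' = l
  · subst hl
    rw [dipoleProd, wigner3j_one_self]; simp
  · rw [dipoleProd, wigner3j, if_neg (by rintro ⟨-, -, h2, h3, -⟩; omega)]; simp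

theorem mul_sqrt_mul_sqrt {c A B : ℝ} (hc : 0 ≤ c) (hA : 0 ≤ A) :
    c * √A * √B = √(c ^ 2 * A * B) := by
  rw [Real.sqrt_mul (by positivity), Real.sqrt_mul (by positivity), Real.sqrt_sq hc]

theorem factorial_two_mul_div (l : ℕ) : (2 * (2 * l).factorial : ℝ) / (2 * l + 3).factorial =
    1 / ((2 * l + 1) * (l + 1) * (2 * l + 3)) := by
  rw [Nat.factorial_succ, Nat.factorial_succ, Nat.factorial_succ]
  push_cast
  field_simp
  ring

theorem wigner3j_one_succ_zero (l : ℕ) : wigner3j 1 l (l + 1) 0 0 0 =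
    (-1) ^ ((1 : ℤ) - l) * √((2 * (2 * l).factorial : ℝ) / (2 * l + 3).factorial) * (l + 1) := by
  have h := wigner3j_one_succ (l := l) (u := l) (v := l) (a := 1) (b := 1) (by ring) rfl
  simp only [Nat.cast_one, sub_self, add_zero, neg_zero, Nat.factorial_one, one_mul] at h
  rw [h, show (l.factorial * l.factorial * (l + 1).factorial *
    (l + 1).factorial : ℝ) = (l.factorial * (l + 1).factorial) ^ 2 by ring,
    Real.sqrt_sq (by positivity), Nat.factorial_succ l]
  push_cast
  field_simp

theorem wigner3j_one_pred_zero (p : ℕ) : wigner3j 1 (p + 1) p 0 0 0 =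
    -((-1) ^ (-(p : ℤ)) * √((2 * (2 * p).factorial : ℝ) / (2 * p + 3).factorial) * (p + 1)) := by
  have h := wigner3j_one_pred (p := p) (u := p + 1) (v := p + 1) (a := 1) (b := 1) (x := p)
    (y := p) (by ring) rfl (by ring) (by ring)
  push_cast at h
  simp only [sub_self, add_zero, neg_zero, Nat.factorial_one, Nat.cast_one, one_mul] at h
  rw [h, show ((p + 1).factorial * (p + 1).factorial *
    p.factorial * p.factorial : ℝ) = (p.factorial * (p + 1).factorial) ^ 2 by ring,
    Real.sqrt_sq (by positivity), Nat.factorial_succ p]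
  push_cast
  field_simp

theorem neg_one_zpow_mul_self_real (m : ℤ) : (-1 : ℝ) ^ m * (-1 : ℝ) ^ m = 1 := by
  rw [← mul_zpow]; simp

/-- Each of the two 3-j symbols carries the same l-dependent sign and the same square root, and the
prefactor (-1)^s meets the sign of the second symbol. All signs square to 1, and a single positive
root remains to be compared with `upZero` and `upOne`. -/
theorem dipoleProd_succ {l u v a b : ℕ} (huv : u + v = 2 * l) (hab : a + b = 2) :
    dipoleProd ((a : ℤ) - 1) l ((u : ℤ) - l) (l + 1) ((a : ℤ) - 1 + ((u : ℤ) - l)) =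
      √((u + a).factorial * (v + b).factorial / (a.factorial * b.factorial * u.factorial *
        v.factorial * ((2 * l + 1) * (2 * l + 3)))) := by
  rw [dipoleProd, wigner3j_one_succ huv hab, wigner3j_one_succ_zero, factorial_two_mul_div]
  set s : ℤ := (a : ℤ) - 1 + ((u : ℤ) - l)
  have h1 := neg_one_zpow_mul_self_real s
  have h2 := neg_one_zpow_mul_self_real ((1 : ℤ) - l)
  rw [zpow_add₀ (by norm_num) ((1 : ℤ) - l) s]
  have h3 : √(1 / (((2 : ℝ) * l + 1) * (l + 1) * (2 * l + 3))) *
      √(1 / (((2 : ℝ) * l + 1) * (l + 1) * (2 * l + 3))) =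
      1 / (((2 : ℝ) * l + 1) * (l + 1) * (2 * l + 3)) := Real.mul_self_sqrt (by positivity)
  set r := √(1 / (((2 : ℝ) * l + 1) * (l + 1) * (2 * l + 3)))
  set B : ℝ := a.factorial * b.factorial * u.factorial * v.factorial * (u + a).factorial
        * (v + b).factorial with hB
  have h4 : (-1 : ℝ) ^ s * √((2 * l + 1) * (2 * ((l + 1 : ℕ) : ℝ) + 1)) *
      ((-1) ^ ((1 : ℤ) - l) * r * (l + 1)) * ((-1) ^ ((1 : ℤ) - l) * (-1) ^ s * r * √B /
        (a.factorial * b.factorial * u.factorial * v.factorial)) =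
      ((-1) ^ s * (-1) ^ s) * ((-1) ^ ((1 : ℤ) - l) * (-1) ^ ((1 : ℤ) - l)) *
      ((r * r * (l + 1) / (a.factorial * b.factorial * u.factorial * v.factorial))
        * √((2 * l + 1) * (2 * ((l + 1 : ℕ) : ℝ) + 1)) * √B) := by ring
  rw [h4, h1, h2, h3, mul_sqrt_mul_sqrt (by positivity) (by positivity), one_mul, one_mul, hB]
  congr 1
  push_cast
  field_simp
  ring

theorem dipoleProd_pred {p u v a b x y : ℕ} (huv : u + v = 2 * (p + 1)) (hab : a + b = 2)
    (hx : x + 2 = u + a) (hy : y + 2 = v + b) :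
    dipoleProd ((a : ℤ) - 1) (p + 1) ((u : ℤ) - (p + 1)) p ((a : ℤ) - 1 + ((u : ℤ) - (p + 1))) =
      -(-1) ^ b * √(u.factorial * v.factorial / (a.factorial * b.factorial * x.factorial *
        y.factorial * ((2 * p + 1) * (2 * p + 3)))) := by
  rw [dipoleProd, wigner3j_one_pred huv hab hx hy, wigner3j_one_pred_zero, factorial_two_mul_div]
  set s : ℤ := (a : ℤ) - 1 + ((u : ℤ) - (p + 1))
  have h1 := neg_one_zpow_mul_self_real s
  have h2 := neg_one_zpow_mul_self_real (-(p : ℤ))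
  rw [zpow_add₀ (by norm_num) (-(p : ℤ)) s]
  have h3 : √(1 / (((2 : ℝ) * p + 1) * (p + 1) * (2 * p + 3))) *
      √(1 / (((2 : ℝ) * p + 1) * (p + 1) * (2 * p + 3))) =
      1 / (((2 : ℝ) * p + 1) * (p + 1) * (2 * p + 3)) := Real.mul_self_sqrt (by positivity)
  set r := √(1 / (((2 : ℝ) * p + 1) * (p + 1) * (2 * p + 3)))
  set B : ℝ := a.factorial * b.factorial * u.factorial * v.factorial * x.factorial
        * y.factorial with hB
  have h4 : (-1 : ℝ) ^ s * √((2 * ((p + 1 : ℕ) : ℝ) + 1) * (2 * p + 1)) *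
      (-((-1) ^ (-(p : ℤ)) * r * (p + 1))) * ((-1) ^ (-(p : ℤ)) * (-1) ^ s * r * √B * (-1) ^ b /
        (a.factorial * b.factorial * x.factorial * y.factorial)) =
      ((-1) ^ s * (-1) ^ s) * ((-1) ^ (-(p : ℤ)) * (-1) ^ (-(p : ℤ))) * (-(-1) ^ b *
      ((r * r * (p + 1) / (a.factorial * b.factorial * x.factorial * y.factorial))
        * √((2 * ((p + 1 : ℕ) : ℝ) + 1) * (2 * p + 1)) * √B)) := by ring
  rw [h4, h1, h2, h3, mul_sqrt_mul_sqrt (by positivity) (by positivity), one_mul, one_mul, hB]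
  congr 2
  push_cast
  field_simp
  ring


theorem dipoleProd_zero_succ {l : ℕ} {m : ℤ} (h : |m| ≤ l) :
    dipoleProd 0 l m (l + 1) m = upZero l m := by
  rw [abs_le] at h
  obtain ⟨u, hu⟩ := Int.eq_ofNat_of_zero_le (show 0 ≤ (l : ℤ) + m by omega)
  obtain ⟨v, hv⟩ := Int.eq_ofNat_of_zero_le (show 0 ≤ (l : ℤ) - m by omega)
  have := dipoleProd_succ (l := l) (u := u) (v := v) (a := 1) (b := 1) (by omega) rfl
  obtain rfl : m = (u : ℤ) - l := by omega
  have hl : (2 * (l : ℝ)) = u + v := by exact_mod_cast (show 2 * l = u + v by omega)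
  have hl' : (l : ℝ) = (u + v) / 2 := by linarith
  simp only [Nat.cast_one, sub_self, zero_add] at this
  rw [this, upZero, Nat.factorial_succ, Nat.factorial_succ]
  congr 1
  push_cast
  rw [show (l : ℝ) + 1 - (u - l) = v + 1 by linarith]
  simp
  field_simp
  ring

theorem dipoleProd_one_succ {l : ℕ} {m : ℤ} (h : |m| ≤ l) :
    dipoleProd 1 l m (l + 1) (m + 1) = upOne l m := by
  rw [abs_le] at h
  obtain ⟨u, hu⟩ := Int.eq_ofNat_of_zero_le (show 0 ≤ (l : ℤ) + m by omega)
  obtain ⟨v, hv⟩ := Int.eq_ofNat_of_zero_le (show 0 ≤ (l : ℤ) - m by omega)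
  have := dipoleProd_succ (l := l) (u := u) (v := v) (a := 2) (b := 0) (by omega) rfl
  obtain rfl : m = (u : ℤ) - l := by omega
  rw [show ((2 : ℕ) : ℤ) - 1 = 1 by norm_num, add_comm (1 : ℤ)] at this
  rw [this, upOne, Nat.factorial_succ, Nat.factorial_succ]
  congr 1
  push_cast
  simp
  field_simp
  ring

theorem dipoleProd_neg_one_succ {l : ℕ} {m : ℤ} (h : |m| ≤ l) :
    dipoleProd (-1) l m (l + 1) (m - 1) = upOne l (-m) := by
  rw [abs_le] at h
  obtain ⟨u, hu⟩ := Int.eq_ofNat_of_zero_le (show 0 ≤ (l : ℤ) + m by omega)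
  obtain ⟨v, hv⟩ := Int.eq_ofNat_of_zero_le (show 0 ≤ (l : ℤ) - m by omega)
  have := dipoleProd_succ (l := l) (u := u) (v := v) (a := 0) (b := 2) (by omega) rfl
  obtain rfl : m = (u : ℤ) - l := by omega
  have hl : (2 * (l : ℝ)) = u + v := by exact_mod_cast (show 2 * l = u + v by omega)
  rw [show ((0 : ℕ) : ℤ) - 1 = -1 by norm_num, neg_add_eq_sub] at this
  rw [this, upOne, Nat.factorial_succ (v + 1), Nat.factorial_succ v]
  congr 1
  push_cast
  rw [show (l : ℝ) + 1 + -(u - l) = v + 1 by linarith,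
    show (l : ℝ) + 2 + -(u - l) = v + 2 by linarith]
  simp
  field_simp
  ring

theorem dipoleProd_zero_pred {p : ℕ} {m : ℤ} (h : |m| ≤ p) :
    dipoleProd 0 (p + 1) m p m = downZero (p + 1) m := by
  rw [abs_le] at h
  obtain ⟨x, hx⟩ := Int.eq_ofNat_of_zero_le (show 0 ≤ (p : ℤ) + m by omega)
  obtain ⟨y, hy⟩ := Int.eq_ofNat_of_zero_le (show 0 ≤ (p : ℤ) - m by omega)
  have := dipoleProd_pred (p := p) (u := x + 1) (v := y + 1) (x := x) (y := y) (a := 1) (b := 1)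
    (by omega) rfl (by omega) (by omega)
  have hm : ((x + 1 : ℕ) : ℤ) - (p + 1) = m := by push_cast; omega
  have hm' : (m : ℝ) = x - p := by exact_mod_cast (show m = x - p by omega)
  have hl : (2 * (p : ℝ)) = x + y := by exact_mod_cast (show 2 * p = x + y by omega)
  rw [hm] at this
  simp only [Nat.cast_one, sub_self, zero_add, pow_one, neg_neg, one_mul] at this
  rw [this, downZero, Nat.factorial_succ, Nat.factorial_succ, hm',
    show (p : ℝ) + 1 - (x - p) = y + 1 by linarith]
  congr 1
  push_cast
  rw [show 2 * ((p : ℝ) + 1) - 1 = 2 * p + 1 by ring]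
  simp
  field_simp
  ring

theorem dipoleProd_one_pred {p : ℕ} {m : ℤ} (h : |m + 1| ≤ p) :
    dipoleProd 1 (p + 1) m p (m + 1) = -downOne (p + 1) m := by
  rw [abs_le] at h
  obtain ⟨x, hx⟩ := Int.eq_ofNat_of_zero_le (show 0 ≤ (p : ℤ) + (m + 1) by omega)
  obtain ⟨y, hy⟩ := Int.eq_ofNat_of_zero_le (show 0 ≤ (p : ℤ) - (m + 1) by omega)
  have := dipoleProd_pred (p := p) (u := x) (v := y + 2) (x := x) (y := y) (a := 2) (b := 0)
    (by omega) rfl (by omega) (by omega)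
  have hm : (x : ℤ) - (p + 1) = m := by omega
  have hm' : (m : ℝ) = x - p - 1 := by exact_mod_cast (show m = x - p - 1 by omega)
  have hl : (2 * (p : ℝ)) = x + y := by exact_mod_cast (show 2 * p = x + y by omega)
  rw [hm, show ((2 : ℕ) : ℤ) - 1 = 1 by norm_num, add_comm (1 : ℤ), pow_zero, neg_one_mul] at this
  rw [this, downOne, Nat.factorial_succ, Nat.factorial_succ, hm',
    show (p : ℝ) + 1 - (x - p - 1) = y + 2 by linarith]
  congr 2
  push_cast
  rw [show 2 * ((p : ℝ) + 1) - 1 = 2 * p + 1 by ring]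
  simp
  field_simp
  ring

theorem dipoleProd_neg_one_pred {p : ℕ} {m : ℤ} (h : |m - 1| ≤ p) :
    dipoleProd (-1) (p + 1) m p (m - 1) = -downOne (p + 1) (-m) := by
  rw [abs_le] at h
  obtain ⟨x, hx⟩ := Int.eq_ofNat_of_zero_le (show 0 ≤ (p : ℤ) + (m - 1) by omega)
  obtain ⟨y, hy⟩ := Int.eq_ofNat_of_zero_le (show 0 ≤ (p : ℤ) - (m - 1) by omega)
  have := dipoleProd_pred (p := p) (u := x + 2) (v := y) (x := x) (y := y) (a := 0) (b := 2)
    (by omega) rfl (by omega) (by omega)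
  have hm : ((x + 2 : ℕ) : ℤ) - (p + 1) = m := by push_cast; omega
  have hm' : (m : ℝ) = x - p + 1 := by exact_mod_cast (show m = x - p + 1 by omega)
  have hl : (2 * (p : ℝ)) = x + y := by exact_mod_cast (show 2 * p = x + y by omega)
  rw [hm, show ((0 : ℕ) : ℤ) - 1 = -1 by norm_num, neg_add_eq_sub, neg_one_sq, neg_one_mul] at this
  rw [this, downOne, Nat.factorial_succ (x + 1), Nat.factorial_succ x, hm',
    show (p : ℝ) + 1 - -(x - p + 1) = x + 2 by linarith]
  congr 2
  push_cast
  rw [show 2 * ((p : ℝ) + 1) - 1 = 2 * p + 1 by ring]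
  simp
  field_simp
  ring

/-! ### Matrix elements of the coordinates -/

theorem inner_Y_sphHarmonic (p : Idx) (l : ℕ) (m : ℤ) :
    inner ℂ (Y p) (toL2 (sphHarmonic l m)) = if p.1 = (l, m) then 1 else 0 := by
  by_cases hm : |m| ≤ l
  · have := orthonormal_iff_ite.1 orthonormal_Y p ⟨(l, m), hm⟩
    rw [Y_eq ⟨(l, m), hm⟩] at this
    rw [this]
    simp only [Subtype.ext_iff]
  · rw [sphHarmonic_eq_zero (by omega), map_zero, inner_zero_right, if_neg]
    intro h
    have := p.2
    rw [h] at this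
    exact hm this

theorem inner_Y_coordinate_two_mul (p q : Idx) :
    inner ℂ (Y p) (toL2 (coordinate 2 * sphHarmonic q.1.1 q.1.2)) =
      dipoleProd 0 q.1.1 q.1.2 p.1.1 p.1.2 := by
  obtain ⟨⟨l, m⟩, hm⟩ := q
  obtain ⟨⟨l', s⟩, hs⟩ := p
  simp only at hm hs ⊢
  rw [coordinate_two_mul hm]
  simp only [map_add, map_smul, inner_add_right, inner_smul_right, inner_Y_sphHarmonic,
    Prod.mk.injEq]
  by_cases hsm : s = m
  swap
  · rw [dipoleProd_eq_zero_of_ne (by simpa using hsm)]; simp [hsm]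
  subst hsm
  by_cases h1 : l' = l + 1
  · subst h1
    rw [dipoleProd_zero_succ hm]
    rw [if_pos ⟨rfl, rfl⟩, if_neg (by omega)]; simp
  by_cases h2 : l = l' + 1
  · subst h2
    rw [dipoleProd_zero_pred hs]
    rw [if_neg (by omega), if_pos (by simp)]; simp
  rw [dipoleProd_eq_zero h1 h2, if_neg (by omega)]
  -- For l = 0 the truncated index l - 1 is again 0, so the indicator may be 1; the coefficient
  -- vanishes instead.
  by_cases h3 : l = 0
  · subst h3
    obtain rfl : s = 0 := by simpa using hm
    simp [downZero]
  · rw [if_neg (by omega)]; simp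

theorem inner_Y_planeFun_mul (p q : Idx) :
    inner ℂ (Y p) (toL2 (planeFun * sphHarmonic q.1.1 q.1.2)) =
      -(√2 : ℝ) * dipoleProd 1 q.1.1 q.1.2 p.1.1 p.1.2 := by
  obtain ⟨⟨l, m⟩, hm⟩ := q
  obtain ⟨⟨l', s⟩, hs⟩ := p
  simp only at hm hs ⊢
  rw [planeFun_mul hm]
  simp only [map_sub, map_smul, inner_sub_right, inner_smul_right, inner_Y_sphHarmonic,
    Prod.mk.injEq]
  congr 1
  by_cases hsm : s = m + 1
  swap
  · rw [dipoleProd_eq_zero_of_ne hsm]; simp [hsm]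
  subst hsm
  by_cases h1 : l' = l + 1
  · subst h1
    rw [dipoleProd_one_succ hm]
    rw [if_pos ⟨rfl, rfl⟩, if_neg (by omega)]; simp
  by_cases h2 : l = l' + 1
  · subst h2
    rw [dipoleProd_one_pred hs]
    rw [if_neg (by omega), if_pos (by simp)]; simp
  rw [dipoleProd_eq_zero h1 h2, if_neg (by omega)]
  by_cases h3 : l = 0
  · subst h3
    obtain rfl : m = 0 := by simpa using hm
    simp [downOne]
  · rw [if_neg (by omega)]; simp

theorem inner_Y_star_planeFun_mul (p q : Idx) :
    inner ℂ (Y p) (toL2 (star planeFun * sphHarmonic q.1.1 q.1.2)) =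
      (√2 : ℝ) * dipoleProd (-1) q.1.1 q.1.2 p.1.1 p.1.2 := by
  obtain ⟨⟨l, m⟩, hm⟩ := q
  obtain ⟨⟨l', s⟩, hs⟩ := p
  simp only at hm hs ⊢
  rw [star_planeFun_mul hm]
  simp only [map_sub, map_smul, inner_sub_right, inner_smul_right, inner_Y_sphHarmonic,
    Prod.mk.injEq]
  congr 1
  by_cases hsm : s = m - 1
  swap
  · rw [dipoleProd_eq_zero_of_ne (by simpa [sub_eq_add_neg] using hsm)]; simp [hsm]
  subst hsm
  by_cases h1 : l' = l + 1
  · subst h1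
    rw [dipoleProd_neg_one_succ hm]
    rw [if_pos ⟨rfl, rfl⟩, if_neg (by omega)]; simp
  by_cases h2 : l = l' + 1
  · subst h2
    rw [dipoleProd_neg_one_pred hs]
    rw [if_neg (by omega), if_pos (by simp)]; simp
  rw [dipoleProd_eq_zero h1 h2, if_neg (by omega)]
  by_cases h3 : l = 0
  · subst h3
    obtain rfl : m = 0 := by simpa using hm
    simp [downOne]
  · rw [if_neg (by omega)]; simp

/-- Matrix elements of multiplication by the components of `r̂`. -/
theorem inner_Y_coordMul_Y (j : Fin 3) (p q : Idx) :
    inner ℂ (Y p) (coordMul j (Y q)) =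
      (-1 : ℂ) ^ p.1.2 * (√((2 * q.1.1 + 1) * (2 * p.1.1 + 1)) : ℝ) *
        (wigner3j 1 q.1.1 p.1.1 0 0 0 : ℂ) * dipole3j j q.1.1 p.1.1 q.1.2 p.1.2 := by
  rw [Y_eq q, coordMul_toL2]
  have hp := inner_Y_planeFun_mul p q
  have hm := inner_Y_star_planeFun_mul p q
  have h0 := inner_Y_coordinate_two_mul p q
  have hs : ((√2 : ℝ) : ℂ) ^ 2 = 2 := by
    rw [← Complex.ofReal_pow, Real.sq_sqrt (by norm_num)]; norm_num
  have hs0 : ((√2 : ℝ) : ℂ) ≠ 0 := by simp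
  have hs1 : ((√2 : ℝ) : ℂ) / 2 = 1 / (√2 : ℝ) := by
    field_simp; exact hs
  unfold dipoleProd at hp hm h0
  push_cast at hp hm h0
  fin_cases j
  · change inner ℂ (Y p) (toL2 (coordinate 0 * _)) = _
    rw [coordinate_zero_eq, smul_mul_assoc, add_mul, map_smul, map_add, inner_smul_right,
      inner_add_right, hp, hm]
    simp only [dipole3j]
    push_cast
    linear_combination ((-1 : ℂ) ^ p.1.2 * (√((2 * q.1.1 + 1) * (2 * p.1.1 + 1)) : ℝ) *
        (wigner3j 1 q.1.1 p.1.1 0 0 0 : ℂ) * (wigner3j 1 q.1.1 p.1.1 (-1) q.1.2 (-p.1.2)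
          - wigner3j 1 q.1.1 p.1.1 1 q.1.2 (-p.1.2))) * hs1
  · change inner ℂ (Y p) (toL2 (coordinate 1 * _)) = _
    rw [coordinate_one_eq, smul_mul_assoc, sub_mul, map_smul, map_sub, inner_smul_right,
      inner_sub_right, hp, hm]
    simp only [dipole3j]
    push_cast
    linear_combination (Complex.I * (-1 : ℂ) ^ p.1.2 *
      (√((2 * q.1.1 + 1) * (2 * p.1.1 + 1)) : ℝ) *
        (wigner3j 1 q.1.1 p.1.1 0 0 0 : ℂ) * (wigner3j 1 q.1.1 p.1.1 (-1) q.1.2 (-p.1.2)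
          + wigner3j 1 q.1.1 p.1.1 1 q.1.2 (-p.1.2))) * hs1
  · change inner ℂ (Y p) (toL2 (coordinate 2 * _)) = _
    rw [h0]
    simp only [dipole3j]

/-- The selection rules of the 3-j symbols; they make the matrix of r̂_j banded. -/
theorem inner_Y_coordMul_Y_eq_zero (j : Fin 3) {p q : Idx}
    (h : ¬ (p.1.1 ≤ q.1.1 + 1 ∧ q.1.1 ≤ p.1.1 + 1 ∧ p.1.2 ≤ q.1.2 + 1 ∧ q.1.2 ≤ p.1.2 + 1)) :
    inner ℂ (Y p) (coordMul j (Y q)) = 0 := by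
  have key : ∀ t : ℤ, |t| ≤ 1 → wigner3j 1 q.1.1 p.1.1 t q.1.2 (-p.1.2) = 0 := by
    intro t ht
    rw [abs_le] at ht
    rw [wigner3j, if_neg]
    rintro ⟨h1, h2, h3, h4, -⟩
    exact h ⟨by omega, by omega, by omega, by omega⟩
  rw [inner_Y_coordMul_Y]
  fin_cases j <;> simp [dipole3j, key]

/-! ### Square roots and sine quotients that are continuous through M² = 1 -/

/-- A square root of the real number `y`, depending continuously on `y`. -/
def rootOf (y : ℝ) : ℂ := Real.sqrt y + Complex.I * Real.sqrt (-y)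

theorem rootOf_of_nonneg {y : ℝ} (hy : 0 ≤ y) : rootOf y = (Real.sqrt y : ℂ) := by
  simp [rootOf, Real.sqrt_eq_zero_of_nonpos (neg_nonpos.2 hy)]

theorem rootOf_of_nonpos {y : ℝ} (hy : y ≤ 0) : rootOf y = Complex.I * (Real.sqrt (-y) : ℂ) := by
  simp [rootOf, Real.sqrt_eq_zero_of_nonpos hy]

theorem rootOf_sq (y : ℝ) : rootOf y ^ 2 = y := by
  rcases le_total 0 y with hy | hy
  · rw [rootOf_of_nonneg hy, ← Complex.ofReal_pow, Real.sq_sqrt hy]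
  · rw [rootOf_of_nonpos hy, mul_pow, Complex.I_sq, ← Complex.ofReal_pow,
      Real.sq_sqrt (neg_nonneg.2 hy)]
    simp

theorem continuous_rootOf : Continuous rootOf := by unfold rootOf; fun_prop

/-- `sin (Λ θ) / Λ`, continued to `Λ = 0`. -/
def sinOver (Λ θ : ℂ) : ℂ := θ * dslope Complex.sin 0 (Λ * θ)

theorem mul_sinOver (Λ θ : ℂ) : Λ * sinOver Λ θ = Complex.sin (Λ * θ) := by
  have h := sub_smul_dslope Complex.sin 0 (Λ * θ)
  simp only [sub_zero, smul_eq_mul, Complex.sin_zero] at h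
  rw [sinOver, ← h]; ring

theorem sinOver_zero_left (θ : ℂ) : sinOver 0 θ = θ := by
  simp [sinOver]

theorem sinOver_eq_div {Λ : ℂ} (h : Λ ≠ 0) (θ : ℂ) : sinOver Λ θ = Complex.sin (Λ * θ) / Λ := by
  rw [← mul_sinOver]; field_simp

theorem continuous_dslope_sin : Continuous (dslope Complex.sin 0) := by
  rw [continuous_iff_continuousAt]
  intro z
  rcases eq_or_ne z 0 with rfl | hz
  · exact continuousAt_dslope_same.2 Complex.differentiable_sin.differentiableAt
  · exact (continuousAt_dslope_of_ne hz).2 Complex.continuous_sin.continuousAt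

theorem continuous_sinOver (θ : ℂ) : Continuous fun Λ => sinOver Λ θ :=
  continuous_const.mul (continuous_dslope_sin.comp (by fun_prop))

theorem hasDerivAt_sinOver (Λ θ : ℂ) : HasDerivAt (sinOver Λ) (Complex.cos (Λ * θ)) θ := by
  rcases eq_or_ne Λ 0 with rfl | h
  · have : sinOver 0 = fun θ => θ := funext sinOver_zero_left
    rw [this, zero_mul, Complex.cos_zero]; exact hasDerivAt_id θ
  · have : sinOver Λ = fun θ => Complex.sin (Λ * θ) / Λ := funext (sinOver_eq_div h)
    rw [this]
    refine (((Complex.hasDerivAt_sin _).comp θ ((hasDerivAt_id θ).const_mul Λ)).div_const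
      Λ).congr_deriv ?_
    simp [h]

theorem sinOver_add (Λ a b : ℂ) :
    sinOver Λ (a + b) = sinOver Λ a * Complex.cos (Λ * b) + Complex.cos (Λ * a) * sinOver Λ b := by
  rcases eq_or_ne Λ 0 with rfl | h
  · simp [sinOver_zero_left]
  · simp only [sinOver_eq_div h, mul_add, Complex.sin_add]; ring

theorem conj_rootOf (y : ℝ) : conj (rootOf y) = rootOf y ∨ conj (rootOf y) = -rootOf y := by
  rcases le_total 0 y with hy | hy
  · left; rw [rootOf_of_nonneg hy, Complex.conj_ofReal]
  · right; rw [rootOf_of_nonpos hy]; simp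

/-- The function is even in its first argument, so the sign left open in `conj_rootOf` does not
matter. -/
theorem conj_sinOver (y : ℝ) (θ : ℂ) :
    conj (sinOver (rootOf y) θ) = sinOver (rootOf y) (conj θ) := by
  rcases eq_or_ne (rootOf y) 0 with h0 | h
  · simp [h0, sinOver_zero_left]
  · rw [sinOver_eq_div h, sinOver_eq_div h, map_div₀, ← Complex.sin_conj, map_mul]
    rcases conj_rootOf y with h | h <;> simp [h]

theorem conj_cos_rootOf (y : ℝ) (θ : ℂ) :
    conj (Complex.cos (rootOf y * θ)) = Complex.cos (rootOf y * conj θ) := by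
  rw [← Complex.cos_conj, map_mul]
  rcases conj_rootOf y with h | h <;> simp [h]

theorem sqrt_mul_lt_pi {y r : ℝ} (hy : y < 1) (hr : 0 < r) (hr' : r ≤ Real.pi) :
    Real.sqrt y * r < Real.pi := by
  have : Real.sqrt y < 1 := by rw [Real.sqrt_lt' one_pos]; simpa using hy
  nlinarith [Real.sqrt_nonneg y]

/-- For negative y the quotient is a hyperbolic sine. For 0 < y < 1 the argument √y r stays below π;
here M² > 0 is essential. -/
theorem sinOver_ofReal_pos {y r : ℝ} (hy : y < 1) (hr : 0 < r) (hr' : r ≤ Real.pi) :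
    ∃ s : ℝ, 0 < s ∧ sinOver (rootOf y) r = s := by
  rcases lt_trichotomy y 0 with h | rfl | h
  · have hs : 0 < Real.sqrt (-y) := Real.sqrt_pos.2 (by linarith)
    refine ⟨Real.sinh (Real.sqrt (-y) * r) / Real.sqrt (-y),
      div_pos (Real.sinh_pos_iff.2 (by positivity)) hs, ?_⟩
    have hs' : (Real.sqrt (-y) : ℂ) ≠ 0 := by exact_mod_cast hs.ne'
    rw [rootOf_of_nonpos h.le, sinOver_eq_div (mul_ne_zero Complex.I_ne_zero hs')]
    push_cast
    rw [show Complex.I * (Real.sqrt (-y) : ℂ) * r = (Real.sqrt (-y) * r : ℂ) * Complex.I by ring,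
      Complex.sin_mul_I]
    field_simp
  · exact ⟨r, hr, by simp [rootOf, sinOver_zero_left]⟩
  · have hs : 0 < Real.sqrt y := Real.sqrt_pos.2 h
    refine ⟨Real.sin (Real.sqrt y * r) / Real.sqrt y, div_pos (Real.sin_pos_of_pos_of_lt_pi
      (by positivity) (sqrt_mul_lt_pi hy hr hr')) hs, ?_⟩
    rw [rootOf_of_nonneg h.le, sinOver_eq_div (by exact_mod_cast hs.ne')]
    push_cast; rfl

theorem cos_rootOf_pos {y : ℝ} (hy : y < 1) :
    ∃ s : ℝ, 0 < s ∧ Complex.cos (rootOf y * (Real.pi / 2 : ℝ)) = s := by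
  rcases le_total y 0 with h | h
  · refine ⟨Real.cosh (Real.sqrt (-y) * (Real.pi / 2)), Real.cosh_pos _, ?_⟩
    rw [rootOf_of_nonpos h, show Complex.I * (Real.sqrt (-y) : ℂ) * (Real.pi / 2 : ℝ) =
      (Real.sqrt (-y) * (Real.pi / 2) : ℂ) * Complex.I by push_cast; ring, Complex.cos_mul_I]
    push_cast; rfl
  · have : Real.sqrt y < 1 := by rw [Real.sqrt_lt' one_pos]; simpa using hy
    refine ⟨Real.cos (Real.sqrt y * (Real.pi / 2)), Real.cos_pos_of_mem_Ioo ⟨?_, ?_⟩, ?_⟩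
    · nlinarith [Real.pi_pos, Real.sqrt_nonneg y]
    · nlinarith [Real.pi_pos, Real.sqrt_nonneg y]
    · rw [rootOf_of_nonneg h]; push_cast; rfl

/-! ### Elementary solutions of the mode equation -/

/-- The elementary solutions of `G'' = (y - l (l + 1) / cosh² η) G`, paired with their
derivatives. -/
def modePair (y η : ℝ) : ℕ → ℂ × ℂ
  | 0 => (sinOver (rootOf y) (Real.pi / 2 - Complex.I * η),
      -Complex.I * Complex.cos (rootOf y * (Real.pi / 2 - Complex.I * η)))
  | l + 1 => (-Complex.I * ((modePair y η l).2 - (l + 1) * (Real.tanh η : ℝ) * (modePair y η l).1),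
      -Complex.I * ((y - (l + 1) ^ 2 * (1 - (Real.tanh η : ℝ) ^ 2)) * (modePair y η l).1
        - (l + 1) * (Real.tanh η : ℝ) * (modePair y η l).2))

def modeG (y : ℝ) (l : ℕ) (η : ℝ) : ℂ := (modePair y η l).1

def modeD (y : ℝ) (l : ℕ) (η : ℝ) : ℂ := (modePair y η l).2

theorem modeG_zero (y η : ℝ) :
    modeG y 0 η = sinOver (rootOf y) (Real.pi / 2 - Complex.I * η) := rfl

theorem modeD_zero (y η : ℝ) :
    modeD y 0 η = -Complex.I * Complex.cos (rootOf y * (Real.pi / 2 - Complex.I * η)) := rfl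

theorem modeG_succ (y : ℝ) (l : ℕ) (η : ℝ) : modeG y (l + 1) η =
    -Complex.I * (modeD y l η - (l + 1) * (Real.tanh η : ℝ) * modeG y l η) := rfl

theorem modeD_succ (y : ℝ) (l : ℕ) (η : ℝ) : modeD y (l + 1) η =
    -Complex.I * ((y - (l + 1) ^ 2 * (1 - (Real.tanh η : ℝ) ^ 2)) * modeG y l η
      - (l + 1) * (Real.tanh η : ℝ) * modeD y l η) := rfl

theorem hasDerivAt_tanh (η : ℝ) : HasDerivAt Real.tanh (1 - Real.tanh η ^ 2) η := by
  have h := (Real.hasDerivAt_sinh η).div (Real.hasDerivAt_cosh η) (Real.cosh_pos η).ne'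
  have hf : Real.tanh = Real.sinh / Real.cosh := by
    ext x; simp [Real.tanh_eq_sinh_div_cosh]
  rw [hf]
  refine h.congr_deriv ?_
  have := (Real.cosh_pos η).ne'
  rw [Pi.div_apply]
  field_simp

theorem one_sub_tanh_sq (η : ℝ) : 1 - Real.tanh η ^ 2 = 1 / Real.cosh η ^ 2 := by
  have := (Real.cosh_pos η).ne'
  rw [Real.tanh_eq_sinh_div_cosh]
  field_simp
  linarith [Real.cosh_sq η]

/-- The passage from l to l + 1 applies -i(d/dη - (l+1) tanh η), which intertwines the two
equations. The second component in the recursion is this expression differentiated once, with G''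
eliminated by the equation for l. -/
theorem hasDerivAt_mode (y : ℝ) (l : ℕ) (η : ℝ) :
    HasDerivAt (modeG y l) (modeD y l η) η ∧
    HasDerivAt (modeD y l) ((y - l * (l + 1) * (1 - (Real.tanh η : ℝ) ^ 2)) * modeG y l η) η := by
  induction l with
  | zero =>
    have h1 : HasDerivAt (fun x : ℝ => (Real.pi / 2 - Complex.I * x : ℂ)) (-Complex.I) η := by
      simpa using ((hasDerivAt_id η).ofReal_comp.const_mul Complex.I).const_sub (Real.pi / 2 : ℂ)
    constructor
    · refine ((hasDerivAt_sinOver (rootOf y) _).comp η h1).congr_deriv ?_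
      rw [modeD_zero]; ring
    · refine (((Complex.hasDerivAt_cos _).comp η (h1.const_mul (rootOf y))).const_mul
        (-Complex.I)).congr_deriv ?_
      rw [modeG_zero, ← mul_sinOver]
      simp only [Nat.cast_zero, zero_mul, sub_zero]
      rw [← rootOf_sq y]
      linear_combination (-rootOf y ^ 2 * sinOver (rootOf y) (Real.pi / 2 - Complex.I * η)) *
        Complex.I_sq
  | succ l ih =>
    obtain ⟨hG, hD⟩ := ih
    have ht : HasDerivAt (fun x : ℝ => ((Real.tanh x : ℝ) : ℂ))
        (1 - (Real.tanh η : ℝ) ^ 2 : ℂ) η := by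
      simpa using (hasDerivAt_tanh η).ofReal_comp
    constructor
    · refine ((hD.sub ((ht.const_mul (l + 1 : ℂ)).mul hG)).const_mul (-Complex.I)).congr_deriv ?_
      rw [modeD_succ]; ring
    · have h2 := ((((ht.pow 2).const_sub 1).const_mul ((l + 1 : ℂ) ^ 2)).const_sub (y : ℂ)).mul hG
      refine ((h2.sub ((ht.const_mul (l + 1 : ℂ)).mul hD)).const_mul (-Complex.I)).congr_deriv ?_
      rw [modeG_succ]; push_cast; simp; ring

theorem continuous_modePair (l : ℕ) (η : ℝ) :
    (Continuous fun y => modeG y l η) ∧ Continuous fun y => modeD y l η := by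
  induction l with
  | zero =>
    have := continuous_rootOf
    constructor
    · exact (continuous_sinOver _).comp continuous_rootOf
    · simp only [modeD_zero]; fun_prop
  | succ l ih =>
    obtain ⟨hG, hD⟩ := ih
    simp only [modeG_succ, modeD_succ]
    constructor <;> fun_prop

/-- The source of time-reversal invariance: π/2 - iη is unchanged under η ↦ -η followed by
conjugation, and the recursion respects this because tanh is odd and the factor -i is imaginary. -/
theorem conj_mode_neg (y : ℝ) (l : ℕ) (η : ℝ) :
    conj (modeG y l (-η)) = modeG y l η ∧ conj (modeD y l (-η)) = -modeD y l η := by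
  induction l with
  | zero =>
    simp only [modeG_zero, modeD_zero, conj_sinOver, map_mul, conj_cos_rootOf]
    simp [map_div₀, Complex.conj_ofReal, map_mul, map_ofNat, sub_eq_add_neg]
  | succ l ih =>
    obtain ⟨hG, hD⟩ := ih
    simp only [modeG_succ, modeD_succ, map_mul, map_sub, map_neg, map_add, map_one, map_natCast,
      Complex.conj_ofReal, Complex.conj_I, map_pow, hG, hD, Real.tanh_neg, Complex.ofReal_neg]
    constructor <;> ring

/-- The normalization of the elementary solutions for the Wronskian. -/
def modeNorm (y : ℝ) : ℕ → ℝ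
  | 0 => 2 / ‖sinOver (rootOf y) Real.pi‖
  | l + 1 => modeNorm y l / ((l + 1) ^ 2 - y)

theorem sinOver_pi {y : ℝ} (hy : y < 1) :
    0 < ‖sinOver (rootOf y) Real.pi‖ ∧
      sinOver (rootOf y) Real.pi = (‖sinOver (rootOf y) Real.pi‖ : ℂ) := by
  obtain ⟨s, hs, h⟩ := sinOver_ofReal_pos hy Real.pi_pos le_rfl
  rw [h, Complex.norm_real, Real.norm_of_nonneg hs.le]
  exact ⟨hs, rfl⟩

theorem modeNorm_denom_pos {y : ℝ} (hy : y < 1) (l : ℕ) : 0 < ((l : ℝ) + 1) ^ 2 - y := by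
  nlinarith [Nat.cast_nonneg (α := ℝ) l]

theorem modeNorm_pos {y : ℝ} (hy : y < 1) (l : ℕ) : 0 < modeNorm y l := by
  induction l with
  | zero => exact div_pos two_pos (sinOver_pi hy).1
  | succ l ih => exact div_pos ih (modeNorm_denom_pos hy l)

theorem continuousOn_modeNorm (l : ℕ) : ContinuousOn (fun y => modeNorm y l) (Set.Iio 1) := by
  induction l with
  | zero =>
    refine ContinuousOn.div continuousOn_const ?_ fun y hy => (sinOver_pi hy).1.ne'
    exact ((continuous_sinOver _).comp continuous_rootOf).norm.continuousOn
  | succ l ih =>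
    exact ih.div (by fun_prop) fun y hy => (modeNorm_denom_pos hy l).ne'

/-- For l = 0 this is the addition formula for the sine at π/2 + iη and π/2 - iη. One step of the
recursion is a linear map of (G, G') of determinant (l+1)² - y up to the phase -i, and `modeNorm`
divides by just this number. -/
theorem wronskian {y : ℝ} (hy : y < 1) (l : ℕ) (η : ℝ) :
    (modeNorm y l : ℂ) * (conj (modeG y l η) * modeD y l η - conj (modeD y l η) * modeG y l η)
      = -2 * Complex.I := by
  induction l with
  | zero =>
    have h := sinOver_add (rootOf y) (Real.pi / 2 + Complex.I * η) (Real.pi / 2 - Complex.I * η)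
    rw [show (Real.pi / 2 + Complex.I * η : ℂ) + (Real.pi / 2 - Complex.I * η) = Real.pi by ring,
      (sinOver_pi hy).2] at h
    have hp : (‖sinOver (rootOf y) Real.pi‖ : ℂ) ≠ 0 := by exact_mod_cast (sinOver_pi hy).1.ne'
    have hc : conj (Real.pi / 2 - Complex.I * η : ℂ) = Real.pi / 2 + Complex.I * η := by
      simp [map_div₀, Complex.conj_ofReal, map_ofNat]
    simp only [modeG_zero, modeD_zero, map_mul, map_neg, conj_sinOver, conj_cos_rootOf, hc,
      Complex.conj_I, modeNorm]
    push_cast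
    rw [div_mul_eq_mul_div, div_eq_iff hp, h]
    ring
  | succ l ih =>
    have hp : ((l : ℂ) + 1) ^ 2 - y ≠ 0 := by exact_mod_cast (modeNorm_denom_pos hy l).ne'
    rw [← ih]
    simp only [modeG_succ, modeD_succ, map_mul, map_sub, map_neg, map_add, map_one, map_natCast,
      Complex.conj_ofReal, Complex.conj_I, map_pow, modeNorm]
    push_cast
    rw [div_mul_eq_mul_div, div_eq_iff hp]
    linear_combination (-(modeNorm y l : ℂ) * ((l + 1) ^ 2 - y) * (conj (modeG y l η) * modeD y l η -
      conj (modeD y l η) * modeG y l η)) * Complex.I_sq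

theorem modeG_ne_zero {y : ℝ} (hy : y < 1) (l : ℕ) (η : ℝ) : modeG y l η ≠ 0 := by
  intro h
  have := wronskian hy l η
  simp [h] at this

/-- At η = 0 the hyperbolic tangent vanishes and a step of the recursion exchanges G and iG' up to a
positive factor and a sign -1. -/
theorem mode_at_zero {y : ℝ} (hy : y < 1) (l : ℕ) :
    (∃ s : ℝ, 0 < s ∧ modeG y l 0 = (-1) ^ l * s) ∧
    ∃ s : ℝ, 0 < s ∧ Complex.I * modeD y l 0 = (-1) ^ l * s := by
  induction l with
  | zero =>
    obtain ⟨s, hs, h⟩ := sinOver_ofReal_pos hy (r := Real.pi / 2) (by positivity)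
      (by linarith [Real.pi_pos])
    obtain ⟨c, hc, h'⟩ := cos_rootOf_pos hy
    refine ⟨⟨s, hs, ?_⟩, ⟨c, hc, ?_⟩⟩
    · rw [modeG_zero]; simpa using h
    · rw [modeD_zero, ← mul_assoc]; simpa using h'
  | succ l ih =>
    obtain ⟨⟨s, hs, h⟩, ⟨c, hc, h'⟩⟩ := ih
    refine ⟨⟨c, hc, ?_⟩, ⟨((l + 1) ^ 2 - y) * s, mul_pos (modeNorm_denom_pos hy l) hs, ?_⟩⟩
    · rw [modeG_succ, pow_succ, mul_neg_one, neg_mul ((-1 : ℂ) ^ l), ← h', Real.tanh_zero]; simp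
    · rw [modeD_succ, h, pow_succ]; push_cast; simp
      linear_combination (-(y - (l + 1) ^ 2) * (-1 : ℂ) ^ l * s) * Complex.I_sq

/-! ### Bounds uniform in the degree -/

/-- The normalized squared modulus of the elementary solution. -/
def modeSq (y : ℝ) (l : ℕ) (η : ℝ) : ℝ := modeNorm y l * ‖modeG y l η‖ ^ 2

theorem modeSq_pos {y : ℝ} (hy : y < 1) (l : ℕ) (η : ℝ) : 0 < modeSq y l η :=
  mul_pos (modeNorm_pos hy l) (by have := norm_pos_iff.2 (modeG_ne_zero hy l η); positivity)

theorem continuousOn_modeSq (l : ℕ) (η : ℝ) : ContinuousOn (fun y => modeSq y l η) (Set.Iio 1) :=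
  (continuousOn_modeNorm l).mul (((continuous_modePair l η).1.norm.pow 2).continuousOn)

theorem hasDerivAt_norm_sq {f : ℝ → ℂ} {f' : ℂ} {x : ℝ} (h : HasDerivAt f f' x) :
    HasDerivAt (fun x => ‖f x‖ ^ 2) (2 * (conj (f x) * f').re) x := by
  refine (h.norm_sq).congr_deriv ?_
  rw [Complex.inner, mul_comm f']

theorem norm_modeG_neg (y : ℝ) (l : ℕ) (η : ℝ) : ‖modeG y l (-η)‖ = ‖modeG y l η‖ := by
  rw [← (conj_mode_neg y l η).1, Complex.norm_conj]

/-- The energy of the elementary solution. -/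
def modeEnergy (y : ℝ) (l : ℕ) (η : ℝ) : ℝ :=
  ‖modeD y l η‖ ^ 2 + (l * (l + 1) * (1 - Real.tanh η ^ 2) - y) * ‖modeG y l η‖ ^ 2

theorem hasDerivAt_modeEnergy (y : ℝ) (l : ℕ) (η : ℝ) :
    HasDerivAt (modeEnergy y l)
      (-(2 * l * (l + 1) * Real.tanh η * (1 - Real.tanh η ^ 2) * ‖modeG y l η‖ ^ 2)) η := by
  obtain ⟨hG, hD⟩ := hasDerivAt_mode y l η
  have h1 := (((hasDerivAt_tanh η).pow 2).const_sub 1).const_mul ((l : ℝ) * (l + 1))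
  refine ((hasDerivAt_norm_sq hD).add ((h1.sub_const y).mul (hasDerivAt_norm_sq hG))).congr_deriv ?_
  have h2 : (conj (modeD y l η) * ((y - l * (l + 1) * (1 - (Real.tanh η : ℝ) ^ 2)) *
      modeG y l η)).re = (y - l * (l + 1) * (1 - Real.tanh η ^ 2)) *
      (conj (modeG y l η) * modeD y l η).re := by
    rw [show ((y : ℂ) - l * (l + 1) * (1 - (Real.tanh η : ℝ) ^ 2)) =
      ((y - l * (l + 1) * (1 - Real.tanh η ^ 2) : ℝ) : ℂ) by push_cast; ring]
    simp only [Complex.mul_re, Complex.mul_im, Complex.conj_re, Complex.conj_im, Complex.ofReal_re,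
      Complex.ofReal_im]
    ring
  rw [h2]
  simp
  ring

/-- The only explicit time dependence of the energy is the factor 1/cosh²η, which decreases for η ≥
0. -/
theorem modeEnergy_le {y η : ℝ} (l : ℕ) (hη : 0 ≤ η) : modeEnergy y l η ≤ modeEnergy y l 0 := by
  have hanti : AntitoneOn (modeEnergy y l) (Set.Ici 0) := by
    refine antitoneOn_of_deriv_nonpos (convex_Ici 0)
      (fun x _ => (hasDerivAt_modeEnergy y l x).continuousAt.continuousWithinAt)
      (fun x _ => (hasDerivAt_modeEnergy y l x).differentiableAt.differentiableWithinAt) ?_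
    intro x hx
    rw [interior_Ici, Set.mem_Ioi] at hx
    rw [(hasDerivAt_modeEnergy y l x).deriv, neg_nonpos]
    have h1 : 0 ≤ Real.tanh x := by
      rw [Real.tanh_eq_sinh_div_cosh]
      exact div_nonneg (Real.sinh_nonneg_iff.2 hx.le) (Real.cosh_pos x).le
    have h2 : 0 ≤ 1 - Real.tanh x ^ 2 := by rw [one_sub_tanh_sq]; positivity
    positivity
  exact hanti Set.self_mem_Ici hη hη

theorem modeSq_zero_succ (y : ℝ) (l : ℕ) :
    modeSq y (l + 1) 0 = modeNorm y l * ‖modeD y l 0‖ ^ 2 / ((l + 1) ^ 2 - y) := by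
  rw [modeSq, modeG_succ, Real.tanh_zero]
  simp [modeNorm]; ring

/-- Two steps of the recursion at η = 0 multiply the value by ((l+1)² - y)/((l+2)² - y), which is at
most 1. -/
theorem modeSq_zero_add_two {y : ℝ} (hy : y < 1) (l : ℕ) :
    modeSq y (l + 2) 0 ≤ modeSq y l 0 := by
  have h0 := modeNorm_denom_pos hy l
  have h1 := modeNorm_denom_pos hy (l + 1)
  have h2 : modeD y (l + 1) 0 = (-Complex.I * ((y - (l + 1) ^ 2 : ℝ) : ℂ)) * modeG y l 0 := by
    rw [modeD_succ, Real.tanh_zero]; push_cast; ring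
  rw [show l + 2 = (l + 1) + 1 from rfl, modeSq_zero_succ, h2, div_le_iff₀ h1, modeNorm, norm_mul,
    norm_mul, Complex.norm_real, Real.norm_eq_abs, mul_pow, mul_pow, sq_abs, modeSq]
  have : modeNorm y l / ((l + 1) ^ 2 - y) * (‖-Complex.I‖ ^ 2 * (y - (l + 1) ^ 2) ^ 2 *
      ‖modeG y l 0‖ ^ 2) = modeNorm y l * ‖modeG y l 0‖ ^ 2 * ((l + 1) ^ 2 - y) := by
    simp; field_simp; ring
  rw [this]
  refine mul_le_mul_of_nonneg_left ?_ (modeSq_pos hy l 0).le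
  push_cast
  nlinarith [Nat.cast_nonneg (α := ℝ) l]

theorem modeSq_zero_le {y : ℝ} (hy : y < 1) (l : ℕ) :
    modeSq y l 0 ≤ max (modeSq y 0 0) (modeSq y 1 0) ∧
      modeSq y (l + 1) 0 ≤ max (modeSq y 0 0) (modeSq y 1 0) := by
  induction l with
  | zero => exact ⟨le_max_left _ _, le_max_right _ _⟩
  | succ l ih => exact ⟨ih.2, (modeSq_zero_add_two hy l).trans ih.1⟩

/-- Let A be the maximum on the right. The normalized energy at 0 is at most 2(l(l+1) - y)A and does
not grow. Either alternative in `h` makes the potential coefficient at η at least (l(l+1) - y)/(2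
cosh²η), so the energy controls the squared modulus with a constant independent of l. -/
theorem modeSq_le_of_one_le {y : ℝ} (hy : y < 1) {l : ℕ} (hl : 1 ≤ l) {η : ℝ}
    (h : y ≤ 0 ∨ 2 * Real.cosh η ^ 2 ≤ l * (l + 1)) :
    modeSq y l η ≤ 4 * Real.cosh η ^ 2 * max (modeSq y 0 0) (modeSq y 1 0) := by
  wlog hη : 0 ≤ η generalizing η
  · have := this (η := -η) (by simpa using h) (by linarith)
    simpa [modeSq, norm_modeG_neg] using this
  set A := max (modeSq y 0 0) (modeSq y 1 0)
  set c := Real.cosh η ^ 2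
  have hc : 1 ≤ c := one_le_pow₀ (Real.one_le_cosh η)
  have hl' : (1 : ℝ) ≤ l := by exact_mod_cast hl
  have hA : 0 < A := lt_max_of_lt_left (modeSq_pos hy 0 0)
  have hN := modeNorm_pos hy l
  have hP := modeSq_pos hy l η
  have h0 : modeNorm y l * modeEnergy y l 0 ≤ 2 * (l * (l + 1) - y) * A := by
    have hb : modeNorm y l * ‖modeD y l 0‖ ^ 2 ≤ ((l : ℝ) ^ 2 - y) * A := by
      obtain ⟨k, rfl⟩ : ∃ k, l = k + 1 := ⟨l - 1, by omega⟩
      have hk := modeNorm_denom_pos hy k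
      have h2 : modeD y (k + 1) 0 = (-Complex.I * ((y - (k + 1) ^ 2 : ℝ) : ℂ)) * modeG y k 0 := by
        rw [modeD_succ, Real.tanh_zero]; push_cast; ring
      rw [h2, modeNorm, norm_mul, norm_mul, Complex.norm_real, Real.norm_eq_abs, mul_pow, mul_pow,
        sq_abs]
      have : modeNorm y k / ((k + 1) ^ 2 - y) * (‖-Complex.I‖ ^ 2 * (y - (k + 1) ^ 2) ^ 2 *
          ‖modeG y k 0‖ ^ 2) = ((k + 1) ^ 2 - y) * modeSq y k 0 := by
        simp [modeSq]; field_simp; ring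
      rw [this]
      push_cast
      exact mul_le_mul_of_nonneg_left (modeSq_zero_le hy k).1 hk.le
    have ha : ((l : ℝ) * (l + 1) - y) * modeSq y l 0 ≤ (l * (l + 1) - y) * A :=
      mul_le_mul_of_nonneg_left (modeSq_zero_le hy l).1 (by nlinarith)
    have he : modeNorm y l * modeEnergy y l 0 =
        modeNorm y l * ‖modeD y l 0‖ ^ 2 + (l * (l + 1) - y) * modeSq y l 0 := by
      simp [modeEnergy, modeSq]; ring
    rw [he]
    nlinarith
  have h1 : ((l : ℝ) * (l + 1) * (1 / c) - y) * modeSq y l η ≤ 2 * (l * (l + 1) - y) * A := by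
    refine le_trans ?_ h0
    refine le_trans ?_ (mul_le_mul_of_nonneg_left (modeEnergy_le l hη) hN.le)
    rw [modeEnergy, one_sub_tanh_sq, modeSq]
    have : 0 ≤ modeNorm y l * ‖modeD y l η‖ ^ 2 := by positivity
    linarith
  have h2 : (l * (l + 1) - y : ℝ) ≤ 2 * c * (l * (l + 1) * (1 / c) - y) := by
    have : c * (l * (l + 1) * (1 / c)) = (l * (l + 1) : ℝ) := by field_simp
    rw [mul_sub, mul_assoc 2 c, this]
    rcases h with h | h
    · nlinarith
    · rcases le_total y 0 with h' | h'
      · nlinarith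
      · nlinarith
  have h3 : (0 : ℝ) < l * (l + 1) - y := by nlinarith
  have h4 : (0 : ℝ) < l * (l + 1) * (1 / c) - y := by
    by_contra hcon
    have : 2 * c * (l * (l + 1) * (1 / c) - y) ≤ 0 :=
      mul_nonpos_of_nonneg_of_nonpos (by positivity) (not_lt.1 hcon)
    linarith
  refine le_of_mul_le_mul_left (h1.trans ?_) h4
  calc 2 * (l * (l + 1) - y) * A ≤ 2 * (2 * c * (l * (l + 1) * (1 / c) - y)) * A := by gcongr
    _ = _ := by ring

theorem eventually_modeSq_le {y₀ : ℝ} (hy : y₀ < 1) (η : ℝ) :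
    ∃ B : ℝ, ∀ᶠ y in 𝓝 y₀, ∀ l, modeSq y l η ≤ B := by
  -- Beyond this degree l(l+1) exceeds 2 cosh²η and the uniform bound applies, with A controlled
  -- near y₀ by the degrees 0 and 1. The finitely many degrees up to L are handled by continuity in
  -- y.
  obtain ⟨L, hL⟩ := exists_nat_ge (2 * Real.cosh η ^ 2)
  have hcont : ∀ l η, ContinuousAt (fun y => modeSq y l η) y₀ := fun l η =>
    (continuousOn_modeSq l η).continuousAt (Iio_mem_nhds hy)
  have hev : ∀ l η, ∀ᶠ y in 𝓝 y₀, modeSq y l η ≤ modeSq y₀ l η + 1 := fun l η =>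
    ((hcont l η).eventually_lt continuousAt_const (by simp)).mono fun y h => h.le
  set A := max (modeSq y₀ 0 0 + 1) (modeSq y₀ 1 0 + 1)
  refine ⟨∑ l ∈ Finset.range (L + 1), (modeSq y₀ l η + 1) + 4 * Real.cosh η ^ 2 * A, ?_⟩
  have hfin : ∀ᶠ y in 𝓝 y₀, ∀ l ∈ Finset.range (L + 1), modeSq y l η ≤ modeSq y₀ l η + 1 :=
    (Filter.eventually_all_finset _).2 fun l _ => hev l η
  have hA : 0 < A := lt_max_of_lt_left (by linarith [modeSq_pos hy 0 0])
  have hpos : ∀ l ∈ Finset.range (L + 1), 0 ≤ modeSq y₀ l η + 1 := fun l _ => by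
    linarith [modeSq_pos hy l η]
  filter_upwards [hfin, hev 0 0, hev 1 0, Iio_mem_nhds hy] with y h h0 h1 hy' l
  by_cases hl : l ∈ Finset.range (L + 1)
  · have := Finset.single_le_sum hpos hl
    have h4 : 0 ≤ 4 * Real.cosh η ^ 2 * A := by positivity
    linarith [h l hl]
  · have hl' : L + 1 ≤ l := by simpa using hl
    have hl2 : (L : ℝ) + 1 ≤ l := by exact_mod_cast hl'
    have := modeSq_le_of_one_le hy' (by omega : 1 ≤ l) (η := η) (Or.inr (by nlinarith))
    have h5 : max (modeSq y 0 0) (modeSq y 1 0) ≤ A := max_le_max h0 h1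
    have h6 := Finset.sum_nonneg hpos
    have : 4 * Real.cosh η ^ 2 * max (modeSq y 0 0) (modeSq y 1 0) ≤ 4 * Real.cosh η ^ 2 * A := by
      gcongr
    linarith

/-! ### The elementary solutions for large mass, with y = -κ² -/

theorem rootOf_neg_sq {κ : ℝ} (hκ : 0 ≤ κ) : rootOf (-κ ^ 2) = Complex.I * κ := by
  rw [rootOf_of_nonpos (by nlinarith), neg_neg, Real.sqrt_sq hκ]

theorem sinh_le_norm_sin (a b : ℝ) : Real.sinh b ^ 2 ≤ ‖Complex.sin (a + b * Complex.I)‖ ^ 2 := by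
  rw [Complex.sin_add_mul_I, ← Complex.ofReal_sin, ← Complex.ofReal_cos, ← Complex.ofReal_cosh,
    ← Complex.ofReal_sinh, ← Complex.normSq_eq_norm_sq,
    show ((Real.sin a : ℂ) * (Real.cosh b : ℂ) + (Real.cos a : ℂ) * (Real.sinh b : ℂ) * Complex.I)
      = ((Real.sin a * Real.cosh b : ℝ) : ℂ) + ((Real.cos a * Real.sinh b : ℝ) : ℂ) * Complex.I by
      push_cast; ring, Complex.normSq_add_mul_I]
  nlinarith [Real.cosh_sq b, Real.sin_sq_add_cos_sq a, sq_nonneg (Real.sin a)]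

theorem modeG_zero_of_pos {κ : ℝ} (hκ : 0 < κ) (η : ℝ) : modeG (-κ ^ 2) 0 η =
    Complex.sin ((κ * η : ℝ) + (κ * (Real.pi / 2) : ℝ) * Complex.I) / (Complex.I * κ) := by
  have h : (κ : ℂ) ≠ 0 := by exact_mod_cast hκ.ne'
  rw [modeG_zero, rootOf_neg_sq hκ.le, sinOver_eq_div (mul_ne_zero Complex.I_ne_zero h)]
  congr 2
  push_cast
  linear_combination (-(κ : ℂ) * η) * Complex.I_sq

/-- The modulus squared of the sine at κη + iκπ/2 is sin²(κη) + sinh²(κπ/2), which is smallest at η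
= 0. -/
theorem modeSq_zero_zero_le {κ : ℝ} (hκ : 0 < κ) (η : ℝ) :
    modeSq (-κ ^ 2) 0 0 ≤ modeSq (-κ ^ 2) 0 η := by
  refine mul_le_mul_of_nonneg_left ?_ (modeNorm_pos (by nlinarith) 0).le
  rw [modeG_zero_of_pos hκ, modeG_zero_of_pos hκ, norm_div, norm_div, div_pow, div_pow]
  gcongr ?_ / _
  refine le_trans (le_of_eq ?_) (sinh_le_norm_sin _ _)
  rw [mul_zero, Complex.ofReal_zero, zero_add, Complex.sin_mul_I, norm_mul, Complex.norm_I,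
    ← Complex.ofReal_sinh, Complex.norm_real, Real.norm_eq_abs, mul_one, sq_abs]

/-- The two sides involve cosh² and sinh² at κπ/2, and cosh² = 1 + sinh² ≤ 2 sinh² there because
κπ/2 ≥ 1. -/
theorem modeSq_one_zero_le {κ : ℝ} (hκ : 1 ≤ κ) :
    modeSq (-κ ^ 2) 1 0 ≤ 2 * modeSq (-κ ^ 2) 0 0 := by
  have hκ' : (0 : ℝ) < κ := by linarith
  have hN := modeNorm_pos (y := -κ ^ 2) (by nlinarith) 0
  rw [modeSq_zero_succ, modeSq, modeG_zero_of_pos hκ', modeD_zero, rootOf_neg_sq hκ'.le]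
  have h1 : Complex.I * (κ : ℂ) * (Real.pi / 2 - Complex.I * (0 : ℝ)) =
    (κ * (Real.pi / 2) : ℝ) * Complex.I := by push_cast; ring
  rw [h1, mul_zero, Complex.ofReal_zero, zero_add, Complex.sin_mul_I, Complex.cos_mul_I,
    ← Complex.ofReal_sinh, ← Complex.ofReal_cosh]
  simp only [norm_mul, norm_neg, norm_div, Complex.norm_I, Complex.norm_real, Real.norm_eq_abs,
    one_mul, mul_one, div_pow, sq_abs]
  rw [div_le_iff₀ (modeNorm_denom_pos (by nlinarith) 0), Real.cosh_sq]
  have h2 : 1 ≤ Real.sinh (κ * (Real.pi / 2)) ^ 2 := by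
    have h3 : κ * (Real.pi / 2) ≤ Real.sinh (κ * (Real.pi / 2)) :=
      Real.self_le_sinh_iff.2 (by positivity)
    have h4 : 1 ≤ κ * (Real.pi / 2) := by nlinarith [Real.pi_gt_three]
    exact one_le_pow₀ (h4.trans h3)
  have h4 : 2 * (modeNorm (-κ ^ 2) 0 * (Real.sinh (κ * (Real.pi / 2)) ^ 2 / κ ^ 2)) *
      ((((0 : ℕ) : ℝ) + 1) ^ 2 - -κ ^ 2) = modeNorm (-κ ^ 2) 0 *
        (2 * Real.sinh (κ * (Real.pi / 2)) ^ 2 + 2 * (Real.sinh (κ * (Real.pi / 2)) ^ 2 / κ ^ 2)) := by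
    field_simp; push_cast; ring
  rw [h4]
  refine mul_le_mul_of_nonneg_left ?_ hN.le
  have : 0 ≤ 2 * (Real.sinh (κ * (Real.pi / 2)) ^ 2 / κ ^ 2) := by positivity
  linarith

theorem modeSq_div_le {κ : ℝ} (hκ : 1 ≤ κ) (l : ℕ) (η : ℝ) :
    modeSq (-κ ^ 2) l η / modeSq (-κ ^ 2) 0 η ≤ 8 * Real.cosh η ^ 2 := by
  have hy : -κ ^ 2 < 1 := by nlinarith
  have h0 := modeSq_pos hy 0 η
  have hc : 1 ≤ Real.cosh η ^ 2 := one_le_pow₀ (Real.one_le_cosh η)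
  rw [div_le_iff₀ h0]
  rcases Nat.eq_zero_or_pos l with rfl | hl
  · nlinarith
  · refine (modeSq_le_of_one_le hy hl (Or.inl (by nlinarith))).trans ?_
    have h1 := modeSq_zero_zero_le (by linarith : 0 < κ) η
    have h2 := modeSq_one_zero_le hκ
    have : max (modeSq (-κ ^ 2) 0 0) (modeSq (-κ ^ 2) 1 0) ≤ 2 * modeSq (-κ ^ 2) 0 η :=
      max_le (by linarith) (by linarith)
    nlinarith

/-- The leading WKB behaviour, G'/G ∼ -iκ. For l = 0 the quotient is the cotangent of a number with
imaginary part κπ/2, and cot w + i = e^{iw}/sin w is small. -/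
theorem tendsto_modeD_div (l : ℕ) (η : ℝ) : Tendsto
    (fun κ : ℝ => modeD (-κ ^ 2) l η / (κ * modeG (-κ ^ 2) l η)) atTop (𝓝 (-Complex.I)) := by
  have hinv : Tendsto (fun κ : ℝ => ((κ : ℂ))⁻¹) atTop (𝓝 0) := by
    have := (Complex.continuous_ofReal.tendsto 0).comp tendsto_inv_atTop_zero
    simpa [Function.comp_def] using this
  induction l with
  | zero =>
    rw [tendsto_iff_norm_sub_tendsto_zero]
    refine squeeze_zero' (Eventually.of_forall fun _ => norm_nonneg _)
      (g := fun κ : ℝ => (κ * (Real.pi / 2))⁻¹) ?_ ?_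
    · filter_upwards [eventually_gt_atTop 0] with κ hκ
      have hκ' : (κ : ℂ) ≠ 0 := by exact_mod_cast hκ.ne'
      have hG := modeG_ne_zero (y := -κ ^ 2) (by nlinarith) 0 η
      rw [modeG_zero_of_pos hκ] at hG ⊢
      rw [modeD_zero, rootOf_neg_sq hκ.le]
      set w : ℂ := (κ * η : ℝ) + (κ * (Real.pi / 2) : ℝ) * Complex.I with hw
      have hs : Complex.sin w ≠ 0 := fun h => hG (by rw [h, zero_div])
      have h1 : Complex.I * (κ : ℂ) * (Real.pi / 2 - Complex.I * η) = w := by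
        rw [hw]; push_cast; linear_combination (-(κ : ℂ) * η) * Complex.I_sq
      have h2 : -Complex.I * Complex.cos w / (κ * (Complex.sin w / (Complex.I * κ))) -
          -Complex.I = Complex.exp (w * Complex.I) / Complex.sin w := by
        rw [Complex.exp_mul_I]
        field_simp
        linear_combination (-Complex.cos w) * Complex.I_sq
      have h3 : (w * Complex.I).re = -(κ * (Real.pi / 2)) := by
        simp [hw]
      have hp : 0 < κ * (Real.pi / 2) := by positivity
      have h4 : κ * (Real.pi / 2) ≤ ‖Complex.sin w‖ := by
        refine le_trans (Real.self_le_sinh_iff.2 hp.le) ?_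
        exact le_of_sq_le_sq (sinh_le_norm_sin _ _) (norm_nonneg _)
      rw [h1, h2, norm_div, Complex.norm_exp, h3, inv_eq_one_div]
      exact div_le_div₀ zero_le_one (Real.exp_le_one_iff.2 (by linarith)) hp h4
    · exact tendsto_inv_atTop_zero.comp
        (tendsto_id.atTop_mul_const (by positivity : 0 < Real.pi / 2))
  | succ l ih =>
    set k : ℂ := l + 1
    set τ : ℂ := ((Real.tanh η : ℝ) : ℂ)
    -- The recursion for G' and G, with numerator and denominator divided by suitable powers of κ
    -- and by G, so that only the previous quotient and 1/κ occur.
    have h1 : Tendsto (fun κ : ℝ =>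
        ((-1 - k ^ 2 * (1 - τ ^ 2) * ((κ : ℂ))⁻¹ ^ 2) -
          k * τ * (modeD (-κ ^ 2) l η / (κ * modeG (-κ ^ 2) l η)) * (κ : ℂ)⁻¹) /
        (modeD (-κ ^ 2) l η / (κ * modeG (-κ ^ 2) l η) - k * τ * (κ : ℂ)⁻¹)) atTop
        (𝓝 (((-1 - k ^ 2 * (1 - τ ^ 2) * 0 ^ 2) - k * τ * (-Complex.I) * 0) /
          (-Complex.I - k * τ * 0))) := by
      refine Tendsto.div ?_ (ih.sub (hinv.const_mul _)) (by simp)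
      exact (tendsto_const_nhds.sub ((hinv.pow 2).const_mul _)).sub ((ih.const_mul _).mul hinv)
    have h2 : (((-1 - k ^ 2 * (1 - τ ^ 2) * 0 ^ 2) - k * τ * (-Complex.I) * 0) /
          (-Complex.I - k * τ * 0)) = -Complex.I := by simp
    rw [h2] at h1
    refine h1.congr' ?_
    filter_upwards [eventually_gt_atTop 0] with κ hκ
    have hκ' : (κ : ℂ) ≠ 0 := by exact_mod_cast hκ.ne'
    have hG := modeG_ne_zero (y := -κ ^ 2) (by nlinarith) l η
    have hG' := modeG_ne_zero (y := -κ ^ 2) (by nlinarith) (l + 1) η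
    rw [modeG_succ] at hG'
    have hG2 : modeD (-κ ^ 2) l η - k * τ * modeG (-κ ^ 2) l η ≠ 0 := right_ne_zero_of_mul hG'
    rw [modeG_succ, modeD_succ]
    change _ = -Complex.I * (((-κ ^ 2 : ℝ) - k ^ 2 * (1 - τ ^ 2)) * modeG (-κ ^ 2) l η
      - k * τ * modeD (-κ ^ 2) l η) / (κ * (-Complex.I * (modeD (-κ ^ 2) l η -
        k * τ * modeG (-κ ^ 2) l η)))
    have h3 : modeD (-κ ^ 2) l η / (κ * modeG (-κ ^ 2) l η) - k * τ * (κ : ℂ)⁻¹ =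
      (modeD (-κ ^ 2) l η - k * τ * modeG (-κ ^ 2) l η) / (κ * modeG (-κ ^ 2) l η) := by
      field_simp
    rw [h3, div_div_eq_mul_div, div_eq_div_iff hG2
      (mul_ne_zero hκ' (mul_ne_zero (neg_ne_zero.2 Complex.I_ne_zero) hG2))]
    field_simp
    push_cast
    ring

/-- One step of the recursion multiplies the squared modulus by |G'/(κG) - (l+1) tanh η/κ|²
κ²/((l+1)² + κ²), and both factors tend to 1. -/
theorem tendsto_modeSq_div (l : ℕ) (η : ℝ) : Tendsto
    (fun κ : ℝ => modeSq (-κ ^ 2) l η / modeSq (-κ ^ 2) 0 η) atTop (𝓝 1) := by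
  induction l with
  | zero =>
    refine tendsto_const_nhds.congr' ?_
    filter_upwards [eventually_gt_atTop 0] with κ hκ
    rw [div_self (modeSq_pos (by nlinarith) 0 η).ne']
  | succ l ih =>
    set k : ℝ := l + 1
    set τ : ℝ := Real.tanh η
    have hinv : Tendsto (fun κ : ℝ => ((κ : ℂ))⁻¹) atTop (𝓝 0) := by
      have := (Complex.continuous_ofReal.tendsto 0).comp tendsto_inv_atTop_zero
      simpa [Function.comp_def] using this
    have h1 : Tendsto (fun κ : ℝ => ‖modeD (-κ ^ 2) l η / (κ * modeG (-κ ^ 2) l η) -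
        k * τ * (κ : ℂ)⁻¹‖ ^ 2 * (1 / (k ^ 2 * κ⁻¹ ^ 2 + 1)) *
        (modeSq (-κ ^ 2) l η / modeSq (-κ ^ 2) 0 η)) atTop
        (𝓝 (‖-Complex.I - k * τ * 0‖ ^ 2 * (1 / (k ^ 2 * 0 ^ 2 + 1)) * 1)) := by
      refine Tendsto.mul (Tendsto.mul ?_ ?_) ih
      · exact ((tendsto_modeD_div l η).sub (hinv.const_mul _)).norm.pow 2
      · exact tendsto_const_nhds.div (((tendsto_inv_atTop_zero.pow 2).const_mul _).add_const 1)
          (by simp)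
    rw [show ‖-Complex.I - k * τ * 0‖ ^ 2 * (1 / (k ^ 2 * 0 ^ 2 + 1)) * 1 = (1 : ℝ) by simp] at h1
    refine h1.congr' ?_
    filter_upwards [eventually_gt_atTop 0] with κ hκ
    have hκ' : (κ : ℂ) ≠ 0 := by exact_mod_cast hκ.ne'
    have hy : -κ ^ 2 < 1 := by nlinarith
    have hG := modeG_ne_zero hy l η
    have hGn : ‖modeG (-κ ^ 2) l η‖ ≠ 0 := norm_ne_zero_iff.2 hG
    have h3 : modeD (-κ ^ 2) l η / (κ * modeG (-κ ^ 2) l η) - k * τ * (κ : ℂ)⁻¹ =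
      (modeD (-κ ^ 2) l η - k * τ * modeG (-κ ^ 2) l η) / (κ * modeG (-κ ^ 2) l η) := by
      field_simp
    have h4 : ‖modeG (-κ ^ 2) (l + 1) η‖ = ‖modeD (-κ ^ 2) l η - k * τ * modeG (-κ ^ 2) l η‖ := by
      rw [modeG_succ, norm_mul]; simp [k, τ]
    have hd := modeNorm_denom_pos hy l
    have h5 : modeSq (-κ ^ 2) (l + 1) η = modeNorm (-κ ^ 2) l / (k ^ 2 + κ ^ 2) *
        ‖modeD (-κ ^ 2) l η - k * τ * modeG (-κ ^ 2) l η‖ ^ 2 := by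
      rw [modeSq, h4, modeNorm, sub_neg_eq_add]
    rw [h3, h5, norm_div, norm_mul, Complex.norm_real, Real.norm_of_nonneg hκ.le]
    have h0 := (modeSq_pos hy 0 η).ne'
    have hN := (modeNorm_pos hy l).ne'
    have : k ^ 2 + κ ^ 2 ≠ 0 := by positivity
    conv_lhs => rw [show modeSq (-κ ^ 2) l η = modeNorm (-κ ^ 2) l * ‖modeG (-κ ^ 2) l η‖ ^ 2 from rfl]
    field_simp

/-! ### The hypergeometric series and its contiguous relations -/

theorem hasSum_congr_terms {ι M : Type*} [AddCommMonoid M] [TopologicalSpace M] {f g : ι → M}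
    {x : M} (h : ∀ i, f i = g i) : HasSum f x ↔ HasSum g x := by rw [funext h]

section Hypergeometric

variable {a b c : ℂ}

theorem one_le_radius_hypergeometric (hc : ∀ k : ℕ, c ≠ -k) :
    1 ≤ (ordinaryHypergeometricSeries ℂ a b c).radius := by
  have h : ordinaryHypergeometricSeries ℂ a b c =
      Complex.Gamma c • Complex.regularizedGaussHGFunSeries a b c := by
    ext n
    have hG : Complex.Gamma c ≠ 0 := Complex.Gamma_ne_zero hc
    have := Complex.Gamma_inv_mul_ordinaryHypergeometricSeries_eq (a := a) (b := b) hc (n := n)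
    simp only [FormalMultilinearSeries.coeff] at this
    change ordinaryHypergeometricSeries ℂ a b c n 1 =
      Complex.Gamma c * Complex.regularizedGaussHGFunSeries a b c n 1
    rw [← this, mul_inv_cancel_left₀ hG]
  rw [h]
  exact (Complex.radius_regularizedGaussHGFunSeries_ge_one a b c).trans
    FormalMultilinearSeries.radius_le_smul

theorem hasFPowerSeriesOnBall_hypergeometric (hc : ∀ k : ℕ, c ≠ -k) :
    HasFPowerSeriesOnBall (ordinaryHypergeometric a b c)
      (ordinaryHypergeometricSeries ℂ a b c) 0 1 := by
  have h := one_le_radius_hypergeometric (a := a) (b := b) hc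
  exact ((ordinaryHypergeometricSeries ℂ a b c).hasFPowerSeriesOnBall
    (one_pos.trans_le h)).mono one_pos h

theorem mem_unit_eball {w : ℂ} (hw : ‖w‖ < 1) : w ∈ Metric.eball (0 : ℂ) 1 := by
  rw [Metric.mem_eball, edist_zero_right, ← ofReal_norm]
  simpa only [ENNReal.ofReal_lt_one] using hw

theorem hasSum_hypergeometric (hc : ∀ k : ℕ, c ≠ -k) {w : ℂ} (hw : ‖w‖ < 1) :
    HasSum (fun n => ordinaryHypergeometricCoefficient a b c n * w ^ n)
      (ordinaryHypergeometric a b c w) := by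
  have h := (hasFPowerSeriesOnBall_hypergeometric (a := a) (b := b) hc).hasSum (mem_unit_eball hw)
  rw [zero_add] at h
  refine (hasSum_congr_terms fun n => ?_).1 h
  rw [ordinaryHypergeometricSeries_apply_eq, smul_eq_mul]

theorem hasDerivAt_hypergeometric (hc : ∀ k : ℕ, c ≠ -k) {w : ℂ} (hw : ‖w‖ < 1) :
    HasDerivAt (ordinaryHypergeometric a b c) (deriv (ordinaryHypergeometric a b c) w) w := by
  have h := (hasFPowerSeriesOnBall_hypergeometric (a := a) (b := b) hc).analyticAt_of_mem
    (mem_unit_eball hw)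
  exact h.differentiableAt.hasDerivAt

theorem hasSum_deriv_hypergeometric (hc : ∀ k : ℕ, c ≠ -k) {w : ℂ} (hw : ‖w‖ < 1) :
    HasSum (fun n : ℕ => (n + 1) * ordinaryHypergeometricCoefficient a b c (n + 1) * w ^ n)
      (deriv (ordinaryHypergeometric a b c) w) := by
  have h := (hasFPowerSeriesOnBall_hypergeometric (a := a) (b := b) hc).fderiv.hasSum
    (mem_unit_eball hw)
  rw [zero_add] at h
  have h1 := (ContinuousLinearMap.apply ℂ ℂ (1 : ℂ)).hasSum h
  refine (hasSum_congr_terms fun n => ?_).1 h1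
  rw [ContinuousLinearMap.apply_apply, FormalMultilinearSeries.apply_eq_pow_smul_coeff,
    smul_apply,
    FormalMultilinearSeries.derivSeries_coeff_one, ordinaryHypergeometricSeries,
    FormalMultilinearSeries.coeff_ofScalars]
  simp
  ring

theorem hasSum_mul_deriv_hypergeometric (hc : ∀ k : ℕ, c ≠ -k) {w : ℂ} (hw : ‖w‖ < 1) :
    HasSum (fun n : ℕ => n * ordinaryHypergeometricCoefficient a b c n * w ^ n)
      (w * deriv (ordinaryHypergeometric a b c) w) := by
  rw [← hasSum_nat_add_iff' 1]
  simp only [Finset.sum_range_one, Nat.cast_zero, zero_mul, sub_zero]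
  refine (hasSum_congr_terms fun n => ?_).1
    ((hasSum_deriv_hypergeometric (a := a) (b := b) hc hw).mul_left w)
  push_cast
  ring

theorem hypergeometricCoefficient_succ (hc : ∀ k : ℕ, c ≠ -k) (n : ℕ) :
    (n + 1) * ordinaryHypergeometricCoefficient a b c (n + 1) * (c + n) =
      ordinaryHypergeometricCoefficient a b c n * ((a + n) * (b + n)) := by
  have h1 : c + n ≠ 0 := fun h => hc n (eq_neg_of_add_eq_zero_left h)
  have h2 : ((n : ℂ) + 1) ≠ 0 := by exact_mod_cast Nat.succ_ne_zero n
  have h3 : ((n.factorial : ℕ) : ℂ) ≠ 0 := by exact_mod_cast Nat.factorial_ne_zero n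
  simp only [ordinaryHypergeometricCoefficient, ascPochhammer_succ_eval, Nat.factorial_succ,
    Nat.cast_mul, Nat.cast_succ, mul_inv]
  field_simp

theorem hypergeometricCoefficient_shift (hc : ∀ k : ℕ, c ≠ -k) (n : ℕ) :
    (c + n) * ordinaryHypergeometricCoefficient a b (c + 1) n =
      c * ordinaryHypergeometricCoefficient a b c n := by
  have h0 : c ≠ 0 := by simpa using hc 0
  have h1 : c + n ≠ 0 := fun h => hc n (eq_neg_of_add_eq_zero_left h)
  have h : (ascPochhammer ℂ n).eval c * (c + n) = c * (ascPochhammer ℂ n).eval (c + 1) := by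
    rw [← ascPochhammer_succ_eval, ascPochhammer_succ_left]
    simp
  have h2 : (ascPochhammer ℂ n).eval (c + 1) = (ascPochhammer ℂ n).eval c * (c + n) / c := by
    rw [h]; field_simp
  simp only [ordinaryHypergeometricCoefficient, h2, inv_div]
  by_cases h3 : (ascPochhammer ℂ n).eval c = 0
  · simp [h3]
  · field_simp

/-- Compare coefficients: the derivative shifts the index, and `hypergeometricCoefficient_succ`
together with `hypergeometricCoefficient_shift` reduces everything to one coefficient. This relation
becomes the raising operator for the order of the Ferrers functions. -/
theorem hypergeometric_contiguous_up (hc : ∀ k : ℕ, c ≠ -k) {w : ℂ} (hw : ‖w‖ < 1) :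
    c * ((1 - w) * deriv (ordinaryHypergeometric a b c) w +
      (c - a - b) * ordinaryHypergeometric a b c w) =
      (c - a) * (c - b) * ordinaryHypergeometric a b (c + 1) w := by
  have hc' : ∀ k : ℕ, c + 1 ≠ -k := fun k h => hc (k + 1) (by push_cast; linear_combination h)
  have h1 := (((hasSum_deriv_hypergeometric (a := a) (b := b) hc hw).sub
    (hasSum_mul_deriv_hypergeometric (a := a) (b := b) hc hw)).add
    ((hasSum_hypergeometric (a := a) (b := b) hc hw).mul_left (c - a - b))).mul_left c
  have h2 := (hasSum_hypergeometric (a := a) (b := b) hc' hw).mul_left ((c - a) * (c - b))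
  refine Eq.trans (by ring) (h1.unique ((hasSum_congr_terms fun n => ?_).1 h2))
  have h3 : c + n ≠ 0 := fun h => hc n (eq_neg_of_add_eq_zero_left h)
  have e1 := hypergeometricCoefficient_succ (a := a) (b := b) hc n
  have e2 := hypergeometricCoefficient_shift (a := a) (b := b) hc n
  apply mul_left_cancel₀ h3
  linear_combination ((c - a) * (c - b) * w ^ n) * e2 - c * w ^ n * e1

theorem hypergeometric_contiguous_down (hc : ∀ k : ℕ, c ≠ -k) {w : ℂ} (hw : ‖w‖ < 1) :
    w * deriv (ordinaryHypergeometric a b (c + 1)) w + c * ordinaryHypergeometric a b (c + 1) w =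
      c * ordinaryHypergeometric a b c w := by
  have hc' : ∀ k : ℕ, c + 1 ≠ -k := fun k h => hc (k + 1) (by push_cast; linear_combination h)
  have h1 := (hasSum_mul_deriv_hypergeometric (a := a) (b := b) hc' hw).add
    ((hasSum_hypergeometric (a := a) (b := b) hc' hw).mul_left c)
  have h2 := (hasSum_hypergeometric (a := a) (b := b) hc hw).mul_left c
  refine h1.unique ((hasSum_congr_terms fun n => ?_).1 h2)
  linear_combination (-w ^ n) * hypergeometricCoefficient_shift (a := a) (b := b) hc n

end Hypergeometric

theorem half_ne_neg_nat (l : ℕ) (k : ℕ) : (l + 1 / 2 : ℂ) ≠ -k := by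
  intro h
  have h2 : ((l + 1 / 2 : ℝ) : ℂ) = ((-k : ℝ) : ℂ) := by push_cast; exact h
  have h3 : (l + 1 / 2 : ℝ) = -k := by exact_mod_cast h2
  have : (0 : ℝ) ≤ l := Nat.cast_nonneg l
  have : (0 : ℝ) ≤ k := Nat.cast_nonneg k
  linarith

/-- Let P and Q be the series with third parameter 1/2 and 3/2 at sin²x. The contiguous relations
say that p = cos x · P and q = sin x · Q satisfy p' = -(2κ)² q and q' = p, the system of cos 2κx and
sin(2κx)/(2κ). Both sides are multiplied by 2κ to avoid a division. -/
theorem two_mul_sin_mul_hypergeometric (κ : ℂ) {φ : ℝ} (h0 : 0 ≤ φ) (h1 : φ < Real.pi / 2) :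
    2 * κ * (Real.sin φ * ordinaryHypergeometric (1 / 2 - κ) (1 / 2 + κ) (3 / 2 : ℂ)
      ((Real.sin φ : ℂ) ^ 2)) = Complex.sin (2 * κ * φ) := by
  have hc : ∀ k : ℕ, (1 / 2 : ℂ) ≠ -k := fun k => by simpa using half_ne_neg_nat 0 k
  have hc' : ∀ k : ℕ, (1 / 2 + 1 : ℂ) ≠ -k := fun k => by
    have := half_ne_neg_nat 1 k; rwa [Nat.cast_one, add_comm] at this
  set P := ordinaryHypergeometric (𝔸 := ℂ) (1 / 2 - κ) (1 / 2 + κ) (1 / 2 : ℂ) with hP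
  set Q := ordinaryHypergeometric (𝔸 := ℂ) (1 / 2 - κ) (1 / 2 + κ) (1 / 2 + 1 : ℂ) with hQ
  rw [show (3 / 2 : ℂ) = 1 / 2 + 1 by norm_num]
  change 2 * κ * (Real.sin φ * Q ((Real.sin φ : ℂ) ^ 2)) = _
  have key : ∀ x ∈ Set.Icc 0 φ,
      HasDerivAt (fun x : ℝ => (Real.cos x : ℂ) * P ((Real.sin x : ℂ) ^ 2))
        (-(2 * κ) ^ 2 * (Real.sin x * Q ((Real.sin x : ℂ) ^ 2))) x ∧
      HasDerivAt (fun x : ℝ => (Real.sin x : ℂ) * Q ((Real.sin x : ℂ) ^ 2))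
        (Real.cos x * P ((Real.sin x : ℂ) ^ 2)) x := by
    intro x hx
    have hcos : 0 < Real.cos x := Real.cos_pos_of_mem_Ioo
      ⟨by linarith [hx.1, Real.pi_pos], by linarith [hx.2]⟩
    have hw : ‖(Real.sin x : ℂ) ^ 2‖ < 1 := by
      rw [norm_pow, Complex.norm_real, Real.norm_eq_abs, sq_abs]
      nlinarith [Real.sin_sq_add_cos_sq x]
    have hs := (Real.hasDerivAt_sin x).ofReal_comp
    have hco := (Real.hasDerivAt_cos x).ofReal_comp
    have dP := (hasDerivAt_hypergeometric (a := 1 / 2 - κ) (b := 1 / 2 + κ) hc hw).comp x (hs.pow 2)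
    have dQ := (hasDerivAt_hypergeometric (a := 1 / 2 - κ) (b := 1 / 2 + κ) hc' hw).comp x
      (hs.pow 2)
    have up := hypergeometric_contiguous_up (a := 1 / 2 - κ) (b := 1 / 2 + κ) hc hw
    have down := hypergeometric_contiguous_down (a := 1 / 2 - κ) (b := 1 / 2 + κ) hc hw
    have hsc : (Real.sin x : ℂ) ^ 2 + (Real.cos x : ℂ) ^ 2 = 1 := by
      exact_mod_cast Real.sin_sq_add_cos_sq x
    rw [← hP, ← hQ] at up
    rw [← hP, ← hQ] at down
    constructor
    · refine (hco.mul dP).congr_deriv ?_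
      rw [← hP]
      simp only [Function.comp_apply, Nat.cast_ofNat, Complex.ofReal_neg]
      rw [show (1 : ℂ) - (Real.sin x : ℂ) ^ 2 = (Real.cos x : ℂ) ^ 2 by linear_combination -hsc] at up
      linear_combination (4 * (Real.sin x : ℂ)) * up
    · refine (hs.mul dQ).congr_deriv ?_
      rw [← hQ]
      simp only [Function.comp_apply, Nat.cast_ofNat]
      linear_combination (2 * (Real.cos x : ℂ)) * down
  have hlin : ∀ x : ℝ, HasDerivAt (fun x : ℝ => 2 * κ * (x : ℂ)) (2 * κ) x := fun x => by
    simpa using (hasDerivAt_id x).ofReal_comp.const_mul (2 * κ)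
  have hsin : ∀ x : ℝ, HasDerivAt (fun x : ℝ => Complex.sin (2 * κ * x))
      (Complex.cos (2 * κ * x) * (2 * κ)) x := fun x => (Complex.hasDerivAt_sin _).comp x (hlin x)
  have hcos : ∀ x : ℝ, HasDerivAt (fun x : ℝ => Complex.cos (2 * κ * x))
      (-Complex.sin (2 * κ * x) * (2 * κ)) x := fun x => (Complex.hasDerivAt_cos _).comp x (hlin x)
  -- The pair (p, 2κq) rotated back by the angle 2κx is constant; its value at 0 is (1, 0).
  have dA : ∀ x ∈ Set.Icc 0 φ, HasDerivAt (fun x : ℝ =>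
      (Real.cos x : ℂ) * P ((Real.sin x : ℂ) ^ 2) * Complex.cos (2 * κ * x) +
      2 * κ * ((Real.sin x : ℂ) * Q ((Real.sin x : ℂ) ^ 2)) * Complex.sin (2 * κ * x)) 0 x := by
    intro x hx
    obtain ⟨hp, hq⟩ := key x hx
    refine ((hp.mul (hcos x)).add ((hq.const_mul (2 * κ)).mul (hsin x))).congr_deriv ?_
    ring
  have dB : ∀ x ∈ Set.Icc 0 φ, HasDerivAt (fun x : ℝ =>
      (Real.cos x : ℂ) * P ((Real.sin x : ℂ) ^ 2) * Complex.sin (2 * κ * x) -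
      2 * κ * ((Real.sin x : ℂ) * Q ((Real.sin x : ℂ) ^ 2)) * Complex.cos (2 * κ * x)) 0 x := by
    intro x hx
    obtain ⟨hp, hq⟩ := key x hx
    refine ((hp.mul (hsin x)).sub ((hq.const_mul (2 * κ)).mul (hcos x))).congr_deriv ?_
    ring
  have hA := constant_of_has_deriv_right_zero (fun x hx => (dA x hx).continuousAt.continuousWithinAt)
    (fun x hx => (dA x ⟨hx.1, hx.2.le⟩).hasDerivWithinAt) φ ⟨h0, le_rfl⟩
  have hB := constant_of_has_deriv_right_zero (fun x hx => (dB x hx).continuousAt.continuousWithinAt)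
    (fun x hx => (dB x ⟨hx.1, hx.2.le⟩).hasDerivWithinAt) φ ⟨h0, le_rfl⟩
  simp only [Real.cos_zero, Real.sin_zero, Complex.ofReal_zero, Complex.ofReal_one, mul_zero,
    zero_mul, Complex.cos_zero, Complex.sin_zero, add_zero, sub_zero, mul_one, ne_eq,
    OfNat.ofNat_ne_zero, not_false_eq_true, zero_pow, hP, ordinaryHypergeometric_zero] at hA hB
  rw [← hP] at hA hB
  linear_combination Complex.sin (2 * κ * φ) * hA - Complex.cos (2 * κ * φ) * hB -
    2 * κ * (Real.sin φ * Q ((Real.sin φ : ℂ) ^ 2)) * Complex.sin_sq_add_cos_sq (2 * κ * φ)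

/-! ### The cut plane -/

theorem isOpen_cutPlane : IsOpen cutPlane :=
  (isOpen_ne_fun Complex.continuous_im continuous_const).union
    (isOpen_lt Complex.continuous_re.abs continuous_const)

theorem starConvex_cutPlane : StarConvex ℝ 0 cutPlane := by
  rw [starConvex_zero_iff]
  intro z hz r hr0 hr1
  rcases hz with hz | hz
  · rcases hr0.eq_or_lt with rfl | hr
    · right; simp
    · left; simpa using ⟨hr.ne', hz⟩
  · right
    rw [Complex.smul_re, smul_eq_mul, abs_mul, abs_of_nonneg hr0]
    nlinarith [abs_nonneg z.re]

theorem zero_mem_cutPlane : (0 : ℂ) ∈ cutPlane := Or.inr (by simp)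

theorem isPreconnected_cutPlane : IsPreconnected cutPlane :=
  (starConvex_cutPlane.isPathConnected zero_mem_cutPlane).isConnected.isPreconnected

/-- The part of the cut plane in the disc of convergence. -/
def cutDisc : Set ℂ := cutPlane ∩ Metric.ball 1 2

theorem zero_mem_cutDisc : (0 : ℂ) ∈ cutDisc := ⟨zero_mem_cutPlane, by simp⟩

theorem isOpen_cutDisc : IsOpen cutDisc := isOpen_cutPlane.inter Metric.isOpen_ball

theorem isPreconnected_cutDisc : IsPreconnected cutDisc :=
  ((starConvex_cutPlane.inter ((convex_ball _ _).starConvex (by simp))).isPathConnected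
    zero_mem_cutDisc).isConnected.isPreconnected

theorem I_mul_mem_cutPlane (x : ℝ) : Complex.I * (x : ℂ) ∈ cutPlane := Or.inr (by simp)

theorem one_sub_mem_slitPlane {z : ℂ} (hz : z ∈ cutPlane) : 1 - z ∈ Complex.slitPlane := by
  rcases hz with hz | hz
  · right; simpa using hz
  · left; have := abs_lt.1 hz; simp; linarith

theorem one_add_mem_slitPlane {z : ℂ} (hz : z ∈ cutPlane) : 1 + z ∈ Complex.slitPlane := by
  rcases hz with hz | hz
  · right; simpa using hz
  · left; have := abs_lt.1 hz; simp; linarith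

theorem one_sub_sq_mem_slitPlane {z : ℂ} (hz : z ∈ cutPlane) : 1 - z ^ 2 ∈ Complex.slitPlane := by
  rw [Complex.mem_slitPlane_iff]
  by_contra! h
  simp only [Complex.sub_re, Complex.one_re, Complex.sub_im, Complex.one_im, pow_two,
    Complex.mul_re, Complex.mul_im] at h
  obtain ⟨h1, h2⟩ := h
  have h3 : z.re * z.im = 0 := by linarith
  rcases mul_eq_zero.1 h3 with h4 | h4
  · rw [h4] at h1; nlinarith [sq_nonneg z.im]
  · rcases hz with hz | hz
    · exact hz h4
    · rw [h4] at h1; have := abs_lt.1 hz; nlinarith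

theorem ratio_mem_slitPlane {z : ℂ} (hz : z ∈ cutPlane) :
    (1 - z) / (1 + z) ∈ Complex.slitPlane := by
  have hne := Complex.slitPlane_ne_zero (one_add_mem_slitPlane hz)
  have hn : 0 < Complex.normSq (1 + z) := Complex.normSq_pos.2 hne
  have h : (1 - z) / (1 + z) = ((1 - z) * conj (1 + z)) * ((Complex.normSq (1 + z))⁻¹ : ℝ) := by
    rw [div_eq_mul_inv, Complex.inv_def]; ring
  rw [Complex.mem_slitPlane_iff, h, Complex.re_mul_ofReal, Complex.im_mul_ofReal]
  rcases hz with hz | hz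
  · right
    refine mul_ne_zero ?_ (inv_pos.2 hn).ne'
    simp
    ring_nf
    simpa using hz
  · by_cases him : z.im = 0
    · left
      refine mul_pos ?_ (inv_pos.2 hn)
      have := abs_lt.1 hz
      simp [him]; nlinarith
    · right
      refine mul_ne_zero ?_ (inv_pos.2 hn).ne'
      simp
      ring_nf
      simpa using him

/-- The branch of `√(1 - z²)` on the cut plane. -/
def cutRoot (z : ℂ) : ℂ := (1 - z ^ 2) ^ (1 / 2 : ℂ)

theorem cutRoot_sq (z : ℂ) : cutRoot z ^ 2 = 1 - z ^ 2 := by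
  rw [cutRoot, ← Complex.cpow_nat_mul]
  norm_num

theorem cutRoot_ne_zero {z : ℂ} (hz : z ∈ cutPlane) : cutRoot z ≠ 0 := by
  intro h
  have := cutRoot_sq z
  rw [h] at this
  exact Complex.slitPlane_ne_zero (one_sub_sq_mem_slitPlane hz) (by rw [← this]; simp)

theorem re_cpow_half_pos {w : ℂ} (hw : w ∈ Complex.slitPlane) : 0 < (w ^ (1 / 2 : ℂ)).re := by
  have h0 := Complex.slitPlane_ne_zero hw
  rw [Complex.cpow_def_of_ne_zero h0, Complex.exp_re]
  refine mul_pos (Real.exp_pos _) (Real.cos_pos_of_mem_Ioo ?_)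
  have h1 : (Complex.log w * (1 / 2)).im = Complex.arg w / 2 := by
    rw [show (1 / 2 : ℂ) = ((1 / 2 : ℝ) : ℂ) by push_cast; rfl, Complex.im_mul_ofReal,
      Complex.log_im]; ring
  rw [h1]
  have h2 := Complex.neg_pi_lt_arg w
  have h3 := lt_of_le_of_ne (Complex.arg_le_pi w) (Complex.mem_slitPlane_iff_arg.1 hw).1
  constructor <;> linarith

theorem hasDerivAt_cutRoot {z : ℂ} (hz : z ∈ cutPlane) :
    HasDerivAt cutRoot (-z / cutRoot z) z := by
  have h1 : HasDerivAt (fun z : ℂ => 1 - z ^ 2) (-(2 * z)) z := by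
    simpa using ((hasDerivAt_id z).pow 2).const_sub 1
  refine (h1.cpow_const (c := 1 / 2) (one_sub_sq_mem_slitPlane hz)).congr_deriv ?_
  have h0 := Complex.slitPlane_ne_zero (one_sub_sq_mem_slitPlane hz)
  have hs := cutRoot_ne_zero hz
  rw [Complex.cpow_sub _ _ h0, Complex.cpow_one]
  change 1 / 2 * (cutRoot z / (1 - z ^ 2)) * _ = _
  rw [← cutRoot_sq]
  field_simp

/-- The numbers √(1 - z²) ± iz are mutually inverse and their sum has positive real part. If one
were real and nonpositive it would be negative, hence so would its inverse, a contradiction. -/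
theorem cutRoot_add_mem_slitPlane {z : ℂ} (hz : z ∈ cutPlane) :
    cutRoot z + Complex.I * z ∈ Complex.slitPlane := by
  by_contra h
  have hre := re_cpow_half_pos (one_sub_sq_mem_slitPlane hz)
  change 0 < (cutRoot z).re at hre
  have hprod : (cutRoot z + Complex.I * z) * (cutRoot z - Complex.I * z) = 1 := by
    linear_combination cutRoot_sq z - z ^ 2 * Complex.I_sq
  rw [Complex.mem_slitPlane_iff] at h
  push Not at h
  set u := cutRoot z + Complex.I * z
  set v := cutRoot z - Complex.I * z
  have huv : u + v = 2 * cutRoot z := by simp [u, v]; ring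
  have h1 := congrArg Complex.re hprod
  simp only [Complex.mul_re, Complex.one_re, h.2, zero_mul, sub_zero] at h1
  have h2 := congrArg Complex.re huv
  simp at h2
  have h3 : u.re < 0 := lt_of_le_of_ne h.1 fun h0 => by rw [h0] at h1; simp at h1
  have h4 : v.re < 0 := by
    by_contra h5
    nlinarith
  linarith

/-- Two continuous square roots of one nonvanishing function on a connected set that agree at 0. -/
theorem ratio_cpow_half {z : ℂ} (hz : z ∈ cutPlane) :
    ((1 - z) / (1 + z)) ^ (1 / 2 : ℂ) = cutRoot z / (1 + z) := by
  have hd : DifferentiableOn ℂ (fun z : ℂ => ((1 - z) / (1 + z)) ^ (1 / 2 : ℂ)) cutPlane := by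
    intro z hz
    refine DifferentiableAt.differentiableWithinAt ?_
    have h1 := Complex.slitPlane_ne_zero (one_add_mem_slitPlane hz)
    exact (DifferentiableAt.div (by fun_prop) (by fun_prop) h1).cpow_const (ratio_mem_slitPlane hz)
  have hg : ContinuousOn (fun z : ℂ => cutRoot z / (1 + z)) cutPlane := fun z hz =>
    ((hasDerivAt_cutRoot hz).continuousAt.div (by fun_prop)
      (Complex.slitPlane_ne_zero (one_add_mem_slitPlane hz))).continuousWithinAt
  refine isPreconnected_cutPlane.eq_of_sq_eq hd.continuousOn hg ?_ ?_ zero_mem_cutPlane ?_ hz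
  · intro w hw
    have h1 := Complex.slitPlane_ne_zero (one_add_mem_slitPlane hw)
    simp only [Pi.pow_apply]
    rw [← Complex.cpow_nat_mul, div_pow, cutRoot_sq]
    norm_num
    field_simp
    ring
  · intro w hw
    exact div_ne_zero (cutRoot_ne_zero hw) (Complex.slitPlane_ne_zero (one_add_mem_slitPlane hw))
  · simp [cutRoot]

/-! ### Ferrers functions of half-integral order are elementary -/

/-- The elementary form of the Ferrers functions `T_ν^{l+1/2}`. -/
def ferrersElem (κ : ℂ) : ℕ → ℂ → ℂ
  | 0 => fun z => (Real.sqrt (2 / Real.pi) : ℂ) * (1 - z ^ 2) ^ (-1 / 4 : ℂ) *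
      Complex.sin (κ * (Real.pi / 2 + Complex.I * Complex.log (cutRoot z + Complex.I * z)))
  | l + 1 => fun z => cutRoot z * deriv (ferrersElem κ l) z +
      (l + 1 / 2) * (z / cutRoot z) * ferrersElem κ l z

theorem differentiableOn_ferrersElem (κ : ℂ) (l : ℕ) :
    DifferentiableOn ℂ (ferrersElem κ l) cutPlane := by
  have hs : DifferentiableOn ℂ cutRoot cutPlane := fun z hz =>
    (hasDerivAt_cutRoot hz).differentiableAt.differentiableWithinAt
  induction l with
  | zero =>
    have h1 : DifferentiableOn ℂ (fun z : ℂ => (1 - z ^ 2) ^ (-1 / 4 : ℂ)) cutPlane := fun z hz =>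
      (DifferentiableAt.cpow_const (f := fun z : ℂ => 1 - z ^ 2) (by fun_prop)
        (one_sub_sq_mem_slitPlane hz)).differentiableWithinAt
    have h2 : DifferentiableOn ℂ (fun z : ℂ => Complex.log (cutRoot z + Complex.I * z)) cutPlane :=
      (hs.add (by fun_prop)).clog fun z hz => cutRoot_add_mem_slitPlane hz
    have h3 := (((h2.const_mul Complex.I).const_add (Real.pi / 2 : ℂ)).const_mul κ).csin
    exact (h1.const_mul _).mul h3
  | succ l ih =>
    exact (hs.mul (ih.deriv isOpen_cutPlane)).add
      (((differentiableOn_id.div hs fun z hz => cutRoot_ne_zero hz).const_mul _).mul ih)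

/-- The prefactor of the hypergeometric expression of the Ferrers function. -/
def ferrersCoeff (ν : ℂ) (l : ℕ) : ℂ :=
  Complex.Gamma (ν + (l + 1 / 2) + 1) /
    (Complex.Gamma (ν - (l + 1 / 2) + 1) * Complex.Gamma (1 + (l + 1 / 2)))

/-- That ν + 1/2 is not an integer keeps the Gamma arguments involving ν away from the poles and the
shift factors away from zero. -/
theorem ferrersCoeff_succ {ν : ℂ} (hν : ∀ n : ℤ, ν + 1 / 2 ≠ n) (l : ℕ) :
    ferrersCoeff ν (l + 1) * (l + 3 / 2) =
      ferrersCoeff ν l * ((ν + 1 / 2 + l + 1) * (ν + 1 / 2 - l - 1)) := by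
  have h1 : ν + 1 / 2 + l + 1 ≠ 0 := fun h => hν (-(l + 1)) (by push_cast; linear_combination h)
  have h2 : ν + 1 / 2 - l - 1 ≠ 0 := fun h => hν (l + 1) (by push_cast; linear_combination h)
  have h3 : (l + 3 / 2 : ℂ) ≠ 0 := by
    have := half_ne_neg_nat (l + 1) 0
    intro h
    apply this
    push_cast
    linear_combination h
  have g1 := Complex.Gamma_add_one _ h1
  have g2 := Complex.Gamma_add_one _ h2
  have g3 := Complex.Gamma_add_one _ h3
  have n1 : Complex.Gamma (ν + 1 / 2 - l - 1) ≠ 0 := Complex.Gamma_ne_zero fun m h =>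
    hν (l + 1 - m) (by push_cast; linear_combination h)
  have n2 : Complex.Gamma (l + 3 / 2 : ℂ) ≠ 0 := Complex.Gamma_ne_zero fun m h =>
    half_ne_neg_nat (l + 1) m (by push_cast; linear_combination h)
  simp only [ferrersCoeff]
  push_cast
  rw [show ν + ((l : ℂ) + 1 + 1 / 2) + 1 = ν + 1 / 2 + l + 1 + 1 by ring,
    show ν - ((l : ℂ) + 1 + 1 / 2) + 1 = ν + 1 / 2 - l - 1 by ring,
    show (1 : ℂ) + (l + 1 + 1 / 2) = l + 3 / 2 + 1 by ring,
    show ν + ((l : ℂ) + 1 / 2) + 1 = ν + 1 / 2 + l + 1 by ring,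
    show ν - ((l : ℂ) + 1 / 2) + 1 = ν + 1 / 2 - l - 1 + 1 by ring,
    show (1 : ℂ) + (l + 1 / 2) = l + 3 / 2 by ring, g1, g2, g3]
  generalize Complex.Gamma (ν + 1 / 2 + l + 1) = G₁
  generalize Complex.Gamma (ν + 1 / 2 - l - 1) = G₂ at *
  generalize Complex.Gamma (l + 3 / 2) = G₃ at *
  generalize ν + 1 / 2 - l - 1 = u at *
  generalize (l + 3 / 2 : ℂ) = v at *
  field_simp

theorem norm_half_one_sub_lt {z : ℂ} (hz : z ∈ cutDisc) : ‖(1 - z) / 2‖ < 1 := by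
  have := hz.2
  rw [Metric.mem_ball, dist_comm, dist_eq_norm] at this
  rw [norm_div, Complex.norm_ofNat]
  linarith

theorem three_half_ne_neg_nat (l k : ℕ) : (1 + (l + 1 / 2) : ℂ) ≠ -k := fun h =>
  half_ne_neg_nat (l + 1) k (by push_cast; linear_combination h)

theorem hasDerivAt_ferrersSeries (ν : ℂ) (l : ℕ) {z : ℂ} (hz : z ∈ cutDisc) :
    HasDerivAt (ferrersSeries ν (l + 1 / 2))
      (ferrersCoeff ν l * ((1 - z) / (1 + z)) ^ ((l + 1 / 2 : ℂ) / 2) *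
        (-(l + 1 / 2) / cutRoot z ^ 2 *
          ordinaryHypergeometric (-ν) (ν + 1) (1 + (l + 1 / 2) : ℂ) ((1 - z) / 2) -
          deriv (ordinaryHypergeometric (-ν) (ν + 1) (1 + (l + 1 / 2) : ℂ)) ((1 - z) / 2) / 2)) z := by
  have hp := Complex.slitPlane_ne_zero (one_add_mem_slitPlane hz.1)
  have hm := Complex.slitPlane_ne_zero (one_sub_mem_slitPlane hz.1)
  have hr : HasDerivAt (fun z : ℂ => (1 - z) / (1 + z)) (-2 / (1 + z) ^ 2) z := by
    refine (((hasDerivAt_id z).const_sub 1).div ((hasDerivAt_id z).const_add 1) hp).congr_deriv ?_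
    simp only [id]
    congr 1
    ring
  have hx := hr.cpow_const (c := (l + 1 / 2 : ℂ) / 2) (ratio_mem_slitPlane hz.1)
  have hF := (hasDerivAt_hypergeometric (a := -ν) (b := ν + 1) (three_half_ne_neg_nat l)
    (norm_half_one_sub_lt hz)).comp z (((hasDerivAt_id z).const_sub 1).div_const 2)
  refine ((hx.const_mul (ferrersCoeff ν l)).mul hF).congr_deriv ?_
  have hxne : (1 - z) / (1 + z) ≠ 0 := div_ne_zero hm hp
  rw [Complex.cpow_sub _ _ hxne, Complex.cpow_one, cutRoot_sq]
  simp only [Function.comp_apply, id]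
  have e : (1 : ℂ) - z ^ 2 = (1 - z) * (1 + z) := by ring
  rw [e]
  field_simp
  ring

/-- With σ = l + 1/2, differentiating the power prefactor leaves (1+z)/2 · F' + σF up to a common
factor, which `hypergeometric_contiguous_up` converts into the series with third parameter raised by
one. The left side is the recursion that defines `ferrersElem`. -/
theorem ferrersSeries_succ {ν : ℂ} (hν : ∀ n : ℤ, ν + 1 / 2 ≠ n) (l : ℕ) {z : ℂ}
    (hz : z ∈ cutDisc) : cutRoot z * deriv (ferrersSeries ν (l + 1 / 2)) z +
      (l + 1 / 2) * (z / cutRoot z) * ferrersSeries ν (l + 1 / 2) z =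
      ferrersSeries ν ((l + 1 : ℕ) + 1 / 2) z := by
  have hp := Complex.slitPlane_ne_zero (one_add_mem_slitPlane hz.1)
  have hm := Complex.slitPlane_ne_zero (one_sub_mem_slitPlane hz.1)
  have hs := cutRoot_ne_zero hz.1
  have hss := cutRoot_sq z
  have h3 : (1 + (l + 1 / 2) : ℂ) ≠ 0 := by simpa using three_half_ne_neg_nat l 0
  rw [(hasDerivAt_ferrersSeries ν l hz).deriv]
  have hup := hypergeometric_contiguous_up (a := -ν) (b := ν + 1) (three_half_ne_neg_nat l)
    (norm_half_one_sub_lt hz)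
  have hcoef := ferrersCoeff_succ hν l
  have hx : ((1 - z) / (1 + z)) ^ (((l + 1 : ℕ) + 1 / 2 : ℂ) / 2) =
      ((1 - z) / (1 + z)) ^ ((l + 1 / 2 : ℂ) / 2) * (cutRoot z / (1 + z)) := by
    rw [← ratio_cpow_half hz.1, ← Complex.cpow_add _ _ (div_ne_zero hm hp)]
    congr 1
    push_cast
    ring
  change _ + _ * (ferrersCoeff ν l * _ * _) = ferrersCoeff ν (l + 1) * _ * _
  rw [hx, show (1 : ℂ) + ((l + 1 : ℕ) + 1 / 2) = 1 + (l + 1 / 2) + 1 by push_cast; ring]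
  set X := ((1 - z) / (1 + z)) ^ ((l + 1 / 2 : ℂ) / 2)
  set F := ordinaryHypergeometric (-ν) (ν + 1) (1 + (l + 1 / 2) : ℂ) ((1 - z) / 2)
  set F' := deriv (ordinaryHypergeometric (-ν) (ν + 1) (1 + (l + 1 / 2) : ℂ)) ((1 - z) / 2)
  set F₁ := ordinaryHypergeometric (-ν) (ν + 1) (1 + (l + 1 / 2) + 1 : ℂ) ((1 - z) / 2)
  have e1 : (1 + (l + 1 / 2) : ℂ) * (ferrersCoeff ν (l + 1) * F₁) =
      -(1 + (l + 1 / 2)) * (ferrersCoeff ν l * ((1 + z) / 2 * F' + (l + 1 / 2) * F)) := by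
    linear_combination F₁ * hcoef + ferrersCoeff ν l * hup
  have e2 : ferrersCoeff ν (l + 1) * F₁ =
      -(ferrersCoeff ν l * ((1 + z) / 2 * F' + (l + 1 / 2) * F)) := by
    apply mul_left_cancel₀ h3
    rw [e1]; ring
  rw [show ferrersCoeff ν (l + 1) * (X * (cutRoot z / (1 + z))) * F₁ =
    X * (cutRoot z / (1 + z)) * (ferrersCoeff ν (l + 1) * F₁) by ring, e2]
  field_simp
  linear_combination (ferrersCoeff ν l * X * F * (2 * l + 1)) * hss

theorem ferrersCoeff_zero {ν : ℂ} (hν : ∀ n : ℤ, ν + 1 / 2 ≠ n) :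
    ferrersCoeff ν 0 = 2 * (ν + 1 / 2) / (Real.sqrt Real.pi : ℂ) := by
  have h1 : ν + 1 / 2 ≠ 0 := fun h => hν 0 (by simpa using h)
  have n1 : Complex.Gamma (ν + 1 / 2) ≠ 0 := Complex.Gamma_ne_zero fun m h =>
    hν (-m) (by push_cast; exact h)
  have h2 : Complex.Gamma (1 / 2 + 1 : ℂ) = (Real.sqrt Real.pi : ℂ) / 2 := by
    rw [Complex.Gamma_add_one _ (by norm_num), Complex.Gamma_one_half_eq]
    rw [Real.sqrt_eq_rpow, Complex.ofReal_cpow Real.pi_pos.le]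
    push_cast; ring
  have hpi : (Real.sqrt Real.pi : ℂ) ≠ 0 := by
    exact_mod_cast (Real.sqrt_pos.2 Real.pi_pos).ne'
  simp only [ferrersCoeff, Nat.cast_zero, zero_add]
  rw [show ν + 1 / 2 + 1 = (ν + 1 / 2) + 1 by ring, show ν - 1 / 2 + 1 = ν + 1 / 2 by ring,
    Complex.Gamma_add_one _ h1, add_comm (1 : ℂ), h2]
  generalize Complex.Gamma (ν + 1 / 2) = G at *
  field_simp

theorem cutRoot_cos {θ : ℝ} (h0 : 0 < θ) (h1 : θ < Real.pi) :
    cutRoot (Real.cos θ) = Real.sin θ := by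
  have hs := Real.sin_pos_of_pos_of_lt_pi h0 h1
  have h : (1 : ℂ) - (Real.cos θ : ℂ) ^ 2 = ((Real.sin θ ^ 2 : ℝ) : ℂ) := by
    rw [Real.sin_sq]; push_cast; ring
  rw [cutRoot, h, show (1 / 2 : ℂ) = ((1 / 2 : ℝ) : ℂ) by push_cast; rfl,
    ← Complex.ofReal_cpow (sq_nonneg _), ← Real.sqrt_eq_rpow, Real.sqrt_sq hs.le]

theorem cutLog_cos {θ : ℝ} (h0 : 0 < θ) (h1 : θ < Real.pi) :
    Real.pi / 2 + Complex.I * Complex.log (cutRoot (Real.cos θ) + Complex.I * Real.cos θ) = θ := by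
  have h : (Real.sin θ : ℂ) + Complex.I * Real.cos θ =
      Complex.exp (((Real.pi / 2 - θ : ℝ) : ℂ) * Complex.I) := by
    rw [Complex.exp_mul_I, ← Complex.ofReal_cos, ← Complex.ofReal_sin, Real.cos_pi_div_two_sub,
      Real.sin_pi_div_two_sub]
    ring
  have him : (((Real.pi / 2 - θ : ℝ) : ℂ) * Complex.I).im = Real.pi / 2 - θ := by simp
  rw [cutRoot_cos h0 h1, h, Complex.log_exp (by rw [him]; linarith) (by rw [him]; linarith)]
  push_cast
  linear_combination (Real.pi / 2 - θ : ℂ) * Complex.I_sq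

theorem prefactor_eq {s c : ℝ} (hs : 0 < s) (hc : 0 < c) :
    Real.sqrt (2 / Real.pi) * ((2 * s * c) ^ 2) ^ (-1 / 4 : ℝ) =
      1 / Real.sqrt Real.pi * (s ^ 2 / c ^ 2) ^ (1 / 4 : ℝ) / s := by
  have hpi := Real.pi_pos
  refine (pow_left_inj₀ (n := 4) (by positivity) (by positivity) (by norm_num)).1 ?_
  have h1 : ∀ x : ℝ, 0 < x → (x ^ (1 / 4 : ℝ)) ^ 4 = x := fun x hx => by
    rw [← Real.rpow_natCast, ← Real.rpow_mul hx.le]; norm_num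
  have h2 : ∀ x : ℝ, 0 < x → (x ^ (-1 / 4 : ℝ)) ^ 4 = x⁻¹ := fun x hx => by
    rw [← Real.rpow_natCast, ← Real.rpow_mul hx.le, ← Real.rpow_neg_one]; norm_num
  have h3 : ∀ x : ℝ, 0 < x → Real.sqrt x ^ 4 = x ^ 2 := fun x hx => by
    rw [show 4 = 2 * 2 by norm_num, pow_mul, Real.sq_sqrt hx.le]
  simp only [mul_pow, div_pow, one_pow]
  rw [h3 _ (by positivity), h3 _ hpi, ← div_pow s c 2, h1 _ (by positivity), ← mul_pow, ← mul_pow,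
    h2 _ (by positivity)]
  field_simp

/-- On z = cos θ the hypergeometric argument (1 - z)/2 is sin²(θ/2), so the closed form applies with
φ = θ/2. -/
theorem ferrersElem_zero_cos {ν : ℂ} (hν : ∀ n : ℤ, ν + 1 / 2 ≠ n) {θ : ℝ} (h0 : 0 < θ)
    (h1 : θ < Real.pi) : ferrersElem (ν + 1 / 2) 0 (Real.cos θ) =
      ferrersSeries ν ((0 : ℕ) + 1 / 2) (Real.cos θ) := by
  have hs : 0 < Real.sin (θ / 2) := Real.sin_pos_of_pos_of_lt_pi (by linarith) (by linarith)
  have hc : 0 < Real.cos (θ / 2) := Real.cos_pos_of_mem_Ioo ⟨by linarith, by linarith⟩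
  have hκ : ν + 1 / 2 ≠ 0 := fun h => hν 0 (by simpa using h)
  have hsin := two_mul_sin_mul_hypergeometric (ν + 1 / 2) (φ := θ / 2) (by linarith) (by linarith)
  rw [show 1 / 2 - (ν + 1 / 2) = -ν by ring, show 1 / 2 + (ν + 1 / 2) = ν + 1 by ring] at hsin
  have hθ : Real.cos θ = Real.cos (θ / 2) ^ 2 - Real.sin (θ / 2) ^ 2 := by
    rw [← Real.cos_two_mul']; congr 1; ring
  have hθ' : Real.sin θ = 2 * Real.sin (θ / 2) * Real.cos (θ / 2) := by
    rw [← Real.sin_two_mul]; congr 1; ring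
  have hone := Real.sin_sq_add_cos_sq (θ / 2)
  have e1 : (1 : ℂ) - (Real.cos θ : ℂ) ^ 2 =
      (((2 * Real.sin (θ / 2) * Real.cos (θ / 2)) ^ 2 : ℝ) : ℂ) := by
    rw [← hθ', Real.sin_sq]; push_cast; ring
  have e2 : ((1 : ℂ) - (Real.cos θ : ℂ)) / (1 + (Real.cos θ : ℂ)) =
      ((Real.sin (θ / 2) ^ 2 / Real.cos (θ / 2) ^ 2 : ℝ) : ℂ) := by
    have : (1 - Real.cos θ) / (1 + Real.cos θ) = Real.sin (θ / 2) ^ 2 / Real.cos (θ / 2) ^ 2 := by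
      rw [hθ, show 1 - (Real.cos (θ / 2) ^ 2 - Real.sin (θ / 2) ^ 2) =
        2 * Real.sin (θ / 2) ^ 2 by linarith, show 1 + (Real.cos (θ / 2) ^ 2 -
        Real.sin (θ / 2) ^ 2) = 2 * Real.cos (θ / 2) ^ 2 by linarith]
      field_simp
    rw [← this]; push_cast; rfl
  have e3 : ((1 : ℂ) - (Real.cos θ : ℂ)) / 2 = (Real.sin (θ / 2) : ℂ) ^ 2 := by
    have : (1 - Real.cos θ) / 2 = Real.sin (θ / 2) ^ 2 := by rw [hθ]; linarith
    exact_mod_cast congrArg (fun x : ℝ => (x : ℂ)) this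
  have hpre := congrArg (fun x : ℝ => (x : ℂ)) (prefactor_eq hs hc)
  simp only [Complex.ofReal_mul, Complex.ofReal_div,
    Complex.ofReal_cpow (sq_nonneg (2 * Real.sin (θ / 2) * Real.cos (θ / 2))),
    Complex.ofReal_cpow (by positivity :
      (0 : ℝ) ≤ Real.sin (θ / 2) ^ 2 / Real.cos (θ / 2) ^ 2)] at hpre
  have hsc : (Real.sin (θ / 2) : ℂ) ≠ 0 := by exact_mod_cast hs.ne'
  change (Real.sqrt (2 / Real.pi) : ℂ) * (1 - (Real.cos θ : ℂ) ^ 2) ^ (-1 / 4 : ℂ) *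
      Complex.sin ((ν + 1 / 2) * (Real.pi / 2 + Complex.I *
        Complex.log (cutRoot (Real.cos θ) + Complex.I * Real.cos θ))) =
      ferrersCoeff ν 0 * ((1 - (Real.cos θ : ℂ)) / (1 + (Real.cos θ : ℂ))) ^
        (((0 : ℕ) + 1 / 2 : ℂ) / 2) * ordinaryHypergeometric (-ν) (ν + 1) (1 + ((0 : ℕ) + 1 / 2) : ℂ)
          ((1 - (Real.cos θ : ℂ)) / 2)
  rw [cutLog_cos h0 h1, ferrersCoeff_zero hν, e1, e2, e3,
    show (1 + ((0 : ℕ) + 1 / 2) : ℂ) = 3 / 2 by norm_num,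
    show ((((0 : ℕ) : ℂ) + 1 / 2) / 2) = ((1 / 4 : ℝ) : ℂ) by push_cast; norm_num,
    show (-1 / 4 : ℂ) = ((-1 / 4 : ℝ) : ℂ) by push_cast; norm_num]
  simp only [Complex.ofReal_mul, Complex.ofReal_div, Complex.ofReal_pow]
  simp only [Complex.ofReal_mul, Complex.ofReal_pow] at hpre
  simp only [Complex.ofReal_div] at hsin
  rw [hpre, show (ν + 1 / 2) * (θ : ℂ) = 2 * (ν + 1 / 2) * ((θ : ℂ) / (2 : ℝ)) by
    push_cast; ring, ← hsin]
  field_simp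
  push_cast
  ring

/-- For l = 0 both sides are analytic and agree on the interval (-1, 1), which accumulates at 0;
higher l follow from the common recursion. -/
theorem ferrersElem_eqOn_series {ν : ℂ} (hν : ∀ n : ℤ, ν + 1 / 2 ≠ n) (l : ℕ) :
    Set.EqOn (ferrersElem (ν + 1 / 2) l) (ferrersSeries ν (l + 1 / 2)) cutDisc := by
  induction l with
  | zero =>
    have h1 : AnalyticOnNhd ℂ (ferrersElem (ν + 1 / 2) 0) cutDisc :=
      ((differentiableOn_ferrersElem _ 0).mono Set.inter_subset_left).analyticOnNhd isOpen_cutDisc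
    have h2 : AnalyticOnNhd ℂ (ferrersSeries ν ((0 : ℕ) + 1 / 2)) cutDisc :=
      DifferentiableOn.analyticOnNhd (fun z hz =>
        (hasDerivAt_ferrersSeries ν 0 hz).differentiableAt.differentiableWithinAt) isOpen_cutDisc
    refine h1.eqOn_of_preconnected_of_frequently_eq h2 isPreconnected_cutDisc zero_mem_cutDisc ?_
    have h3 : ∀ᶠ x : ℝ in 𝓝[≠] 0, ferrersElem (ν + 1 / 2) 0 (x : ℂ) =
        ferrersSeries ν ((0 : ℕ) + 1 / 2) (x : ℂ) := by
      refine nhdsWithin_le_nhds ?_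
      filter_upwards [Ioo_mem_nhds (show (-1 : ℝ) < 0 by norm_num) one_pos] with x hx
      rw [← Real.cos_arccos hx.1.le hx.2.le]
      refine ferrersElem_zero_cos hν (Real.arccos_pos.2 hx.2) ?_
      exact lt_of_le_of_ne (Real.arccos_le_pi x) fun h =>
        absurd (Real.arccos_eq_pi.1 h) (not_le.2 hx.1)
    have h4 : Tendsto (fun x : ℝ => (x : ℂ)) (𝓝[≠] 0) (𝓝[≠] 0) := by
      refine tendsto_nhdsWithin_iff.2 ⟨?_, ?_⟩
      · exact (Complex.continuous_ofReal.tendsto' 0 0 (by simp)).mono_left nhdsWithin_le_nhds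
      · filter_upwards [self_mem_nhdsWithin] with x hx
        simpa using hx
    exact h4.frequently h3.frequently
  | succ l ih =>
    intro z hz
    rw [← ferrersSeries_succ hν l hz]
    have h := (ih.eventuallyEq_of_mem (isOpen_cutDisc.mem_nhds hz)).deriv_eq
    change cutRoot z * deriv (ferrersElem (ν + 1 / 2) l) z + _ = _
    rw [h, ih hz]

/-- The elementary function witnesses that an analytic continuation exists, so the chosen function
is not the default 0; connectedness of the cut plane makes the continuation unique. -/
theorem ferrersT_eq {ν : ℂ} (hν : ∀ n : ℤ, ν + 1 / 2 ≠ n) (l : ℕ) {z : ℂ} (hz : z ∈ cutPlane) :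
    ferrersT ν (l + 1 / 2) z = ferrersElem (ν + 1 / 2) l z := by
  have hex : ∃ f : ℂ → ℂ, DifferentiableOn ℂ f cutPlane ∧
      Set.EqOn f (ferrersSeries ν (l + 1 / 2)) (cutPlane ∩ Metric.ball 1 2) :=
    ⟨_, differentiableOn_ferrersElem _ l, ferrersElem_eqOn_series hν l⟩
  rw [ferrersT, dif_pos hex]
  obtain ⟨hd, he⟩ := hex.choose_spec
  refine (hd.analyticOnNhd isOpen_cutPlane).eqOn_of_preconnected_of_eventuallyEq
    ((differentiableOn_ferrersElem _ l).analyticOnNhd isOpen_cutPlane) isPreconnected_cutPlane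
    zero_mem_cutPlane ?_ hz
  exact (he.trans (ferrersElem_eqOn_series hν l).symm).eventuallyEq_of_mem
    (isOpen_cutDisc.mem_nhds zero_mem_cutDisc)

/-! ### Ferrers functions on the imaginary axis -/

/-- Here κ may be either square root of y, since both sides are odd in κ. This is what makes the
choice of ν in the principal series immaterial. -/
theorem mul_sinOver_rootOf {κ : ℂ} {y : ℝ} (h : κ ^ 2 = y) (θ : ℂ) :
    κ * sinOver (rootOf y) θ = Complex.sin (κ * θ) := by
  rw [← rootOf_sq, sq_eq_sq_iff_eq_or_eq_neg] at h
  rcases h with rfl | rfl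
  · exact mul_sinOver _ _
  · rw [neg_mul, mul_sinOver, neg_mul, Complex.sin_neg]

theorem cutRoot_I_sinh (η : ℝ) : cutRoot (Complex.I * Real.sinh η) = Real.cosh η := by
  have h : (1 : ℂ) - (Complex.I * Real.sinh η) ^ 2 = ((Real.cosh η ^ 2 : ℝ) : ℂ) := by
    rw [Real.cosh_sq, mul_pow, Complex.I_sq]; push_cast; ring
  rw [cutRoot, h, show (1 / 2 : ℂ) = ((1 / 2 : ℝ) : ℂ) by push_cast; rfl,
    ← Complex.ofReal_cpow (sq_nonneg _), ← Real.sqrt_eq_rpow, Real.sqrt_sq (Real.cosh_pos η).le]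

theorem hasDerivAt_inv_sqrt_cosh (η : ℝ) : HasDerivAt (fun x => (Real.sqrt (Real.cosh x))⁻¹)
    (-(Real.tanh η / 2) * (Real.sqrt (Real.cosh η))⁻¹) η := by
  have hc := Real.cosh_pos η
  refine (((Real.hasDerivAt_cosh η).sqrt hc.ne').inv (Real.sqrt_pos.2 hc).ne').congr_deriv ?_
  rw [Real.sq_sqrt hc.le, Real.tanh_eq_sinh_div_cosh]
  have := (Real.sqrt_pos.2 hc).ne'
  field_simp

/-- At z = i sinh η one has √(1 - z²) = cosh η and √(1 - z²) + iz = e^{-η}. The derivative of the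
factor 1/√cosh η adds 1/2 to the coefficient l + 1/2 of tanh η, so the raising operator becomes the
recursion for `modeG`. -/
theorem ferrersElem_I_sinh {κ : ℂ} {y : ℝ} (h : κ ^ 2 = y) (l : ℕ) (η : ℝ) :
    ferrersElem κ l (Complex.I * Real.sinh η) = (Real.sqrt (2 / Real.pi) : ℂ) * κ *
      ((Real.sqrt (Real.cosh η))⁻¹ : ℝ) * modeG y l η := by
  induction l generalizing η with
  | zero =>
    have hc := Real.cosh_pos η
    have e1 : (1 : ℂ) - (Complex.I * Real.sinh η) ^ 2 = ((Real.cosh η ^ 2 : ℝ) : ℂ) := by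
      rw [Real.cosh_sq, mul_pow, Complex.I_sq]; push_cast; ring
    have e2 : (Real.cosh η ^ 2) ^ (-1 / 4 : ℝ) = (Real.sqrt (Real.cosh η))⁻¹ := by
      rw [Real.sqrt_eq_rpow, ← Real.rpow_neg hc.le, ← Real.rpow_natCast, ← Real.rpow_mul hc.le]
      norm_num
    have e3 : (Real.cosh η : ℂ) + Complex.I * (Complex.I * Real.sinh η) =
        ((Real.exp (-η) : ℝ) : ℂ) := by
      rw [← Real.cosh_sub_sinh]; push_cast
      linear_combination Complex.sinh η * Complex.I_sq
    have e4 : Complex.log ((Real.exp (-η) : ℝ) : ℂ) = -(η : ℂ) := by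
      rw [← Complex.ofReal_log (Real.exp_pos _).le, Real.log_exp]; push_cast; rfl
    rw [modeG_zero]
    change (Real.sqrt (2 / Real.pi) : ℂ) * (1 - (Complex.I * Real.sinh η) ^ 2) ^ (-1 / 4 : ℂ) *
      Complex.sin (κ * (Real.pi / 2 + Complex.I * Complex.log (cutRoot (Complex.I * Real.sinh η) +
        Complex.I * (Complex.I * Real.sinh η)))) = _
    rw [cutRoot_I_sinh, e3, e4, e1, show (-1 / 4 : ℂ) = ((-1 / 4 : ℝ) : ℂ) by push_cast; norm_num,
      ← Complex.ofReal_cpow (sq_nonneg _), e2,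
      show (Real.pi / 2 + Complex.I * -η : ℂ) = Real.pi / 2 - Complex.I * η by ring,
      ← mul_sinOver_rootOf h]
    ring
  | succ l ih =>
    have hc := Real.cosh_pos η
    have hcC : (Real.cosh η : ℂ) ≠ 0 := by exact_mod_cast hc.ne'
    set z := Complex.I * (Real.sinh η : ℂ)
    have hz : z ∈ cutPlane := I_mul_mem_cutPlane _
    have hd : HasDerivAt (ferrersElem κ l) (deriv (ferrersElem κ l) z) z :=
      ((differentiableOn_ferrersElem κ l).differentiableAt
        (isOpen_cutPlane.mem_nhds hz)).hasDerivAt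
    have h1 := hd.comp η (((Real.hasDerivAt_sinh η).ofReal_comp).const_mul Complex.I)
    have h2 := (((hasDerivAt_inv_sqrt_cosh η).ofReal_comp).const_mul
      ((Real.sqrt (2 / Real.pi) : ℂ) * κ)).mul (hasDerivAt_mode y l η).1
    have h3 := h1.unique (h2.congr_of_eventuallyEq (Eventually.of_forall fun x => ih x))
    have h4 : cutRoot z * deriv (ferrersElem κ l) z = -Complex.I *
        (deriv (ferrersElem κ l) z * (Complex.I * Real.cosh η)) := by
      rw [cutRoot_I_sinh]
      linear_combination (deriv (ferrersElem κ l) z * Real.cosh η) * Complex.I_sq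
    have h5 : z / cutRoot z = Complex.I * (Real.tanh η : ℝ) := by
      rw [cutRoot_I_sinh, Real.tanh_eq_sinh_div_cosh]; push_cast; simp only [z]; push_cast; ring
    change cutRoot z * deriv (ferrersElem κ l) z + (l + 1 / 2) * (z / cutRoot z) *
      ferrersElem κ l z = _
    rw [h4, h3, h5, ih, modeG_succ]
    push_cast
    ring

/-! ### Phases, Gamma factors and the normalized time factor -/

section Degree

variable {ν : ℂ} {y : ℝ}

theorem degree_ne_int (h : (ν + 1 / 2) ^ 2 = y) (hy : y < 1) (hy0 : y ≠ 0) (n : ℤ) :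
    ν + 1 / 2 ≠ n := by
  intro hn
  rw [hn] at h
  have h1 : (n : ℝ) ^ 2 = y := by exact_mod_cast h
  have h2 : n ^ 2 < 1 := by
    have : ((n ^ 2 : ℤ) : ℝ) < 1 := by push_cast; rw [h1]; exact hy
    exact_mod_cast this
  have h3 : n = 0 := by
    by_contra h0
    have : 1 ≤ |n| := Int.one_le_abs h0
    nlinarith [sq_abs n]
  rw [h3] at h1
  exact hy0 (by rw [← h1]; simp)

/-- As κ² is real and Re κ ≥ 0, the number κ is either nonnegative or purely imaginary; N(ν) is the
inverse phase in each case. -/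
theorem phaseN_mul (h : (ν + 1 / 2) ^ 2 = y) (hre : -(1 / 2) ≤ ν.re) :
    phaseN ν * (ν + 1 / 2) = (‖ν + 1 / 2‖ : ℂ) := by
  have hk : ν + 1 / 2 = ⟨ν.re + 1 / 2, ν.im⟩ := by
    apply Complex.ext
    · simp
    · simp
  have him : (ν.re + 1 / 2) * ν.im = 0 := by
    have := congrArg Complex.im h
    rw [hk, pow_two] at this
    simp only [Complex.mul_im, Complex.ofReal_im] at this
    linarith
  unfold phaseN
  split_ifs with h1 h2
  · have h3 : ν + 1 / 2 = ((ν.re + 1 / 2 : ℝ) : ℂ) := by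
      rw [hk, h1]; rfl
    rw [h3, Complex.norm_real, Real.norm_of_nonneg (by linarith), one_mul]
  · have h3 : ν + 1 / 2 = Complex.I * ((ν.im : ℝ) : ℂ) := by
      rw [hk, (mul_eq_zero.1 him).resolve_right h1]
      apply Complex.ext <;> simp
    rw [h3, norm_mul, Complex.norm_I, one_mul, Complex.norm_real, Real.norm_of_nonneg h2.le]
    linear_combination (-(ν.im : ℂ)) * Complex.I_sq
  · have h3 : ν + 1 / 2 = Complex.I * ((ν.im : ℝ) : ℂ) := by
      rw [hk, (mul_eq_zero.1 him).resolve_right h1]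
      apply Complex.ext <;> simp
    rw [h3, norm_mul, Complex.norm_I, one_mul, Complex.norm_real,
      Real.norm_of_nonpos (not_lt.1 h2)]
    push_cast
    linear_combination (ν.im : ℂ) * Complex.I_sq

/-- The reflection formula gives l = 0. Lowering both Gamma arguments by one divides the product by
(-κ-l-1)(κ-l-1) = (l+1)² - y, the factor in the recursion for `modeNorm`. -/
theorem modeNorm_eq_gammaAbs (h : (ν + 1 / 2) ^ 2 = y) (hy : y < 1) (hy0 : y ≠ 0) (l : ℕ) :
    modeNorm y l = gammaAbs ν l * (2 / Real.pi) * ‖ν + 1 / 2‖ ^ 2 := by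
  have hint := degree_ne_int h hy hy0
  set κ := ν + 1 / 2 with hκ
  have h0 : κ ≠ 0 := fun h => hint 0 (by simpa using h)
  have hn0 : ‖κ‖ ≠ 0 := norm_ne_zero_iff.2 h0
  have hg : ∀ l, gammaAbs ν l = ‖Complex.Gamma (-κ - l) * Complex.Gamma (κ - l)‖ := fun l => by
    rw [gammaAbs, show -ν - l - 1 / 2 = -κ - l by rw [hκ]; ring,
      show ν - l + 1 / 2 = κ - l by rw [hκ]; ring]
  induction l with
  | zero =>
    have h1 : κ * sinOver (rootOf y) Real.pi = Complex.sin (κ * Real.pi) :=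
      mul_sinOver_rootOf h Real.pi
    have h2 := Complex.Gamma_mul_Gamma_one_sub κ
    have h3 : Complex.Gamma (1 - κ) = -κ * Complex.Gamma (-κ) := by
      rw [← Complex.Gamma_add_one _ (neg_ne_zero.2 h0)]; congr 1; ring
    have hs := (sinOver_pi hy).1
    have hs0 : Complex.sin (Real.pi * κ) ≠ 0 := by
      rw [mul_comm, ← h1]; exact mul_ne_zero h0 (norm_pos_iff.1 hs)
    have h4 : Complex.Gamma (-κ) * Complex.Gamma κ =
        -(Real.pi : ℂ) / (κ ^ 2 * sinOver (rootOf y) Real.pi) := by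
      rw [h3] at h2
      have h5 : Complex.sin (Real.pi * κ) = κ * sinOver (rootOf y) Real.pi := by
        rw [h1, mul_comm]
      have h6 : sinOver (rootOf y) Real.pi ≠ 0 := norm_pos_iff.1 hs
      rw [h5, eq_div_iff (mul_ne_zero h0 h6)] at h2
      rw [eq_div_iff (mul_ne_zero (pow_ne_zero 2 h0) h6)]
      linear_combination -h2
    rw [hg, Nat.cast_zero, sub_zero, sub_zero, h4, modeNorm]
    simp only [norm_div, norm_neg, norm_mul, norm_pow, Complex.norm_real, Real.norm_eq_abs,
      abs_of_pos Real.pi_pos]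
    have := Real.pi_pos.ne'
    field_simp
  | succ l ih =>
    have h1 : -κ - l - 1 ≠ 0 := fun h => hint (-(l + 1)) (by push_cast; linear_combination -h)
    have h2 : κ - l - 1 ≠ 0 := fun h => hint (l + 1) (by push_cast; linear_combination h)
    have g1 : Complex.Gamma (-κ - l) = (-κ - l - 1) * Complex.Gamma (-κ - l - 1) := by
      rw [← Complex.Gamma_add_one _ h1]; congr 1; ring
    have g2 : Complex.Gamma (κ - l) = (κ - l - 1) * Complex.Gamma (κ - l - 1) := by
      rw [← Complex.Gamma_add_one _ h2]; congr 1; ring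
    have hd := modeNorm_denom_pos hy l
    have h3 : ‖(-κ - l - 1) * (κ - l - 1)‖ = (l + 1) ^ 2 - y := by
      rw [show (-κ - l - 1) * (κ - l - 1) = (((l + 1) ^ 2 - y : ℝ) : ℂ) by
        push_cast; rw [← h]; ring, Complex.norm_real, Real.norm_of_nonneg hd.le]
    rw [hg, g1, g2] at ih
    rw [modeNorm, ih, hg]
    push_cast
    rw [show -κ - ((l : ℂ) + 1) = -κ - l - 1 by ring, show κ - ((l : ℂ) + 1) = κ - l - 1 by ring,
      show (-κ - l - 1) * Complex.Gamma (-κ - l - 1) * ((κ - l - 1) * Complex.Gamma (κ - l - 1)) =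
      ((-κ - l - 1) * (κ - l - 1)) * (Complex.Gamma (-κ - l - 1) * Complex.Gamma (κ - l - 1)) by
      ring, norm_mul ((-κ - l - 1) * (κ - l - 1)), h3]
    field_simp

/-- The time-dependent factor of the positive-energy mode in terms of elementary functions. -/
def modeRadial (α y : ℝ) (l : ℕ) (t : ℝ) : ℂ :=
  ((Real.sqrt (modeNorm y l / (2 * α)) / Real.cosh (t / α) : ℝ) : ℂ) * modeG y l (t / α)

theorem timeT_eq (α : ℝ) (h : (ν + 1 / 2) ^ 2 = y) (hy : y < 1) (hy0 : y ≠ 0) (l : ℕ) (t : ℝ) :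
    timeT α ν l t = (Real.sqrt (2 / Real.pi) : ℂ) * (ν + 1 / 2) *
      ((Real.sqrt (Real.cosh (t / α)))⁻¹ : ℝ) * modeG y l (t / α) := by
  rw [timeT, ferrersT_eq (degree_ne_int h hy hy0) l (I_mul_mem_cutPlane _), ferrersElem_I_sinh h]

theorem timeFactor_eq (α : ℝ) (h : (ν + 1 / 2) ^ 2 = y) (hy : y < 1) (hy0 : y ≠ 0)
    (hre : -(1 / 2) ≤ ν.re) (l : ℕ) (t : ℝ) :
    timeFactor α ν l t = ((Real.sqrt (2 / Real.pi) * ‖ν + 1 / 2‖ / Real.cosh (t / α) : ℝ) : ℂ) *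
      modeG y l (t / α) := by
  have hc := Real.cosh_pos (t / α)
  have hs : (Real.sqrt (Real.cosh (t / α)) : ℂ) ≠ 0 := by exact_mod_cast (Real.sqrt_pos.2 hc).ne'
  have hss : (Real.sqrt (Real.cosh (t / α)) : ℂ) ^ 2 = (Real.cosh (t / α) : ℂ) := by
    exact_mod_cast Real.sq_sqrt hc.le
  have hc0 : (Real.cosh (t / α) : ℂ) ≠ 0 := by exact_mod_cast hc.ne'
  rw [timeFactor, timeT_eq α h hy hy0]
  push_cast [-Complex.ofReal_cosh]
  rw [← phaseN_mul h hre]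
  field_simp
  rw [hss]
  ring

theorem gammaAbs_pos (h : (ν + 1 / 2) ^ 2 = y) (hy : y < 1) (hy0 : y ≠ 0) (l : ℕ) :
    0 < gammaAbs ν l := by
  have h1 := modeNorm_eq_gammaAbs h hy hy0 l
  have h2 := modeNorm_pos hy l
  by_contra h3
  have h4 : gammaAbs ν l = 0 := le_antisymm (not_lt.1 h3) (norm_nonneg _)
  rw [h4] at h1
  simp [h1] at h2

/-- The factor |κ| of the Ferrers function is absorbed into `modeNorm`, so the result no longer
refers to ν and remains meaningful at y = 0. -/
theorem radial_eq {α : ℝ} (hα : 0 < α) (h : (ν + 1 / 2) ^ 2 = y) (hy : y < 1) (hy0 : y ≠ 0)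
    (hre : -(1 / 2) ≤ ν.re) (l : ℕ) (t : ℝ) : radial α ν l t = modeRadial α y l t := by
  rw [radial, timeFactor_eq α h hy hy0 hre, modeRadial, modeNorm_eq_gammaAbs h hy hy0]
  have hg := gammaAbs_pos h hy hy0 l
  have h1 : Real.sqrt (gammaAbs ν l * (2 / Real.pi) * ‖ν + 1 / 2‖ ^ 2 / (2 * α)) =
      Real.sqrt (gammaAbs ν l / (2 * α)) * (Real.sqrt (2 / Real.pi) * ‖ν + 1 / 2‖) := by
    rw [show gammaAbs ν l * (2 / Real.pi) * ‖ν + 1 / 2‖ ^ 2 / (2 * α) =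
      gammaAbs ν l / (2 * α) * (2 / Real.pi * ‖ν + 1 / 2‖ ^ 2) by ring,
      Real.sqrt_mul (by positivity), Real.sqrt_mul (by have := Real.pi_pos; positivity),
      Real.sqrt_sq (norm_nonneg _)]
  rw [h1]
  push_cast
  ring

theorem timeT_ne_zero (α : ℝ) (h : (ν + 1 / 2) ^ 2 = y) (hy : y < 1) (hy0 : y ≠ 0) (l : ℕ) (t : ℝ) :
    timeT α ν l t ≠ 0 := by
  have hκ : ν + 1 / 2 ≠ 0 := fun h1 => degree_ne_int h hy hy0 0 (by simpa using h1)
  have hpi : (Real.sqrt (2 / Real.pi) : ℂ) ≠ 0 := by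
    exact_mod_cast (Real.sqrt_pos.2 (div_pos two_pos Real.pi_pos)).ne'
  have hc : (((Real.sqrt (Real.cosh (t / α)))⁻¹ : ℝ) : ℂ) ≠ 0 := by
    exact_mod_cast (inv_pos.2 (Real.sqrt_pos.2 (Real.cosh_pos (t / α)))).ne'
  rw [timeT_eq α h hy hy0]
  exact mul_ne_zero (mul_ne_zero (mul_ne_zero hpi hκ) hc) (modeG_ne_zero hy l _)

theorem omegaDS_eq (α : ℝ) (h : (ν + 1 / 2) ^ 2 = y) (hy : y < 1) (hy0 : y ≠ 0) (l : ℕ) (t : ℝ) :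
    omegaDS α ν l t = Real.cosh (t / α) / modeSq y l (t / α) := by
  have hc := Real.cosh_pos (t / α)
  rw [omegaDS, timeT_eq α h hy hy0, modeSq, modeNorm_eq_gammaAbs h hy hy0]
  simp only [norm_mul, Complex.norm_real, mul_pow, Real.norm_eq_abs, sq_abs, inv_pow]
  rw [Real.sq_sqrt (by have := Real.pi_pos; positivity), Real.sq_sqrt hc.le]
  have := hc.ne'
  have hG : ‖modeG y l (t / α)‖ ≠ 0 := norm_ne_zero_iff.2 (modeG_ne_zero hy l _)
  have hκ : ‖ν + 1 / 2‖ ≠ 0 :=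
    norm_ne_zero_iff.2 fun h1 => degree_ne_int h hy hy0 0 (by simpa using h1)
  have hg := (gammaAbs_pos h hy hy0 l).ne'
  field_simp

end Degree

theorem norm_modeRadial_sq {α y : ℝ} (hα : 0 < α) (hy : y < 1) (l : ℕ) (t : ℝ) :
    ‖modeRadial α y l t‖ ^ 2 = modeSq y l (t / α) / (2 * α * Real.cosh (t / α) ^ 2) := by
  have hN := modeNorm_pos hy l
  rw [modeRadial, norm_mul, Complex.norm_real, mul_pow, Real.norm_eq_abs, sq_abs, div_pow,
    Real.sq_sqrt (by positivity), modeSq]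
  field_simp

theorem modeRadial_ne_zero {α y : ℝ} (hα : 0 < α) (hy : y < 1) (l : ℕ) (t : ℝ) :
    modeRadial α y l t ≠ 0 := by
  have h := norm_modeRadial_sq hα hy l t
  have h1 := modeSq_pos hy l (t / α)
  have := Real.cosh_pos (t / α)
  intro h0
  rw [h0, norm_zero] at h
  have : 0 < modeSq y l (t / α) / (2 * α * Real.cosh (t / α) ^ 2) := by positivity
  rw [← h] at this
  simp at this

theorem modeRadial_bounded {α y : ℝ} (hα : 0 < α) (hy : y < 1) (t : ℝ) :
    ∃ B : ℝ, ∀ᶠ y' in 𝓝 y, ∀ l, ‖modeRadial α y' l t‖ ≤ B := by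
  obtain ⟨B, hB⟩ := eventually_modeSq_le hy (t / α)
  refine ⟨Real.sqrt (B / (2 * α * Real.cosh (t / α) ^ 2)), ?_⟩
  filter_upwards [hB, Iio_mem_nhds hy] with y' h hy' l
  apply Real.le_sqrt_of_sq_le
  rw [norm_modeRadial_sq hα hy']
  have := Real.cosh_pos (t / α)
  gcongr
  exact h l

theorem continuousOn_modeRadial (α : ℝ) (l : ℕ) (t : ℝ) :
    ContinuousOn (fun y => modeRadial α y l t) (Set.Iio 1) := by
  refine ContinuousOn.mul ?_ (continuous_modePair l (t / α)).1.continuousOn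
  refine Complex.continuous_ofReal.comp_continuousOn ?_
  exact (((continuousOn_modeNorm l).div_const _).sqrt).div_const _

theorem conj_modeRadial_neg (α y : ℝ) (l : ℕ) (t : ℝ) :
    conj (modeRadial α y l (-t)) = modeRadial α y l t := by
  rw [modeRadial, map_mul, Complex.conj_ofReal, neg_div, (conj_mode_neg y l _).1, Real.cosh_neg,
    modeRadial]

theorem modeRadial_zero {α y : ℝ} (hα : 0 < α) (hy : y < 1) (l : ℕ) :
    ∃ s : ℝ, 0 < s ∧ modeRadial α y l 0 = (-1) ^ l * s := by
  obtain ⟨s, hs, h⟩ := (mode_at_zero hy l).1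
  have hN := modeNorm_pos hy l
  refine ⟨Real.sqrt (modeNorm y l / (2 * α)) * s, by positivity, ?_⟩
  rw [modeRadial, zero_div, h, Real.cosh_zero]
  push_cast
  ring

/-! ### Modes and solutions at an admissible mass -/

section Parameter

variable {α ħ ξ m : ℝ} {ν : ℂ}

theorem one_sub_massSq_lt (hm : m ∈ massRange α ħ ξ) : 1 - massSq α ħ ξ m < 1 := by
  have := hm.2
  linarith

theorem one_sub_massSq_ne (hm : m ∈ admissibleMass α ħ ξ) : 1 - massSq α ħ ξ m ≠ 0 :=
  fun h => hm.2 (by linarith)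

theorem degree_sq {M : ℝ} (hν : IsDegree M ν) : (ν + 1 / 2) ^ 2 = ((1 - M : ℝ) : ℂ) := by
  rw [hν.1]; push_cast; rfl

theorem radial_eq_modeRadial (hα : 0 < α) (hm : m ∈ admissibleMass α ħ ξ)
    (hν : IsDegree (massSq α ħ ξ m) ν) (l : ℕ) (t : ℝ) :
    radial α ν l t = modeRadial α (1 - massSq α ħ ξ m) l t :=
  radial_eq hα (degree_sq hν) (one_sub_massSq_lt hm.1) (one_sub_massSq_ne hm) hν.2 l t

end Parameter

theorem modeRadial_bounded_at {α y : ℝ} (hα : 0 < α) (hy : y < 1) (t : ℝ) :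
    ∃ B : ℝ, ∀ l, ‖modeRadial α y l t‖ ≤ B := by
  obtain ⟨B, hB⟩ := modeRadial_bounded hα hy t
  exact ⟨B, hB.self_of_nhds⟩

theorem hasSum_sphereMultiplier_expand {c : ℕ → ℂ} (h : ∃ B, ∀ l, ‖c l‖ ≤ B) (φ : OneParticle) :
    HasSum (fun p : Idx => (φ p * c p.1.1) • Y p) (sphereMultiplier c (expand φ)) := by
  rw [sphereMultiplier_expand]
  refine (hasSum_congr_terms fun p => ?_).1 (hasSum_expand (multiplier c φ))
  rw [multiplier_apply h, mul_comm]

section Field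

variable {α y : ℝ} {ν : ℂ}

theorem field_eq (hα : 0 < α) (hy : y < 1) (hr : ∀ l t, radial α ν l t = modeRadial α y l t)
    (φ : OneParticle) (t : ℝ) :
    field α ν φ t = sphereMultiplier (fun l => modeRadial α y l t) (expand φ) := by
  rw [field, ← (hasSum_sphereMultiplier_expand (modeRadial_bounded_at hα hy t) φ).tsum_eq]
  simp only [hr]

theorem hasSum_field (hα : 0 < α) (hy : y < 1) (hr : ∀ l t, radial α ν l t = modeRadial α y l t)
    (φ : OneParticle) (t : ℝ) :
    HasSum (fun p : Idx => (φ p * radial α ν p.1.1 t) • Y p) (field α ν φ t) := by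
  rw [field_eq hα hy hr]
  simp only [hr]
  exact hasSum_sphereMultiplier_expand (modeRadial_bounded_at hα hy t) φ

theorem inner_Y_field (hα : 0 < α) (hy : y < 1) (hr : ∀ l t, radial α ν l t = modeRadial α y l t)
    (φ : OneParticle) (t : ℝ) (p : Idx) :
    inner ℂ (Y p) (field α ν φ t) = modeRadial α y p.1.1 t * φ p := by
  rw [field_eq hα hy hr, inner_Y_sphereMultiplier (modeRadial_bounded_at hα hy t), inner_Y_expand]

theorem eq_of_field_eq (hα : 0 < α) (hy : y < 1)
    (hr : ∀ l t, radial α ν l t = modeRadial α y l t) {φ ψ : OneParticle} {t : ℝ}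
    (h : field α ν φ t = field α ν ψ t) : φ = ψ := by
  ext p
  have := congrArg (inner ℂ (Y p)) h
  rw [inner_Y_field hα hy hr, inner_Y_field hα hy hr] at this
  exact mul_left_cancel₀ (modeRadial_ne_zero hα hy _ _) this

theorem field_injective (hα : 0 < α) (hy : y < 1)
    (hr : ∀ l t, radial α ν l t = modeRadial α y l t) : Function.Injective (field α ν) :=
  fun _ _ h => eq_of_field_eq hα hy hr (congrFun h 0)

theorem field_sphereAct (hα : 0 < α) (hy : y < 1)
    (hr : ∀ l t, radial α ν l t = modeRadial α y l t) (g : Space ≃ₗᵢ[ℝ] Space) (φ : OneParticle)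
    (t : ℝ) : field α ν (expand.symm (sphereAct g (expand φ))) t = sphereAct g (field α ν φ t) := by
  rw [field_eq hα hy hr, field_eq hα hy hr, LinearIsometryEquiv.apply_symm_apply,
    sphereMultiplier_sphereAct (modeRadial_bounded_at hα hy t)]

theorem field_star (hα : 0 < α) (hy : y < 1)
    (hr : ∀ l t, radial α ν l t = modeRadial α y l t) (φ : OneParticle) (t : ℝ) :
    field α ν (expand.symm (star (expand φ))) t = star (field α ν φ (-t)) := by
  rw [field_eq hα hy hr, field_eq hα hy hr, LinearIsometryEquiv.apply_symm_apply,
    sphereMultiplier_star (modeRadial_bounded_at hα hy (-t))]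
  simp only [conj_modeRadial_neg]

theorem eq_of_forall_field_sphereAct (hα : 0 < α) (hy : y < 1)
    (hr : ∀ l t, radial α ν l t = modeRadial α y l t) {g : Space ≃ₗᵢ[ℝ] Space} {φ ψ : OneParticle}
    (h : ∀ t, field α ν ψ t = sphereAct g (field α ν φ t)) :
    ψ = expand.symm (sphereAct g (expand φ)) :=
  eq_of_field_eq hα hy hr (t := 0) (by rw [h, field_sphereAct hα hy hr])

theorem eq_of_forall_field_star (hα : 0 < α) (hy : y < 1)
    (hr : ∀ l t, radial α ν l t = modeRadial α y l t) {φ ψ : OneParticle}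
    (h : ∀ t, field α ν ψ t = star (field α ν φ (-t))) :
    ψ = expand.symm (star (expand φ)) :=
  eq_of_field_eq hα hy hr (t := 0) (by rw [h, field_star hα hy hr])

end Field

/-- The Klein–Gordon norm of a single mode is the Wronskian of G. The real prefactor contributes to
the derivative a real multiple of G, which drops out of the antisymmetric expression, so its
derivative is never computed. -/
theorem hasDerivAt_modeRadial {α y : ℝ} (hα : 0 < α) (hy : y < 1) (l : ℕ) (t : ℝ) :
    ∃ R' : ℂ, HasDerivAt (modeRadial α y l) R' t ∧
      Complex.I * (scale α t : ℂ) ^ 2 *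
        (conj (modeRadial α y l t) * R' - conj R' * modeRadial α y l t) = 1 := by
  have hc := Real.cosh_pos (t / α)
  have hdiv : HasDerivAt (fun s : ℝ => s / α) (1 / α) t := (hasDerivAt_id t).div_const α
  have hcosh := (Real.hasDerivAt_cosh (t / α)).comp t hdiv
  obtain ⟨c', h1⟩ : ∃ c' : ℝ, HasDerivAt (fun s : ℝ =>
      ((Real.sqrt (modeNorm y l / (2 * α)) / Real.cosh (s / α) : ℝ) : ℂ)) (c' : ℂ) t :=
    ⟨_, ((hasDerivAt_const t (Real.sqrt (modeNorm y l / (2 * α)))).div hcosh hc.ne').ofReal_comp⟩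
  have h2 := (hasDerivAt_mode y l (t / α)).1.scomp t hdiv
  refine ⟨_, h1.mul h2, ?_⟩
  have hW := wronskian hy l (t / α)
  have hN := modeNorm_pos hy l
  have hN0 : (modeNorm y l : ℂ) ≠ 0 := by exact_mod_cast hN.ne'
  have hsq : (Real.sqrt (modeNorm y l / (2 * α)) : ℂ) ^ 2 = modeNorm y l / (2 * α) := by
    have := Real.sq_sqrt (by positivity : 0 ≤ modeNorm y l / (2 * α))
    exact_mod_cast congrArg (fun x : ℝ => (x : ℂ)) this
  have hα0 : (α : ℂ) ≠ 0 := by exact_mod_cast hα.ne'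
  have hc0 : (Real.cosh (t / α) : ℂ) ≠ 0 := by exact_mod_cast hc.ne'
  simp only [modeRadial, scale, map_add, map_mul, Complex.conj_ofReal, Complex.real_smul]
  push_cast [-Complex.ofReal_cosh]
  set S : ℂ := (Real.sqrt (modeNorm y l / (2 * α)) : ℂ)
  set c : ℂ := (Real.cosh (t / α) : ℂ)
  set G := modeG y l (t / α)
  set D := modeD y l (t / α)
  have : Complex.I * ((α : ℂ) * c) ^ 2 * (S / c * conj G * (c' * G + S / c * (1 / α * D)) -
      (c' * conj G + S / c * (1 / α * conj D)) * (S / c * G)) =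
      Complex.I * α * S ^ 2 * (conj G * D - conj D * G) := by
    field_simp; ring
  rw [this, hsq]
  have h3 : Complex.I * α * (modeNorm y l / (2 * α)) * (conj G * D - conj D * G) =
      Complex.I / 2 * ((modeNorm y l : ℂ) * (conj G * D - conj D * G)) := by
    field_simp
  rw [h3, hW]
  linear_combination (-1 : ℂ) * Complex.I_sq

theorem kgForm_mode {α y : ℝ} {ν : ℂ} (hα : 0 < α) (hy : y < 1)
    (hr : ∀ l t, radial α ν l t = modeRadial α y l t) (t : ℝ) (p q : Idx) :
    kgForm α t (mode α ν p) (mode α ν q) = if p = q then 1 else 0 := by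
  obtain ⟨P', hP, -⟩ := hasDerivAt_modeRadial hα hy p.1.1 t
  obtain ⟨Q', hQ, hQ1⟩ := hasDerivAt_modeRadial hα hy q.1.1 t
  have hmode : ∀ (p : Idx) (s : ℝ) (x : Sphere),
      mode α ν p s x = modeRadial α y p.1.1 s * sphHarmonic p.1.1 p.1.2 x := fun p s x => by
    rw [mode, hr]
  have hd : ∀ x, deriv (fun s => mode α ν q s x) t = Q' * sphHarmonic q.1.1 q.1.2 x := fun x => by
    simp only [hmode]
    exact (hQ.mul_const _).deriv
  have hd' : ∀ x, deriv (fun s => conj (mode α ν p s x)) t =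
      conj P' * conj (sphHarmonic p.1.1 p.1.2 x) := fun x => by
    simp only [hmode, map_mul]
    exact (hP.star.mul_const _).deriv
  have hint : ∫ x, conj (sphHarmonic p.1.1 p.1.2 x) * sphHarmonic q.1.1 q.1.2 x ∂sphereMeasure =
      if p = q then 1 else 0 := by
    rw [← inner_toL2, ← Y_eq, ← Y_eq, orthonormal_iff_ite.1 orthonormal_Y]
  rw [kgForm]
  have : ∀ x, conj (mode α ν p t x) * deriv (fun s => mode α ν q s x) t -
      deriv (fun s => conj (mode α ν p s x)) t * mode α ν q t x =
      (conj (modeRadial α y p.1.1 t) * Q' - conj P' * modeRadial α y q.1.1 t) *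
        (conj (sphHarmonic p.1.1 p.1.2 x) * sphHarmonic q.1.1 q.1.2 x) := fun x => by
    rw [hd, hd', hmode, hmode, map_mul]; ring
  simp only [this]
  rw [integral_const_mul, hint]
  split_ifs with hpq
  · subst hpq
    rw [mul_one, hP.unique hQ]
    rw [hP.unique hQ] at hP
    exact hQ1
  · simp

/-! ### Unitary maps commuting with rotations, and the set of masses -/

/-- The index `(l, 0)`. -/
def axialIdx (l : ℕ) : Idx := ⟨(l, 0), by simp⟩

theorem negIdx_axialIdx (l : ℕ) : negIdx (axialIdx l) = axialIdx l := by
  apply Subtype.ext; simp [negIdx, axialIdx]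

theorem norm_Y (p : Idx) : ‖Y p‖ = 1 := orthonormal_Y.1 p

theorem inner_Y_self (p : Idx) : inner ℂ (Y p) (Y p) = (1 : ℂ) := by
  rw [orthonormal_iff_ite.1 orthonormal_Y, if_pos rfl]

theorem star_Y_axialIdx (l : ℕ) : star (Y (axialIdx l)) = Y (axialIdx l) := by
  rw [star_Y, negIdx_axialIdx]; simp [axialIdx]

theorem expand_symm_Y (p : Idx) : expand.symm (Y p) = modeVec p := by
  rw [← expand_modeVec, LinearIsometryEquiv.symm_apply_apply]

/-- A unitary map intertwining the rotations is a multiplication by phases that depend only on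
the degree. -/
theorem exists_phase_of_commute (e : OneParticle ≃ₗᵢ[ℂ] L2Sphere)
    (h : ∀ (i : Fin 3) (θ : ℝ) (φ : OneParticle),
      e (expand.symm (sphereAct (axisRotation i θ) (expand φ))) =
        sphereAct (axisRotation i θ) (e φ)) :
    ∃ s : ℕ → ℂ, (∀ p, e (modeVec p) = s p.1.1 • Y p) ∧ ∀ l, ‖s l‖ = 1 := by
  set A : L2Sphere →L[ℂ] L2Sphere :=
    (e : OneParticle →L[ℂ] L2Sphere) ∘L (expand.symm : L2Sphere →L[ℂ] OneParticle) with hA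
  have hAe : ∀ φ, A (expand φ) = e φ := fun φ => by simp [hA]
  have hcomm : ∀ (i : Fin 3) (θ : ℝ) (f : L2Sphere),
      A (sphereAct (axisRotation i θ) f) = sphereAct (axisRotation i θ) (A f) := by
    intro i θ f
    obtain ⟨φ, rfl⟩ := expand.surjective f
    rw [hAe, ← h, ← hAe, LinearIsometryEquiv.apply_symm_apply]
  have hs : ∀ p : Idx, e (modeVec p) = matCoeff A p.1.1 0 p.1.1 0 • Y p := by
    intro p
    refine L2_ext fun q => ?_
    rw [← hAe, expand_modeVec, inner_Y_map_Y hcomm, inner_smul_right,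
      orthonormal_iff_ite.1 orthonormal_Y]
    split_ifs with hqp
    · rw [mul_one]
    · rw [mul_zero]
  refine ⟨fun l => matCoeff A l 0 l 0, hs, fun l => ?_⟩
  have h1 := congrArg norm (hs (axialIdx l))
  rw [e.norm_map, norm_smul, norm_Y, mul_one, ← expand_symm_Y, LinearIsometryEquiv.norm_map,
    norm_Y] at h1
  exact h1.symm

theorem linearIsometryEquiv_ext_modeVec {e e' : OneParticle ≃ₗᵢ[ℂ] L2Sphere}
    (h : ∀ p, e (modeVec p) = e' (modeVec p)) : e = e' := by
  have h1 : (e : OneParticle →L[ℂ] L2Sphere) ∘L (expand.symm : L2Sphere →L[ℂ] OneParticle) =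
      (e' : OneParticle →L[ℂ] L2Sphere) ∘L (expand.symm : L2Sphere →L[ℂ] OneParticle) := by
    refine continuousLinearMap_ext_Y fun p => ?_
    simpa [expand_symm_Y] using h p
  ext1 φ
  have := congrArg (fun A : L2Sphere →L[ℂ] L2Sphere => A (expand φ)) h1
  simpa using this

section Mass

variable {α ħ ξ : ℝ}

theorem massSq_eq (hα : 0 < α) (m : ℝ) :
    massSq α ħ ξ m = (α / ħ) ^ 2 * m ^ 2 + 6 * ξ / ħ ^ 2 := by
  rw [massSq, mul_add, show α ^ 2 * (ξ * (6 / α ^ 2)) = 6 * ξ by field_simp]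
  ring

theorem massSq_lt (hα : 0 < α) (hħ : 0 < ħ) {m m' : ℝ} (h0 : 0 ≤ m) (h : m < m') :
    massSq α ħ ξ m < massSq α ħ ξ m' := by
  rw [massSq_eq hα, massSq_eq hα]
  have : m ^ 2 < m' ^ 2 := by nlinarith
  gcongr

theorem massRange_mono (hα : 0 < α) (hħ : 0 < ħ) {m m' : ℝ} (hm : m ∈ massRange α ħ ξ)
    (h : m ≤ m') : m' ∈ massRange α ħ ξ := by
  rcases h.eq_or_lt with rfl | h
  · exact hm
  · exact ⟨hm.1.trans h.le, hm.2.trans (massSq_lt hα hħ hm.1 h)⟩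

theorem isPreconnected_massRange (hα : 0 < α) (hħ : 0 < ħ) :
    IsPreconnected (massRange α ħ ξ) := by
  have : Set.OrdConnected (massRange α ħ ξ) :=
    ⟨fun a ha b _ x hx => massRange_mono hα hħ ha hx.1⟩
  exact this.isPreconnected

theorem tendsto_massSq (hα : 0 < α) (hħ : 0 < ħ) : Tendsto (massSq α ħ ξ) atTop atTop := by
  have : massSq α ħ ξ = fun m => (α / ħ) ^ 2 * m ^ 2 + 6 * ξ / ħ ^ 2 := funext (massSq_eq hα)
  rw [this]
  exact tendsto_atTop_add_const_right _ _
    ((tendsto_pow_atTop two_ne_zero).const_mul_atTop (by positivity))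

theorem continuous_massSq : Continuous (massSq α ħ ξ) := by unfold massSq; fun_prop

theorem eventually_admissible (hα : 0 < α) (hħ : 0 < ħ) :
    ∀ᶠ m in atTop, m ∈ admissibleMass α ħ ξ := by
  filter_upwards [(tendsto_massSq (ξ := ξ) hα hħ).eventually_gt_atTop 1, eventually_ge_atTop 0]
    with m h1 h0
  exact ⟨⟨h0, by linarith⟩, h1.ne'⟩

/-- A continuous function on the masses in range that takes the square value `c ^ 2` at all
admissible masses takes it at all masses in range. -/
theorem sq_eq_on_massRange (hα : 0 < α) (hħ : 0 < ħ) {g : ℝ → ℂ} {c : ℂ}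
    (hg : ContinuousOn g (massRange α ħ ξ)) (h : ∀ m ∈ admissibleMass α ħ ξ, g m ^ 2 = c) :
    ∀ m ∈ massRange α ħ ξ, g m ^ 2 = c := by
  intro m hm
  by_cases h1 : massSq α ħ ξ m = 1
  -- If M² = 1 at m, all larger masses are admissible because M² is strictly increasing; the value
  -- at m is their limit.
  · have hsub : Set.Ioi m ⊆ massRange α ħ ξ := fun x hx => massRange_mono hα hħ hm (le_of_lt hx)
    have ht : Tendsto (fun x => g x ^ 2) (𝓝[>] m) (𝓝 (g m ^ 2)) :=
      (((hg m hm).mono hsub).tendsto).pow 2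
    refine tendsto_nhds_unique ht (tendsto_const_nhds.congr' ?_)
    filter_upwards [self_mem_nhdsWithin] with x hx
    refine (h x ⟨hsub hx, ?_⟩).symm
    have := massSq_lt (ξ := ξ) hα hħ hm.1 hx
    linarith
  · exact h m ⟨hm, h1⟩

end Mass

/-! ### What the postulates determine -/

section Uniqueness

variable {α ħ ξ : ℝ} {ν : ℝ → ℂ} {W : ℝ → ℝ → (OneParticle ≃ₗᵢ[ℂ] L2Sphere)}

/-- Schur's lemma gives the phases. The mode u_{l,0} is its own time reversal, since Y_l^0 is real
and the time factor satisfies conj R(-t) = R(t); postulate III for it relates s_l(-t) and s_l(t). -/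
theorem exists_phase (hα : 0 < α)
    (hν : ∀ m ∈ admissibleMass α ħ ξ, IsDegree (massSq α ħ ξ m) (ν m))
    (hW : LocalizationPostulates α ħ ξ ν W) {m : ℝ} (hm : m ∈ admissibleMass α ħ ξ) :
    ∃ s : ℕ → ℝ → ℂ, (∀ (p : Idx) (t : ℝ), W m t (modeVec p) = s p.1.1 t • Y p) ∧
      ∀ l t, ‖s l t‖ = 1 ∧ s l (-t) = conj (s l t) := by
  have hy := one_sub_massSq_lt hm.1
  have hr := radial_eq_modeRadial hα hm (hν m hm)
  have key : ∀ t, ∃ s : ℕ → ℂ, (∀ p, W m t (modeVec p) = s p.1.1 • Y p) ∧ ∀ l, ‖s l‖ = 1 := by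
    intro t
    refine exists_phase_of_commute (W m t) fun i θ φ => ?_
    exact hW.rotation m hm i θ φ _ (fun t => field_sphereAct hα hy hr _ φ t) t
  choose s hs hs1 using key
  refine ⟨fun l t => s t l, fun p t => hs t p, fun l t => ⟨hs1 t l, ?_⟩⟩
  have h1 := hW.time_reversal m hm (modeVec (axialIdx l)) (modeVec (axialIdx l)) (fun t => by
    rw [← field_star hα hy hr, expand_modeVec, star_Y_axialIdx, expand_symm_Y]) (-t)
  rw [neg_neg, hs, hs] at h1
  have h2 := congrArg (inner ℂ (Y (axialIdx l))) h1
  rw [inner_Y_star, negIdx_axialIdx, inner_smul_right, inner_smul_right, inner_Y_self] at h2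
  simpa [axialIdx] using h2

/-- The sign s_l(0) = ±1 cannot jump as the mass varies over the connected range, which contains the
point M² = 1 separating the two series. So it suffices to know it for one large mass, where
postulate IV decides. -/
theorem phase_at_zero (hα : 0 < α) (hħ : 0 < ħ)
    (hν : ∀ m ∈ admissibleMass α ħ ξ, IsDegree (massSq α ħ ξ m) (ν m))
    (hW : LocalizationPostulates α ħ ξ ν W) {m : ℝ} (hm : m ∈ admissibleMass α ħ ξ) (l : ℕ) :
    W m 0 (modeVec (axialIdx l)) = (-1 : ℂ) ^ l • Y (axialIdx l) := by
  set u := modeVec (axialIdx l)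
  set b := Y (axialIdx l)
  have hex : ∀ m ∈ admissibleMass α ħ ξ, ∃ s : ℂ, W m 0 u = s • b ∧ s ^ 2 = 1 ∧ conj s = s := by
    intro m hm
    obtain ⟨s, hs, hs'⟩ := exists_phase hα hν hW hm
    obtain ⟨h1, h2⟩ := hs' l 0
    rw [neg_zero] at h2
    refine ⟨s l 0, hs (axialIdx l) 0, ?_, h2.symm⟩
    rw [pow_two]
    nth_rewrite 1 [h2]
    rw [← Complex.normSq_eq_conj_mul_self, Complex.normSq_eq_norm_sq, h1]
    simp
  -- Since s² = 1, the inverse image of Y_l^0 is s u_{l,0}, with slice s R_l(0) Y_l^0 at time 0.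
  -- Dividing its Y_l^0 coefficient by the continuous nonzero R_l(0) gives a continuous function
  -- that equals s at admissible masses.
  obtain ⟨G, hG, hGm⟩ := hW.mass_continuity 0 b 0
  set R : ℝ → ℂ := fun m => modeRadial α (1 - massSq α ħ ξ m) l 0 with hR
  have hRc : ContinuousOn R (massRange α ħ ξ) :=
    (continuousOn_modeRadial α l 0).comp (continuous_const.sub continuous_massSq).continuousOn
      fun m hm => one_sub_massSq_lt hm
  have hR0 : ∀ m ∈ massRange α ħ ξ, R m ≠ 0 := fun m hm =>
    modeRadial_ne_zero hα (one_sub_massSq_lt hm) l 0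
  set g : ℝ → ℂ := fun m => inner ℂ b (G m) / R m with hg
  have hgc : ContinuousOn g (massRange α ħ ξ) :=
    (ContinuousOn.inner (𝕜 := ℂ) continuousOn_const hG).div hRc hR0
  have hgs : ∀ m ∈ admissibleMass α ħ ξ, W m 0 u = g m • b ∧ g m ^ 2 = 1 := by
    intro m hm
    obtain ⟨s, hs, hs2, hsc⟩ := hex m hm
    have hsymm : (W m 0).symm b = s • u := by
      apply (W m 0).injective
      rw [LinearIsometryEquiv.apply_symm_apply, map_smul, hs, smul_smul, ← pow_two, hs2, one_smul]
    have hgm : g m = s := by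
      have hu : u (axialIdx l) = 1 := by
        rw [← inner_Y_expand, expand_modeVec, inner_Y_self]
      simp only [hg]
      rw [hGm m hm, inner_Y_field hα (one_sub_massSq_lt hm.1)
        (radial_eq_modeRadial hα hm (hν m hm)), hsymm, lp.coeFn_smul, Pi.smul_apply, hu,
        smul_eq_mul, mul_one]
      exact mul_div_cancel_left₀ _ (hR0 m hm.1)
    rw [hgm]
    exact ⟨hs, hs2⟩
  have hsq := sq_eq_on_massRange hα hħ hgc fun m hm => (hgs m hm).2
  have hone : ((-1 : ℂ) ^ l) ^ 2 = 1 := by rw [← pow_mul, mul_comm, pow_mul]; simp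
  have hor := (isPreconnected_massRange (ξ := ξ) hα hħ).eq_or_eq_neg_of_sq_eq hgc
    (g := fun _ => (-1 : ℂ) ^ l) continuousOn_const
    (fun m hm => by simp only [Pi.pow_apply]; rw [hsq m hm, hone])
    (fun _ => pow_ne_zero _ (by norm_num))
  rcases hor with h | h
  · rw [(hgs m hm).1, h hm.1]
  · exfalso
    obtain ⟨f, hf, hlim⟩ := hW.large_mass 0
    -- With the wrong sign the difference in postulate IV has norm 1 + f R with f and R = |R_l(0)|
    -- positive, so it cannot drop below 1.
    have h1 := (hlim u).eventually_lt_const one_pos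
    obtain ⟨m', hm', h2⟩ := ((eventually_admissible (ξ := ξ) hα hħ).and h1).exists
    obtain ⟨c, hc, hRm⟩ := modeRadial_zero hα (one_sub_massSq_lt hm'.1) l
    have hfield : field α (ν m') u 0 = R m' • b := by
      rw [field_eq hα (one_sub_massSq_lt hm'.1) (radial_eq_modeRadial hα hm' (hν m' hm')),
        expand_modeVec, sphereMultiplier_Y (modeRadial_bounded_at hα (one_sub_massSq_lt hm'.1) 0)]
      rfl
    have hgm := h hm'.1
    simp only [Pi.neg_apply] at hgm
    rw [(hgs m' hm').1, hfield, hgm, smul_smul, ← sub_smul, norm_smul, norm_Y, mul_one] at h2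
    have h3 : -(-1 : ℂ) ^ l - (f m' : ℂ) * R m' = -(-1) ^ l * ((1 + f m' * c : ℝ) : ℂ) := by
      change -(-1 : ℂ) ^ l - (f m' : ℂ) * modeRadial α (1 - massSq α ħ ξ m') l 0 = _
      rw [hRm]; push_cast; ring
    have hfc : 0 < f m' * c := mul_pos (hf m') hc
    rw [h3, norm_mul, Complex.norm_real, Real.norm_of_nonneg (by linarith)] at h2
    simp at h2
    linarith

theorem postulates_determine_phases (hα : 0 < α) (hħ : 0 < ħ)
    (hν : ∀ m ∈ admissibleMass α ħ ξ, IsDegree (massSq α ħ ξ m) (ν m))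
    (hW : LocalizationPostulates α ħ ξ ν W) {m : ℝ} (hm : m ∈ admissibleMass α ħ ξ) :
    ∃ s : ℕ → ℝ → ℂ, (∀ (p : Idx) (t : ℝ), W m t (modeVec p) = s p.1.1 t • Y p) ∧
      (∀ l t, ‖s l t‖ = 1 ∧ s l (-t) = conj (s l t)) ∧ ∀ l, s l 0 = (-1) ^ l := by
  obtain ⟨s, hs, hs'⟩ := exists_phase hα hν hW hm
  refine ⟨s, hs, hs', fun l => ?_⟩
  have h := phase_at_zero hα hħ hν hW hm l
  rw [hs] at h
  exact smul_left_injective ℂ (norm_ne_zero_iff.1 (by rw [norm_Y]; exact one_ne_zero)) h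

theorem unique_at_zero (hα : 0 < α) (hħ : 0 < ħ)
    (hν : ∀ m ∈ admissibleMass α ħ ξ, IsDegree (massSq α ħ ξ m) (ν m))
    {W' : ℝ → ℝ → (OneParticle ≃ₗᵢ[ℂ] L2Sphere)}
    (hW : LocalizationPostulates α ħ ξ ν W) (hW' : LocalizationPostulates α ħ ξ ν W')
    {m : ℝ} (hm : m ∈ admissibleMass α ħ ξ) : W m 0 = W' m 0 := by
  obtain ⟨s, hs, -, h0⟩ := postulates_determine_phases hα hħ hν hW hm
  obtain ⟨s', hs', -, h0'⟩ := postulates_determine_phases hα hħ hν hW' hm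
  refine linearIsometryEquiv_ext_modeVec fun p => ?_
  rw [hs, hs', h0, h0']

end Uniqueness

/-! ### The explicit family and its postulates -/

/-- Dominated convergence in ℓ² with majorant (2B)²|φ_p|². It serves both continuity in the mass and
the large mass limit. -/
theorem tendsto_multiplier {ι : Type*} {F : Filter ι} {c : ι → ℕ → ℂ} {c₀ : ℕ → ℂ} {B : ℝ}
    (hB : ∀ᶠ i in F, ∀ l, ‖c i l‖ ≤ B) (hB₀ : ∀ l, ‖c₀ l‖ ≤ B)
    (h : ∀ l, Tendsto (fun i => c i l) F (𝓝 (c₀ l))) (φ : OneParticle) :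
    Tendsto (fun i => multiplier (c i) φ) F (𝓝 (multiplier c₀ φ)) := by
  have hnorm : ∀ ψ : OneParticle, ‖ψ‖ ^ 2 = ∑' p, ‖ψ p‖ ^ 2 := fun ψ => by
    have := lp.norm_rpow_eq_tsum (p := 2) (by norm_num) ψ
    simpa using this
  have hφ : Summable fun p => ‖φ p‖ ^ 2 := by
    have := (lp.memℓp φ).summable (by norm_num)
    simpa using this
  have hsq : Tendsto (fun i => ‖multiplier (c i) φ - multiplier c₀ φ‖ ^ 2) F (𝓝 0) := by
    simp only [hnorm]
    have h0 : (∑' _ : Idx, (0 : ℝ)) = 0 := tsum_zero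
    rw [← h0]
    refine tendsto_tsum_of_dominated_convergence (bound := fun p => (2 * B) ^ 2 * ‖φ p‖ ^ 2)
      (hφ.mul_left _) ?_ ?_
    · intro p
      have h1 : Tendsto (fun i => ‖(c i p.1.1 - c₀ p.1.1) * φ p‖ ^ 2) F
          (𝓝 (‖(c₀ p.1.1 - c₀ p.1.1) * φ p‖ ^ 2)) :=
        ((((h p.1.1).sub_const _).mul_const _).norm).pow 2
      rw [sub_self, zero_mul, norm_zero, zero_pow two_ne_zero] at h1
      refine h1.congr' ?_
      filter_upwards [hB] with i hi
      rw [lp.coeFn_sub, Pi.sub_apply, multiplier_apply ⟨B, hi⟩, multiplier_apply ⟨B, hB₀⟩, sub_mul]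
    · filter_upwards [hB] with i hi p
      rw [lp.coeFn_sub, Pi.sub_apply, multiplier_apply ⟨B, hi⟩, multiplier_apply ⟨B, hB₀⟩, ← sub_mul,
        norm_mul, mul_pow, Real.norm_eq_abs, abs_of_nonneg (by positivity)]
      gcongr
      calc ‖c i p.1.1 - c₀ p.1.1‖ ≤ ‖c i p.1.1‖ + ‖c₀ p.1.1‖ := norm_sub_le _ _
        _ ≤ 2 * B := by linarith [hi p.1.1, hB₀ p.1.1]
  rw [tendsto_iff_norm_sub_tendsto_zero]
  have := hsq.sqrt
  simpa [Real.sqrt_sq (norm_nonneg _)] using this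

/-- The phase of the positive-energy mode. -/
def modePhase (α y : ℝ) (l : ℕ) (t : ℝ) : ℂ :=
  Complex.exp (Complex.arg (modeRadial α y l t) * Complex.I)

theorem norm_modePhase (α y : ℝ) (l : ℕ) (t : ℝ) : ‖modePhase α y l t‖ = 1 :=
  Complex.norm_exp_ofReal_mul_I _

theorem norm_mul_modePhase (α y : ℝ) (l : ℕ) (t : ℝ) :
    (‖modeRadial α y l t‖ : ℂ) * modePhase α y l t = modeRadial α y l t :=
  Complex.norm_mul_exp_arg_mul_I _

theorem modePhase_eq_div {α y : ℝ} (hα : 0 < α) (hy : y < 1) (l : ℕ) (t : ℝ) :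
    modePhase α y l t = modeRadial α y l t / (‖modeRadial α y l t‖ : ℂ) := by
  have : (‖modeRadial α y l t‖ : ℂ) ≠ 0 := by
    exact_mod_cast norm_ne_zero_iff.2 (modeRadial_ne_zero hα hy l t)
  rw [eq_div_iff this, mul_comm, norm_mul_modePhase]

theorem conj_modePhase_mul (α y : ℝ) (l : ℕ) (t : ℝ) :
    conj (modePhase α y l t) * modeRadial α y l t = (‖modeRadial α y l t‖ : ℂ) := by
  rw [← norm_mul_modePhase α y l t]
  have : conj (modePhase α y l t) * modePhase α y l t = 1 := by
    rw [← Complex.normSq_eq_conj_mul_self, Complex.normSq_eq_norm_sq, norm_modePhase]; simp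
  rw [mul_left_comm, this, norm_mul, norm_modePhase]
  simp

theorem conj_modePhase_neg {α y : ℝ} (hα : 0 < α) (hy : y < 1) (l : ℕ) (t : ℝ) :
    conj (modePhase α y l (-t)) = modePhase α y l t := by
  have h := conj_modeRadial_neg α y l t
  rw [modePhase_eq_div hα hy, modePhase_eq_div hα hy, map_div₀, Complex.conj_ofReal, h, ← h,
    Complex.norm_conj]

/-- The argument itself jumps on the negative axis; the quotient R/|R| does not. -/
theorem continuousOn_modePhase {α : ℝ} (hα : 0 < α) (l : ℕ) (t : ℝ) :
    ContinuousOn (fun y => modePhase α y l t) (Set.Iio 1) := by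
  have h := continuousOn_modeRadial α l t
  refine (h.div (Complex.continuous_ofReal.comp_continuousOn h.norm) fun y hy => ?_).congr
    fun y hy => modePhase_eq_div hα hy l t
  simp only [Function.comp_apply]
  exact_mod_cast norm_ne_zero_iff.2 (modeRadial_ne_zero hα hy l t)

/-- The localization unitary: the expansion in spherical harmonics, with the phases of the modes. -/
def localization (α y t : ℝ) : OneParticle ≃ₗᵢ[ℂ] L2Sphere :=
  (phaseEquiv (fun l => modePhase α y l t) fun l => norm_modePhase α y l t).trans expand

theorem modePhase_bounded (α y t : ℝ) : ∃ B, ∀ l, ‖modePhase α y l t‖ ≤ B :=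
  ⟨1, fun l => (norm_modePhase α y l t).le⟩

theorem localization_apply (α y t : ℝ) (φ : OneParticle) :
    localization α y t φ = sphereMultiplier (fun l => modePhase α y l t) (expand φ) := by
  rw [sphereMultiplier_expand]; rfl

theorem inner_Y_localization (α y t : ℝ) (φ : OneParticle) (p : Idx) :
    inner ℂ (Y p) (localization α y t φ) = modePhase α y p.1.1 t * φ p := by
  rw [localization_apply, inner_Y_sphereMultiplier (modePhase_bounded α y t), inner_Y_expand]

theorem localization_modeVec (α y t : ℝ) (p : Idx) :
    localization α y t (modeVec p) = modePhase α y p.1.1 t • Y p := by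
  rw [localization_apply, expand_modeVec, sphereMultiplier_Y (modePhase_bounded α y t)]

theorem localization_symm_apply (α y t : ℝ) (h : L2Sphere) (p : Idx) :
    (localization α y t).symm h p = conj (modePhase α y p.1.1 t) * inner ℂ (Y p) h := by
  have : (localization α y t).symm h = (phaseEquiv (fun l => modePhase α y l t)
    fun l => norm_modePhase α y l t).symm (expand.symm h) := rfl
  rw [this, phaseEquiv_symm_apply, expand_symm_apply]

theorem localization_sphereAct (α y t : ℝ) (g : Space ≃ₗᵢ[ℝ] Space) (φ : OneParticle) :
    localization α y t (expand.symm (sphereAct g (expand φ))) =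
      sphereAct g (localization α y t φ) := by
  rw [localization_apply, localization_apply, LinearIsometryEquiv.apply_symm_apply,
    sphereMultiplier_sphereAct (modePhase_bounded α y t)]

theorem localization_star {α y : ℝ} (hα : 0 < α) (hy : y < 1) (t : ℝ) (φ : OneParticle) :
    localization α y t (expand.symm (star (expand φ))) = star (localization α y (-t) φ) := by
  rw [localization_apply, localization_apply, LinearIsometryEquiv.apply_symm_apply,
    sphereMultiplier_star (modePhase_bounded α y (-t))]
  simp only [conj_modePhase_neg hα hy]

theorem field_localization_symm {α y : ℝ} {ν : ℂ} (hα : 0 < α) (hy : y < 1)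
    (hr : ∀ l t, radial α ν l t = modeRadial α y l t) (t t' : ℝ) (h : L2Sphere) :
    field α ν ((localization α y t).symm h) t' =
      sphereMultiplier (fun l => conj (modePhase α y l t) * modeRadial α y l t') h := by
  obtain ⟨B, hB⟩ := modeRadial_bounded_at hα hy t'
  refine L2_ext fun p => ?_
  rw [inner_Y_field hα hy hr, inner_Y_sphereMultiplier, localization_symm_apply]
  · ring
  · exact ⟨B, fun l => by rw [norm_mul, Complex.norm_conj, norm_modePhase, one_mul]; exact hB l⟩

theorem continuousOn_sphereMultiplier {α : ℝ} (hα : 0 < α) (t t' : ℝ) (h : L2Sphere) :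
    ContinuousOn (fun y => sphereMultiplier
      (fun l => conj (modePhase α y l t) * modeRadial α y l t') h) (Set.Iio 1) := by
  intro y hy
  obtain ⟨φ, rfl⟩ := expand.surjective h
  simp only [sphereMultiplier_expand]
  refine ContinuousAt.continuousWithinAt ?_
  refine (expand.continuous.tendsto _).comp ?_
  obtain ⟨B, hB⟩ := modeRadial_bounded hα hy t'
  have hB' : ∀ᶠ y in 𝓝 y, ∀ l, ‖conj (modePhase α y l t) * modeRadial α y l t'‖ ≤ B := by
    filter_upwards [hB] with y' h l
    rw [norm_mul, Complex.norm_conj, norm_modePhase, one_mul]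
    exact h l
  refine tendsto_multiplier hB' hB'.self_of_nhds (fun l => ?_) φ
  have h1 : ContinuousAt (fun y => modePhase α y l t) y :=
    (continuousOn_modePhase hα l t).continuousAt (Iio_mem_nhds hy)
  have h2 : ContinuousAt (fun y => modeRadial α y l t') y :=
    (continuousOn_modeRadial α l t').continuousAt (Iio_mem_nhds hy)
  exact ((Complex.continuous_conj.continuousAt.comp h1).mul h2)

theorem norm_modeRadial_div_sq {α y : ℝ} (hα : 0 < α) (hy : y < 1) (l : ℕ) (t : ℝ) :
    (‖modeRadial α y l t‖ / ‖modeRadial α y 0 t‖) ^ 2 = modeSq y l (t / α) / modeSq y 0 (t / α) := by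
  have := Real.cosh_pos (t / α)
  have h0 := (modeSq_pos hy 0 (t / α)).ne'
  rw [div_pow, norm_modeRadial_sq hα hy, norm_modeRadial_sq hα hy]
  field_simp

/-- With f = 1/|R_0(t)|, the difference in postulate IV is the multiplier with entries of modulus |1
- |R_l|/|R_0||, which tends to 0 for each l and is bounded uniformly in l. -/
theorem localization_large_mass {α ħ ξ : ℝ} {ν : ℝ → ℂ} (hα : 0 < α) (hħ : 0 < ħ)
    (hν : ∀ m ∈ admissibleMass α ħ ξ, IsDegree (massSq α ħ ξ m) (ν m)) (t : ℝ) :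
    ∃ f : ℝ → ℝ, (∀ m, 0 < f m) ∧ ∀ φ : OneParticle,
      Tendsto (fun m => ‖localization α (1 - massSq α ħ ξ m) t φ -
        (f m : ℂ) • field α (ν m) φ t‖) atTop (𝓝 0) := by
  classical
  set y : ℝ → ℝ := fun m => 1 - massSq α ħ ξ m
  -- The value 1 at other masses only keeps f positive everywhere and does not affect the limit.
  refine ⟨fun m => if m ∈ admissibleMass α ħ ξ then ‖modeRadial α (y m) 0 t‖⁻¹ else 1,
    fun m => ?_, fun φ => ?_⟩
  · dsimp only
    split_ifs with hm
    · exact inv_pos.2 (norm_pos_iff.2 (modeRadial_ne_zero hα (one_sub_massSq_lt hm.1) 0 t))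
    · exact one_pos
  set κ : ℝ → ℝ := fun m => Real.sqrt (massSq α ħ ξ m - 1)
  have hκ : Tendsto κ atTop atTop :=
    Real.tendsto_sqrt_atTop.comp (tendsto_atTop_add_const_right _ _ (tendsto_massSq hα hħ))
  have hyκ : ∀ᶠ m in atTop, y m = -κ m ^ 2 ∧ 1 ≤ κ m := by
    filter_upwards [hκ.eventually_ge_atTop 1] with m hm
    refine ⟨?_, hm⟩
    have : 0 ≤ massSq α ħ ξ m - 1 := by
      by_contra h
      have : κ m = 0 := Real.sqrt_eq_zero_of_nonpos (not_le.1 h).le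
      linarith
    simp only [y, κ, Real.sq_sqrt this]
    ring
  set c : ℝ → ℕ → ℂ := fun m l => modePhase α (y m) l t *
    (1 - ((‖modeRadial α (y m) l t‖ / ‖modeRadial α (y m) 0 t‖ : ℝ) : ℂ))
  set B : ℝ := 1 + Real.sqrt (8 * Real.cosh (t / α) ^ 2)
  have hcB : ∀ᶠ m in atTop, ∀ l, ‖c m l‖ ≤ B := by
    filter_upwards [hyκ] with m hm l
    have hy1 : y m < 1 := by rw [hm.1]; nlinarith [hm.2]
    rw [norm_mul, norm_modePhase, one_mul]
    refine (norm_sub_le _ _).trans ?_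
    rw [norm_one, Complex.norm_real, Real.norm_of_nonneg (by positivity)]
    refine add_le_add le_rfl ?_
    apply Real.le_sqrt_of_sq_le
    rw [norm_modeRadial_div_sq hα hy1, hm.1]
    exact modeSq_div_le hm.2 l _
  have hclim : ∀ l, Tendsto (fun m => c m l) atTop (𝓝 ((fun _ => 0) l)) := by
    intro l
    rw [tendsto_zero_iff_norm_tendsto_zero]
    have h1 := (((tendsto_modeSq_div l (t / α)).comp hκ).sqrt.const_sub 1).abs
    rw [Real.sqrt_one, sub_self, abs_zero] at h1
    refine h1.congr' ?_
    filter_upwards [hyκ] with m hm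
    have hy1 : y m < 1 := by rw [hm.1]; nlinarith [hm.2]
    simp only [c, Function.comp_apply]
    rw [norm_mul, norm_modePhase, one_mul, ← hm.1, ← norm_modeRadial_div_sq hα hy1,
      Real.sqrt_sq (by positivity), ← Complex.ofReal_one, ← Complex.ofReal_sub, Complex.norm_real,
      Real.norm_eq_abs]
  have hB0 : ∀ l : ℕ, ‖(fun _ => 0 : ℕ → ℂ) l‖ ≤ B := fun l => by simp; positivity
  have hlim := (tendsto_multiplier hcB hB0 hclim φ).norm
  have hzero : multiplier (fun _ => 0) φ = 0 := by
    ext p; rw [multiplier_apply ⟨B, hB0⟩]; simp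
  rw [hzero, norm_zero] at hlim
  refine hlim.congr' ?_
  filter_upwards [hcB, eventually_admissible (ξ := ξ) hα hħ] with m hm hadm
  rw [if_pos hadm, ← expand.norm_map]
  congr 1
  have hy1 := one_sub_massSq_lt hadm.1
  refine L2_ext fun p => ?_
  rw [inner_Y_expand, multiplier_apply ⟨B, hm⟩, inner_sub_right, inner_smul_right,
    inner_Y_localization, inner_Y_field hα hy1 (radial_eq_modeRadial hα hadm (hν m hadm))]
  simp only [c, y]
  push_cast
  linear_combination (-(φ p / (‖modeRadial α (1 - massSq α ħ ξ m) 0 t‖ : ℂ))) *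
    norm_mul_modePhase α (1 - massSq α ħ ξ m) p.1.1 t

theorem localizationPostulates_localization {α ħ ξ : ℝ} {ν : ℝ → ℂ} (hα : 0 < α) (hħ : 0 < ħ)
    (hν : ∀ m ∈ admissibleMass α ħ ξ, IsDegree (massSq α ħ ξ m) (ν m)) :
    LocalizationPostulates α ħ ξ ν fun m t => localization α (1 - massSq α ħ ξ m) t where
  mass_continuity t h t' := by
    refine ⟨fun m => sphereMultiplier (fun l => conj (modePhase α (1 - massSq α ħ ξ m) l t) *
      modeRadial α (1 - massSq α ħ ξ m) l t') h, ?_, fun m hm => ?_⟩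
    · exact (continuousOn_sphereMultiplier hα t t' h).comp
        (continuous_const.sub continuous_massSq).continuousOn fun m hm => one_sub_massSq_lt hm
    · exact (field_localization_symm hα (one_sub_massSq_lt hm.1)
        (radial_eq_modeRadial hα hm (hν m hm)) t t' h).symm
  rotation m hm i θ φ ψ h t := by
    rw [eq_of_forall_field_sphereAct hα (one_sub_massSq_lt hm.1)
      (radial_eq_modeRadial hα hm (hν m hm)) h, localization_sphereAct]
  parity m hm i φ ψ h t := by
    rw [eq_of_forall_field_sphereAct hα (one_sub_massSq_lt hm.1)
      (radial_eq_modeRadial hα hm (hν m hm)) h, localization_sphereAct]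
  time_reversal m hm φ ψ h t := by
    rw [eq_of_forall_field_star hα (one_sub_massSq_lt hm.1)
      (radial_eq_modeRadial hα hm (hν m hm)) h, localization_star hα (one_sub_massSq_lt hm.1)]
  large_mass := localization_large_mass hα hħ hν

/-! ### A continuous phase of the modes -/

section Phase

variable {α y : ℝ}

/-- The rate of change of the phase of the positive-energy mode. -/
def phaseRate (α y : ℝ) (l : ℕ) (t : ℝ) : ℝ := 1 / (2 * scale α t ^ 2 * ‖modeRadial α y l t‖ ^ 2)

theorem scale_pos (hα : 0 < α) (t : ℝ) : 0 < scale α t := mul_pos hα (Real.cosh_pos _)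

theorem continuous_modeRadial (hα : 0 < α) (hy : y < 1) (l : ℕ) :
    Continuous (modeRadial α y l) :=
  continuous_iff_continuousAt.2 fun t => (hasDerivAt_modeRadial hα hy l t).choose_spec.1.continuousAt

theorem continuous_phaseRate (hα : 0 < α) (hy : y < 1) (l : ℕ) : Continuous (phaseRate α y l) := by
  have h1 := continuous_modeRadial hα hy l
  have h2 : Continuous (scale α) := by
    unfold scale
    exact continuous_const.mul (Real.continuous_cosh.comp (continuous_id.div_const α))
  refine continuous_const.div (by fun_prop) fun t => ?_
  have := scale_pos hα t
  have := norm_pos_iff.2 (modeRadial_ne_zero hα hy l t)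
  positivity

/-- The phase `ζ` of the mode, continuous in time. -/
def modeAngle (α y : ℝ) (l : ℕ) (t : ℝ) : ℝ :=
  -Complex.arg (modeRadial α y l 0) + ∫ s in (0 : ℝ)..t, phaseRate α y l s

theorem hasDerivAt_modeAngle (hα : 0 < α) (hy : y < 1) (l : ℕ) (t : ℝ) :
    HasDerivAt (modeAngle α y l) (phaseRate α y l t) t :=
  (((continuous_phaseRate hα hy l).integral_hasStrictDerivAt 0 t).hasDerivAt).const_add _

/-- The square of the phase is R/conj R, whose logarithmic derivative is -2i times `phaseRate` by
the Wronskian. Thus (phase · e^{iζ})² is constant, equal to 1 by the choice of ζ(0), and continuity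
removes the sign ambiguity left by squaring. -/
theorem exp_modeAngle (hα : 0 < α) (hy : y < 1) (l : ℕ) (t : ℝ) :
    Complex.exp (-Complex.I * (modeAngle α y l t : ℂ)) = modePhase α y l t := by
  have hR0 := modeRadial_ne_zero hα hy l
  have hRc0 : ∀ t, conj (modeRadial α y l t) ≠ 0 := fun t => by simpa using hR0 t
  set E : ℝ → ℂ := fun t => Complex.exp (Complex.I * (modeAngle α y l t : ℂ))
  have hE : ∀ t, HasDerivAt E (E t * (Complex.I * (phaseRate α y l t : ℂ))) t := fun t =>
    (((hasDerivAt_modeAngle hα hy l t).ofReal_comp).const_mul Complex.I).cexp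
  have hphase : ∀ t, modePhase α y l t ^ 2 = modeRadial α y l t / conj (modeRadial α y l t) := by
    intro t
    have hn : (‖modeRadial α y l t‖ : ℂ) ≠ 0 := by exact_mod_cast norm_ne_zero_iff.2 (hR0 t)
    have hmul : modeRadial α y l t * conj (modeRadial α y l t) =
        (‖modeRadial α y l t‖ : ℂ) ^ 2 := Complex.mul_conj' _
    rw [modePhase_eq_div hα hy, div_pow, ← hmul]
    have := hR0 t
    have := hRc0 t
    field_simp
  have hderiv : ∀ t, HasDerivAt (fun t =>
      modeRadial α y l t / conj (modeRadial α y l t) * E t ^ 2) 0 t := by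
    intro t
    obtain ⟨R', hR, hW⟩ := hasDerivAt_modeRadial hα hy l t
    refine (((hR.div hR.star (hRc0 t)).mul ((hE t).pow 2))).congr_deriv ?_
    have hmul : modeRadial α y l t * conj (modeRadial α y l t) =
        (‖modeRadial α y l t‖ : ℂ) ^ 2 := Complex.mul_conj' _
    have hrate : 2 * (scale α t : ℂ) ^ 2 * (modeRadial α y l t * conj (modeRadial α y l t)) *
        (phaseRate α y l t : ℂ) = 1 := by
      have h1 : (2 * scale α t ^ 2 * ‖modeRadial α y l t‖ ^ 2) * phaseRate α y l t = 1 := by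
        have := scale_pos hα t
        have := norm_pos_iff.2 (hR0 t)
        rw [phaseRate]; field_simp
      rw [hmul]
      exact_mod_cast congrArg (fun x : ℝ => (x : ℂ)) h1
    have hs0 : (scale α t : ℂ) ≠ 0 := by exact_mod_cast (scale_pos hα t).ne'
    have h0 := hR0 t
    have h1 := hRc0 t
    simp only [Complex.star_def, Pi.div_apply, Pi.pow_apply]
    set R := modeRadial α y l t
    set Rc := conj R
    have h2 : R' * Rc - R * conj R' = -2 * Complex.I * (R * Rc) * (phaseRate α y l t : ℂ) := by
      have h3 : (scale α t : ℂ) ^ 2 ≠ 0 := pow_ne_zero 2 hs0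
      apply mul_left_cancel₀ (mul_ne_zero Complex.I_ne_zero h3)
      linear_combination hW - hrate + (2 * (scale α t : ℂ) ^ 2 * (R * Rc) *
        (phaseRate α y l t : ℂ)) * Complex.I_sq
    rw [h2]
    field_simp
    push_cast
    ring
  have hconst := is_const_of_deriv_eq_zero (fun t => (hderiv t).differentiableAt)
    (fun t => (hderiv t).deriv)
  have hzero : modePhase α y l 0 * E 0 = 1 := by
    simp only [E, modePhase, modeAngle, intervalIntegral.integral_same, add_zero]
    rw [← Complex.exp_add, ← Complex.exp_zero]
    congr 1
    push_cast
    ring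
  have hcont : Continuous fun t => modePhase α y l t * E t := by
    have h1 := continuous_modeRadial hα hy l
    have h2 : Continuous fun t => modePhase α y l t := by
      have : (fun t => modePhase α y l t) =
          fun t => modeRadial α y l t / (‖modeRadial α y l t‖ : ℂ) :=
        funext fun t => modePhase_eq_div hα hy l t
      rw [this]
      exact h1.div (Complex.continuous_ofReal.comp h1.norm) fun t => by
        exact_mod_cast norm_ne_zero_iff.2 (hR0 t)
    exact h2.mul (continuous_iff_continuousAt.2 fun t => (hE t).continuousAt)
  have hone : Set.EqOn (fun t => modePhase α y l t * E t) (fun _ => 1) Set.univ := by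
    refine isPreconnected_univ.eq_of_sq_eq hcont.continuousOn continuousOn_const ?_
      (fun _ => one_ne_zero) (Set.mem_univ 0) hzero
    intro t _
    simp only [Pi.pow_apply]
    have := hconst t 0
    rw [mul_pow, hphase, this, ← hphase, ← mul_pow, hzero]
  have h := hone (Set.mem_univ t)
  simp only [E] at h
  rw [neg_mul, Complex.exp_neg]
  exact (eq_inv_of_mul_eq_one_left h).symm

theorem modeAngle_eq_neg_arg (hα : 0 < α) (hy : y < 1) (l : ℕ) (t : ℝ) :
    (modeAngle α y l t : Real.Angle) =
      -((Complex.arg (modeRadial α y l t) : ℝ) : Real.Angle) := by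
  have h := exp_modeAngle hα hy l t
  rw [modePhase, Complex.exp_eq_exp_iff_exists_int] at h
  obtain ⟨n, hn⟩ := h
  rw [← Real.Angle.coe_neg, Real.Angle.angle_eq_iff_two_pi_dvd_sub]
  refine ⟨-n, ?_⟩
  have h2 : Complex.I * ((modeAngle α y l t - -Complex.arg (modeRadial α y l t) : ℝ) : ℂ) =
      Complex.I * ((2 * Real.pi * ((-n : ℤ) : ℝ) : ℝ) : ℂ) := by
    push_cast
    linear_combination -hn
  exact_mod_cast mul_left_cancel₀ Complex.I_ne_zero h2

end Phase

/-! ### The frequencies, and the series for the localization map -/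

section Omega

variable {α y : ℝ} {ν : ℂ}

/-- This is why the weight √(2aω) in the definition of W_t turns each time factor into a pure phase.
-/
theorem two_mul_scale_mul_omegaDS (hα : 0 < α) (h : (ν + 1 / 2) ^ 2 = y) (hy : y < 1) (hy0 : y ≠ 0)
    (l : ℕ) (t : ℝ) : 2 * scale α t * omegaDS α ν l t = 1 / ‖modeRadial α y l t‖ ^ 2 := by
  rw [omegaDS_eq α h hy hy0, norm_modeRadial_sq hα hy, scale, one_div_div]
  ring

theorem sqrt_two_mul_scale_mul_omegaDS (hα : 0 < α) (h : (ν + 1 / 2) ^ 2 = y) (hy : y < 1)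
    (hy0 : y ≠ 0) (l : ℕ) (t : ℝ) :
    Real.sqrt (2 * scale α t * omegaDS α ν l t) = ‖modeRadial α y l t‖⁻¹ := by
  rw [two_mul_scale_mul_omegaDS hα h hy hy0, one_div, Real.sqrt_inv, Real.sqrt_sq (norm_nonneg _)]

theorem omegaDS_div_scale (hα : 0 < α) (h : (ν + 1 / 2) ^ 2 = y) (hy : y < 1) (hy0 : y ≠ 0)
    (l : ℕ) (t : ℝ) : omegaDS α ν l t / scale α t = phaseRate α y l t := by
  have h1 := two_mul_scale_mul_omegaDS hα h hy hy0 l t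
  have h2 := (scale_pos hα t).ne'
  have h3 := norm_ne_zero_iff.2 (modeRadial_ne_zero hα hy l t)
  rw [phaseRate, div_eq_div_iff h2 (by positivity)]
  field_simp at h1
  linear_combination scale α t * h1

theorem arg_timeFactor (hα : 0 < α) (h : (ν + 1 / 2) ^ 2 = y) (hy : y < 1) (hy0 : y ≠ 0)
    (hre : -(1 / 2) ≤ ν.re) (l : ℕ) (t : ℝ) :
    Complex.arg (timeFactor α ν l t) = Complex.arg (modeRadial α y l t) := by
  have hg := gammaAbs_pos h hy hy0 l
  rw [← radial_eq hα h hy hy0 hre, radial, Complex.arg_real_mul _ (Real.sqrt_pos.2 (by positivity))]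

theorem hasSum_localization (hα : 0 < α) (h : (ν + 1 / 2) ^ 2 = y) (hy : y < 1) (hy0 : y ≠ 0)
    (hre : -(1 / 2) ≤ ν.re) (t : ℝ) (φ : OneParticle) :
    HasSum (fun p : Idx => ((Real.sqrt (2 * scale α t * omegaDS α ν p.1.1 t) : ℂ) * φ p *
      radial α ν p.1.1 t) • Y p) (localization α y t φ) := by
  rw [localization_apply]
  refine (hasSum_congr_terms fun p => ?_).1
    (hasSum_sphereMultiplier_expand (modePhase_bounded α y t) φ)
  rw [radial_eq hα h hy hy0 hre, sqrt_two_mul_scale_mul_omegaDS hα h hy hy0,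
    modePhase_eq_div hα hy]
  congr 1
  push_cast
  ring

end Omega

/-! ### Double series and the position operators -/

section Banded

variable {ι κ E : Type*} [NormedAddCommGroup E] [InnerProductSpace ℂ E]

theorem norm_sum_sq_le_of_card_le {N : ℕ} (s : Finset κ) (a : κ → ℂ)
    (hN : (s.filter fun x => a x ≠ 0).card ≤ N) :
    ‖∑ x ∈ s, a x‖ ^ 2 ≤ N * ∑ x ∈ s, ‖a x‖ ^ 2 := by
  classical
  rw [← Finset.sum_filter_ne_zero]
  have h1 : ‖∑ x ∈ s.filter (fun x => a x ≠ 0), a x‖ ^ 2 ≤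
      (∑ x ∈ s.filter (fun x => a x ≠ 0), ‖a x‖) ^ 2 := by
    gcongr; exact norm_sum_le _ _
  refine h1.trans (sq_sum_le_card_mul_sum_sq.trans ?_)
  have h2 : ∑ x ∈ s.filter (fun x => a x ≠ 0), ‖a x‖ ^ 2 ≤ ∑ x ∈ s, ‖a x‖ ^ 2 :=
    Finset.sum_le_sum_of_subset_of_nonneg (Finset.filter_subset _ _) fun _ _ _ => by positivity
  gcongr

/-- A double series along an orthonormal family with square-summable coefficients converges, if
every row has at most `N` nonzero entries. -/
theorem summable_smul_of_banded [CompleteSpace E] {v : ι → E} (hv : Orthonormal ℂ v) {N : ℕ}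
    {a : ι × κ → ℂ}
    (hN : ∀ (i : ι) (s : Finset (ι × κ)), (∀ x ∈ s, x.1 = i ∧ a x ≠ 0) → s.card ≤ N)
    (ha : Summable fun x => ‖a x‖ ^ 2) : Summable fun x => a x • v x.1 := by
  classical
  -- Group a finite sum by rows: different rows are orthogonal, and within a row Cauchy–Schwarz over
  -- at most N nonzero entries costs a factor N. The Cauchy criterion for the squared coefficients
  -- then transfers to the vectors.
  have key : ∀ t : Finset (ι × κ), ‖∑ x ∈ t, a x • v x.1‖ ^ 2 ≤ N * ∑ x ∈ t, ‖a x‖ ^ 2 := by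
    intro t
    have hmaps : ∀ x ∈ t, x.1 ∈ t.image Prod.fst := fun x hx => Finset.mem_image_of_mem _ hx
    rw [← Finset.sum_fiberwise_of_maps_to hmaps, ← Finset.sum_fiberwise_of_maps_to hmaps]
    have h1 : ∀ i ∈ t.image Prod.fst, ∑ x ∈ t with x.1 = i, a x • v x.1 =
        (∑ x ∈ t with x.1 = i, a x) • v i := fun i _ => by
      rw [Finset.sum_smul]
      exact Finset.sum_congr rfl fun x hx => by rw [(Finset.mem_filter.1 hx).2]
    rw [Finset.sum_congr rfl h1]
    have h2 : ‖∑ i ∈ t.image Prod.fst, (∑ x ∈ t with x.1 = i, a x) • v i‖ ^ 2 =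
        ∑ i ∈ t.image Prod.fst, ‖∑ x ∈ t with x.1 = i, a x‖ ^ 2 := by
      have h4 : ∀ z : ℂ, conj z * z = ((‖z‖ ^ 2 : ℝ) : ℂ) := fun z => by
        rw [← Complex.normSq_eq_conj_mul_self, Complex.normSq_eq_norm_sq]
      rw [← inner_self_eq_norm_sq (𝕜 := ℂ), hv.inner_sum]
      simp only [h4]
      rw [← Complex.ofReal_sum]
      exact Complex.ofReal_re _
    rw [h2, Finset.mul_sum]
    refine Finset.sum_le_sum fun i _ => norm_sum_sq_le_of_card_le _ _ ?_
    refine hN i _ fun x hx => ?_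
    simp only [Finset.mem_filter] at hx
    exact ⟨hx.1.2, hx.2⟩
  rw [summable_iff_vanishing_norm]
  intro ε hε
  obtain ⟨s, hs⟩ := summable_iff_vanishing_norm.1 ha (ε ^ 2 / (N + 1)) (by positivity)
  refine ⟨s, fun t ht => ?_⟩
  have h1 := hs t ht
  rw [Real.norm_of_nonneg (Finset.sum_nonneg fun _ _ => by positivity),
    lt_div_iff₀ (by positivity)] at h1
  have h2 := key t
  have h3 : 0 ≤ ∑ x ∈ t, ‖a x‖ ^ 2 := Finset.sum_nonneg fun _ _ => by positivity
  refine lt_of_pow_lt_pow_left₀ 2 hε.le (h2.trans_lt ?_)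
  linarith

end Banded

theorem summable_norm_sq (φ : OneParticle) : Summable fun p => ‖φ p‖ ^ 2 := by
  have := (lp.memℓp φ).summable (by norm_num)
  simpa using this

theorem norm_sq_eq_tsum (φ : OneParticle) : ‖φ‖ ^ 2 = ∑' p, ‖φ p‖ ^ 2 := by
  have := lp.norm_rpow_eq_tsum (p := 2) (by norm_num) φ
  simpa using this

theorem hasSum_norm_inner_Y_sq (f : L2Sphere) :
    HasSum (fun p => ‖inner ℂ (Y p) f‖ ^ 2) (‖f‖ ^ 2) := by
  have h := (summable_norm_sq (expand.symm f)).hasSum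
  rw [← norm_sq_eq_tsum, LinearIsometryEquiv.norm_map] at h
  simpa only [expand_symm_apply] using h

/-- The expansion of `r̂_j h` in spherical harmonics, as a double series. -/
theorem hasSum_coordMul (j : Fin 3) {c : ℕ → ℂ} (hc : ∃ B, ∀ l, ‖c l‖ ≤ B) (ψ : OneParticle) :
    HasSum (fun x : Idx × Idx => (c x.1.1.1 * inner ℂ (Y x.1) (coordMul j (Y x.2)) * ψ x.2) • Y x.1)
      (sphereMultiplier c (coordMul j (expand ψ))) := by
  classical
  obtain ⟨B, hB⟩ := hc
  set K : Idx × Idx → ℂ := fun x => inner ℂ (Y x.1) (coordMul j (Y x.2)) with hK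
  set a : Idx × Idx → ℂ := fun x => c x.1.1.1 * K x * ψ x.2 with ha
  -- Summing over a column first gives ‖r̂_j Y_q‖² ≤ 1, by Bessel's equality, times |ψ_q|².
  have hKsum : Summable fun x : Idx × Idx => ‖K x‖ ^ 2 * ‖ψ x.2‖ ^ 2 := by
    rw [← (Equiv.prodComm Idx Idx).summable_iff]
    have hrow : ∀ q, HasSum (fun p => ‖K (p, q)‖ ^ 2 * ‖ψ q‖ ^ 2)
        (‖coordMul j (Y q)‖ ^ 2 * ‖ψ q‖ ^ 2) := fun q =>
      (hasSum_norm_inner_Y_sq (coordMul j (Y q))).mul_right _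
    refine (summable_prod_of_nonneg fun x => mul_nonneg (sq_nonneg _) (sq_nonneg _)).2 ⟨fun q => (hrow q).summable, ?_⟩
    refine Summable.of_nonneg_of_le (fun q => tsum_nonneg fun p =>
      mul_nonneg (sq_nonneg _) (sq_nonneg _)) (fun q => ?_)
      (summable_norm_sq ψ)
    change ∑' p, ‖K (p, q)‖ ^ 2 * ‖ψ q‖ ^ 2 ≤ _
    rw [(hrow q).tsum_eq]
    have h1 : ‖coordMul j (Y q)‖ ≤ 1 := (norm_coordMul_le j _).trans (norm_Y q).le
    have h2 : ‖coordMul j (Y q)‖ ^ 2 ≤ 1 := pow_le_one₀ (norm_nonneg _) h1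
    exact mul_le_of_le_one_left (by positivity) h2
  have hasum : Summable fun x => ‖a x‖ ^ 2 := by
    refine Summable.of_nonneg_of_le (fun x => by positivity) (fun x => ?_) (hKsum.mul_left (B ^ 2))
    simp only [ha, norm_mul, mul_pow]
    rw [mul_assoc]
    gcongr
    exact hB _
  -- Degree and order each change by at most one, so an entry of row p is fixed by a pair of
  -- differences in {-1, 0, 1}: at most nine.
  have hband : ∀ (p : Idx) (s : Finset (Idx × Idx)), (∀ x ∈ s, x.1 = p ∧ a x ≠ 0) →
      s.card ≤ 9 := by
    intro p s hs
    have hmem : ∀ x ∈ s, ((x.2.1.1 : ℤ) - p.1.1, x.2.1.2 - p.1.2) ∈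
        Finset.Icc (-1 : ℤ) 1 ×ˢ Finset.Icc (-1 : ℤ) 1 := by
      intro x hx
      obtain ⟨h1, h2⟩ := hs x hx
      have h3 : K x ≠ 0 := fun h => h2 (by simp [ha, h])
      have h4 := not_imp_comm.1 (inner_Y_coordMul_Y_eq_zero j) h3
      rw [h1] at h4
      simp only [Finset.mem_product, Finset.mem_Icc]
      omega
    have hinj : Set.InjOn (fun x : Idx × Idx => ((x.2.1.1 : ℤ) - p.1.1, x.2.1.2 - p.1.2)) s := by
      intro x hx x' hx' h
      simp only [Prod.mk.injEq] at h
      have h1 := (hs x hx).1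
      have h1' := (hs x' hx').1
      refine Prod.ext (h1.trans h1'.symm) (Subtype.ext (Prod.ext ?_ ?_))
      · omega
      · omega
    exact (Finset.card_le_card_of_injOn _ hmem hinj).trans (by simp)
  have hsum := summable_smul_of_banded orthonormal_Y hband hasum
  -- Convergence being known, the sum is identified through its coefficients; row p reduces to the
  -- expansion of ψ pushed through the bounded operator r̂_j.
  have hval : sphereMultiplier c (coordMul j (expand ψ)) = ∑' x, a x • Y x.1 := by
    refine L2_ext fun p => ?_
    rw [inner_Y_sphereMultiplier ⟨B, hB⟩, ← coordMulL_apply]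
    have h1 : HasSum (fun q => a (p, q)) (c p.1.1 * inner ℂ (Y p) (coordMulL j (expand ψ))) := by
      have h2 := (((hasSum_expand ψ).mapL (coordMulL j)).mapL (innerSL ℂ (Y p))).mul_left (c p.1.1)
      refine (hasSum_congr_terms fun q => ?_).1 h2
      rw [map_smul, map_smul, innerSL_apply_apply, coordMulL_apply, smul_eq_mul]
      simp only [ha, hK]
      ring
    have h2 : HasSum (fun x : Idx × Idx => if x.1 = p then a x else 0)
        (c p.1.1 * inner ℂ (Y p) (coordMulL j (expand ψ))) := by
      have hinj : Function.Injective fun q : Idx => (p, q) := fun q q' h => (Prod.mk.inj h).2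
      rw [← hinj.hasSum_iff]
      · simpa [Function.comp_def] using h1
      · rintro ⟨p', q⟩ hx
        refine if_neg fun h => hx ⟨q, ?_⟩
        rw [← h]
    have h3 := hsum.hasSum.mapL (innerSL ℂ (Y p))
    have h4 : HasSum (fun x : Idx × Idx => if x.1 = p then a x else 0)
        (inner ℂ (Y p) (∑' x, a x • Y x.1)) := by
      refine (hasSum_congr_terms fun x => ?_).1 h3
      rw [map_smul, innerSL_apply_apply, orthonormal_iff_ite.1 orthonormal_Y, smul_eq_mul]
      by_cases hx : x.1 = p
      · rw [if_pos hx, if_pos hx.symm, mul_one]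
      · rw [if_neg hx, if_neg (Ne.symm hx), mul_zero]
    exact h2.unique h4
  rw [hval]
  exact hsum.hasSum

/-- In the matrix of W_t⁻¹ r̂_j W_t the incoming phase e^{-iζ_l} remains, while the outgoing phase
cancels that of the time factor and leaves |R_p| = 1/√(2aω_p). -/
theorem hasSum_positionOp {α y : ℝ} {ν : ℂ} (hα : 0 < α) (h : (ν + 1 / 2) ^ 2 = y) (hy : y < 1)
    (hy0 : y ≠ 0) (hre : -(1 / 2) ≤ ν.re) (j : Fin 3) (t : ℝ) (φ : OneParticle) :
    HasSum (fun q : Idx × Idx =>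
      ((-1 : ℂ) ^ q.1.1.2 * φ q.2 * Complex.exp (-Complex.I * (modeAngle α y q.2.1.1 t : ℂ)) *
        (Real.sqrt ((2 * q.2.1.1 + 1) * (2 * q.1.1.1 + 1) /
          (2 * scale α t * omegaDS α ν q.1.1.1 t)) : ℂ) *
        (wigner3j 1 q.2.1.1 q.1.1.1 0 0 0 : ℂ) *
        dipole3j j q.2.1.1 q.1.1.1 q.2.1.2 q.1.1.2) • Y q.1)
      (field α ν (positionOp (localization α y t) j φ) t) := by
  have hr : ∀ l t, radial α ν l t = modeRadial α y l t := radial_eq hα h hy hy0 hre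
  have hpos : positionOp (localization α y t) j φ =
      (localization α y t).symm (coordMul j (localization α y t φ)) := rfl
  obtain ⟨B, hB⟩ := modeRadial_bounded_at hα hy t
  rw [hpos, field_localization_symm hα hy hr, localization_apply, sphereMultiplier_expand]
  have hc : ∃ B, ∀ l, ‖conj (modePhase α y l t) * modeRadial α y l t‖ ≤ B :=
    ⟨B, fun l => by rw [norm_mul, Complex.norm_conj, norm_modePhase, one_mul]; exact hB l⟩
  refine (hasSum_congr_terms fun x => ?_).1 (hasSum_coordMul j hc _)
  congr 1
  have hsqrt : Real.sqrt ((2 * x.2.1.1 + 1) * (2 * x.1.1.1 + 1) *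
      ‖modeRadial α y x.1.1.1 t‖ ^ 2) = Real.sqrt ((2 * x.2.1.1 + 1) * (2 * x.1.1.1 + 1)) *
      ‖modeRadial α y x.1.1.1 t‖ := by
    rw [Real.sqrt_mul (by positivity), Real.sqrt_sq (norm_nonneg _)]
  rw [multiplier_apply (modePhase_bounded α y t), conj_modePhase_mul, exp_modeAngle hα hy,
    inner_Y_coordMul_Y, two_mul_scale_mul_omegaDS hα h hy hy0, div_div_eq_mul_div, div_one, hsqrt]
  push_cast
  ring

end DeSitter

end

theorem mainTheorem1 (α ħ ξ : ℝ) (hα : 0 < α) (hħ : 0 < ħ) (ν : ℝ → ℂ)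
    (hν : ∀ m ∈ admissibleMass α ħ ξ, IsDegree (massSq α ħ ξ m) (ν m)) :
    -- the positive-energy modes are an orthonormal basis of the one-particle space, whose
    -- vectors are solutions, and on which spatial isometries and time reversal act
    (∀ m ∈ admissibleMass α ħ ξ,
      (∀ (l : ℕ) (t : ℝ), timeT α (ν m) l t ≠ 0) ∧
      (∀ (t : ℝ) (p q : Idx),
        kgForm α t (mode α (ν m) p) (mode α (ν m) q) = if p = q then 1 else 0) ∧
      (∀ (φ : OneParticle) (t : ℝ),
        HasSum (fun p : Idx => (φ p * radial α (ν m) p.1.1 t) • Y p) (field α (ν m) φ t)) ∧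
      Function.Injective (field α (ν m)) ∧
      (∀ (g : Space ≃ₗᵢ[ℝ] Space) (φ : OneParticle), ∃ ψ : OneParticle,
        ∀ t, field α (ν m) ψ t = sphereAct g (field α (ν m) φ t)) ∧
      (∀ φ : OneParticle, ∃ ψ : OneParticle,
        ∀ t, field α (ν m) ψ t = star (field α (ν m) φ (-t)))) ∧
    -- the postulates determine the transformations up to phases, and at time zero completely
    (∀ W : ℝ → ℝ → (OneParticle ≃ₗᵢ[ℂ] L2Sphere), LocalizationPostulates α ħ ξ ν W →
      ∀ m ∈ admissibleMass α ħ ξ, ∃ s : ℕ → ℝ → ℂ,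
        (∀ (p : Idx) (t : ℝ), W m t (modeVec p) = s p.1.1 t • Y p) ∧
        (∀ l t, ‖s l t‖ = 1 ∧ s l (-t) = (starRingEnd ℂ) (s l t)) ∧
        (∀ l, s l 0 = (-1) ^ l)) ∧
    -- uniqueness of the transformation and of the position operator at time zero
    (∀ W W' : ℝ → ℝ → (OneParticle ≃ₗᵢ[ℂ] L2Sphere),
      LocalizationPostulates α ħ ξ ν W → LocalizationPostulates α ħ ξ ν W' →
      ∀ m ∈ admissibleMass α ħ ξ,
        W m 0 = W' m 0 ∧ ∀ j, positionOp (W m 0) j = positionOp (W' m 0) j) ∧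
    -- the explicit family satisfies the postulates, with its phases and position operators
    (∃ W : ℝ → ℝ → (OneParticle ≃ₗᵢ[ℂ] L2Sphere), LocalizationPostulates α ħ ξ ν W ∧
      ∀ m ∈ admissibleMass α ħ ξ,
        (∀ (t : ℝ) (φ : OneParticle),
          HasSum (fun p : Idx =>
            ((Real.sqrt (2 * scale α t * omegaDS α (ν m) p.1.1 t) : ℂ) * φ p *
              radial α (ν m) p.1.1 t) • Y p) (W m t φ)) ∧
        ∃ ζ : ℕ → ℝ → ℝ,
          (∀ l t, (ζ l t : Real.Angle) =
            -((Complex.arg (timeFactor α (ν m) l t) : ℝ) : Real.Angle)) ∧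
          (∀ l t, HasDerivAt (ζ l) (omegaDS α (ν m) l t / scale α t) t) ∧
          (∀ (p : Idx) (t : ℝ),
            W m t (modeVec p) = Complex.exp (-Complex.I * (ζ p.1.1 t : ℂ)) • Y p) ∧
          (∀ (j : Fin 3) (t : ℝ) (φ : OneParticle),
            HasSum (fun q : Idx × Idx =>
              ((-1 : ℂ) ^ q.1.1.2 * φ q.2 * Complex.exp (-Complex.I * (ζ q.2.1.1 t : ℂ)) *
                (Real.sqrt ((2 * q.2.1.1 + 1) * (2 * q.1.1.1 + 1) /
                  (2 * scale α t * omegaDS α (ν m) q.1.1.1 t)) : ℂ) *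
                (wigner3j 1 q.2.1.1 q.1.1.1 0 0 0 : ℂ) *
                dipole3j j q.2.1.1 q.1.1.1 q.2.1.2 q.1.1.2) • Y q.1)
              (field α (ν m) (positionOp (W m t) j φ) t))) := by
  have hy : ∀ m ∈ admissibleMass α ħ ξ, 1 - massSq α ħ ξ m < 1 := fun m hm =>
    one_sub_massSq_lt hm.1
  have hr : ∀ m ∈ admissibleMass α ħ ξ, ∀ l t,
      radial α (ν m) l t = modeRadial α (1 - massSq α ħ ξ m) l t := fun m hm =>
    radial_eq_modeRadial hα hm (hν m hm)
  refine ⟨fun m hm => ⟨fun l t => ?_, fun t p q => ?_, fun φ t => ?_, ?_, fun g φ => ?_,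
    fun φ => ?_⟩, fun W hW m hm => postulates_determine_phases hα hħ hν hW hm,
    fun W W' hW hW' m hm => ?_, ?_⟩
  · exact timeT_ne_zero α (degree_sq (hν m hm)) (hy m hm) (one_sub_massSq_ne hm) l t
  · exact kgForm_mode hα (hy m hm) (hr m hm) t p q
  · exact hasSum_field hα (hy m hm) (hr m hm) φ t
  · exact field_injective hα (hy m hm) (hr m hm)
  · exact ⟨_, fun t => field_sphereAct hα (hy m hm) (hr m hm) g φ t⟩
  · exact ⟨_, fun t => field_star hα (hy m hm) (hr m hm) φ t⟩
  · have h := unique_at_zero hα hħ hν hW hW' hm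
    exact ⟨h, fun j => by rw [h]⟩
  · refine ⟨_, localizationPostulates_localization hα hħ hν, fun m hm => ⟨fun t φ => ?_,
      fun l t => modeAngle α (1 - massSq α ħ ξ m) l t, fun l t => ?_, fun l t => ?_,
      fun p t => ?_, fun j t φ => ?_⟩⟩
    · exact hasSum_localization hα (degree_sq (hν m hm)) (hy m hm) (one_sub_massSq_ne hm)
        (hν m hm).2 t φ
    · rw [modeAngle_eq_neg_arg hα (hy m hm), arg_timeFactor hα (degree_sq (hν m hm)) (hy m hm)
        (one_sub_massSq_ne hm) (hν m hm).2]
    · rw [omegaDS_div_scale hα (degree_sq (hν m hm)) (hy m hm) (one_sub_massSq_ne hm)]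
      exact hasDerivAt_modeAngle hα (hy m hm) l t
    · rw [localization_modeVec, exp_modeAngle hα (hy m hm)]
    · exact hasSum_positionOp hα (degree_sq (hν m hm)) (hy m hm) (one_sub_massSq_ne hm)
        (hν m hm).2 j t φ
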